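/- Let $\Bbbk$ be a commutative unital ring. An \emph{algebra} is a monoid in the monoidal category of $\mathbb Z$-graded (homological) chain complexes of $\Bbbk$-modules, i.e. a differential graded $\Bbbk$-algebra. Let $\mathsf{sSet}^0$ be the category of reduced simplicial sets (simplicial sets with exactly one $0$-simplex). \textbf{Adams' side.} For $X\in\mathsf{sSet}^0$ let $C^\triangle_A(X)$ be the normalized chains of $X$ with coefficients in $\Bbbk$, with $\partial x=\sum_i(-1)^i\delta_i x$, the Alexander--Whitney coproduct $[v_0,\dots,v_q]\mapsto\sum_i[v_0,\dots,v_i]\otimes[v_i,\dots,v_q]$, the usual augmentation, and the coaugmentation given by the unique $0$-simplex. For a coaugmented differential graded coalgebra $(C,\partial,\Delta,\varepsilon,\nu)$ with $\overline C=\operatorname{coker}\nu$, the cobar construction $\Omega C$ is the tensor algebra $T(s^{-1}\overline C)$ whose differential is the derivation extending $-s^{-1}\partial s+(s^{-1}\otimes s^{-1})\Delta s$, where $(s^{-1}\otimes s^{-1})(a\otimes b)=(-1)^{|a|}s^{-1}a\otimes s^{-1}b$. \textbf{Baues' side.} Let $\square$ be the cube category: its objects are the sets $2^n=\{0,1\}^n$,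 its morphisms are generated by the cofaces $\delta_i^0,\delta_i^1$ (insert $0$, respectively $1$, as $i$-th coordinate), the codegeneracies $\sigma_i$ (omit a coordinate) and the coconnections $\gamma_i$ (replace two adjacent coordinates by their maximum). Let $\mathsf{Nec}$ be the category of necklaces $T=[n_1]\vee\dots\vee[n_k]$ with $n_i>0$, $k\ge 0$ (for $k=0$, $T=[0]$), identified with a full subcategory of double pointed simplicial sets through $\mathcal S(T)=\triangle^{n_1}\vee\dots\vee\triangle^{n_k}$, pointed by its first and last vertex; it is monoidal under concatenation $\vee$. Put $\dim T=n_1+\dots+n_k-k$. The presheaf categories $\mathsf{cSet}$ on $\square$ and $\mathsf{nSet}$ on $\mathsf{Nec}$ carry Day convolution. Let $\mathcal P\colon\mathsf{Nec}\to\square$ be the monoidal functor with $\mathcal P(T)=2^{\dim T}$ that sends the coface $[n]\to[n+1]$ omitting an inner vertex $j$ to $\delta^0_j$, the map $[j]\vee[n+1-j]\to[n+1]$ to $\delta^1_j$, the codegeneracy $s^j\colon[n+1]\to[n]$, $n>0$, to $\gamma_j$ for $0<j<n$, to the first codegeneracy $\sigma_1$ for $j=0$ and to the last codegeneracy $\sigma_n$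 for $j=n$, and $[1]\to[0]$ to the identity. Let $\mathcal P_!\colon\mathsf{nSet}\to\mathsf{cSet}$ be left Kan extension along $\mathcal P$; it is monoidal. For $X\in\mathsf{sSet}^0$, the necklical set $\Omega_{nec}(X)=\operatorname{colim}_{\mathcal S(T)\to X}\mathsf{Nec}(-,T)$, i.e. $T\mapsto\operatorname{Hom}(\mathcal S(T),X)$, is a monoid in $\mathsf{nSet}$ under concatenation, and $\Omega_\square(X)=\mathcal P_!\,\Omega_{nec}(X)$ is the resulting monoid in $\mathsf{cSet}$. For a cubical set $Y$ let $C^\square(Y)$ be its normalized chains: in degree $n$ the free $\Bbbk$-module on $Y_n$ modulo the images of the degeneracies and connections, with $\partial y=\sum_{i=1}^n(-1)^i(\delta_i^1-\delta_i^0)y$; this functor is monoidal, so it carries monoids in $\mathsf{cSet}$ to algebras. \textbf{Lemma.} There is an isomorphism of functors from reduced simplicial sets to algebras $$C^\square\,\Omega_\square\;\cong\;\Omega\,C^\triangle_A\colon\ \mathsf{sSet}^0\longrightarrow\mathsf{Mon}_{\mathsf{Ch}},$$ that is, there are isomorphisms of differential graded algebras $C^\square(\Omega_\square X)\cong\Omega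 C^\triangle_A(X)$, natural in the reduced simplicial set $X$. -/

import Mathlib

open CategoryTheory MonoidalCategory Opposite
open scoped TensorProduct

universe u v w

noncomputable section

namespace CubicalCobar

section

section Graded

variable {k : Type v} [CommRing k]

/-- The linear map out of a `ℤ`-graded module with prescribed restrictions to the homogeneous
components. -/
def gradedLift {M : Type w} [AddCommGroup M] [Module k M] {N : Type*} [AddCommMonoid N] [Module k N]
    {𝒜 : ℤ → Submodule k M} (h : DirectSum.IsInternal 𝒜) (f : ∀ n, 𝒜 n →ₗ[k] N) : M →ₗ[k] N :=
  letI := h.chooseDecomposition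
  DirectSum.toModule k ℤ N f ∘ₗ (DirectSum.decomposeLinearEquiv 𝒜).toLinearMap

/-- For a `ℤ`-graded module `M = ⨁ Mₙ`, the linear involution acting on `Mₙ` by `(-1)ⁿ`. -/
def signInv {M : Type w} [AddCommGroup M] [Module k M] (𝒜 : ℤ → Submodule k M)
    (h : DirectSum.IsInternal 𝒜) : M →ₗ[k] M :=
  gradedLift h fun n => (n.negOnePow : ℤ) • (𝒜 n).subtype

variable {M : Type w} [AddCommGroup M] [Module k M]

lemma gradedLift_of_mem {N : Type*} [AddCommMonoid N] [Module k N]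
    {𝒜 : ℤ → Submodule k M} (h : DirectSum.IsInternal 𝒜) (f : ∀ n, 𝒜 n →ₗ[k] N) {n : ℤ} {x : M}
    (hx : x ∈ 𝒜 n) : gradedLift h f x = f n ⟨x, hx⟩ := by
  let := h.chooseDecomposition
  simp only [gradedLift, LinearMap.comp_apply, LinearEquiv.coe_coe,
    DirectSum.decomposeLinearEquiv_apply]
  rw [DirectSum.decompose_of_mem 𝒜 hx]
  exact DirectSum.toModule_lof k n _

lemma signInv_of_mem {𝒜 : ℤ → Submodule k M} (h : DirectSum.IsInternal 𝒜) {n : ℤ} {x : M}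
    (hx : x ∈ 𝒜 n) : signInv 𝒜 h x = (n.negOnePow : ℤ) • x := by
  simp [signInv, gradedLift_of_mem h _ hx]

/-- A linear map out of a graded module is determined by its values on homogeneous elements. -/
lemma graded_ext {N : Type*} [AddCommMonoid N] [Module k N] {𝒜 : ℤ → Submodule k M}
    (h : DirectSum.IsInternal 𝒜) {f g : M →ₗ[k] N} (H : ∀ n, ∀ x ∈ 𝒜 n, f x = g x) : f = g := by
  have : (⊤ : Submodule k M) ≤ LinearMap.eqLocus f g := by
    rw [← h.submodule_iSup_eq_top]
    exact iSup_le fun n x hx => H n x hx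
  ext x
  exact this (Submodule.mem_top (x := x))

lemma isInternal_of_proj {𝒜 : ℤ → Submodule k M} (π : ℤ → M →ₗ[k] M)
    (h1 : ∀ n, ∀ x ∈ 𝒜 n, π n x = x) (h0 : ∀ m n, m ≠ n → ∀ x ∈ 𝒜 m, π n x = 0)
    (htop : ⨆ n, 𝒜 n = ⊤) : DirectSum.IsInternal 𝒜 := by
  refine DirectSum.isInternal_submodule_of_iSupIndep_of_iSup_eq_top (fun n => ?_) htop
  rw [Submodule.disjoint_def]
  intro x hx hx'
  have : ⨆ m, ⨆ (_ : m ≠ n), 𝒜 m ≤ LinearMap.ker (π n) :=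
    iSup₂_le fun m hm x hx => h0 m n hm x hx
  rw [← h1 n x hx]
  exact this hx'

/-- The linear map induced on a quotient. -/
def descend {M' N : Type*} [AddCommGroup M'] [Module k M'] [AddCommGroup N] [Module k N]
    (p : M →ₗ[k] M') (hp : Function.Surjective p) (f : M →ₗ[k] N)
    (h : LinearMap.ker p ≤ LinearMap.ker f) : M' →ₗ[k] N :=
  (LinearMap.ker p).liftQ f h ∘ₗ (p.quotKerEquivOfSurjective hp).symm.toLinearMap

lemma descend_apply {M' N : Type*} [AddCommGroup M'] [Module k M'] [AddCommGroup N] [Module k N]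
    (p : M →ₗ[k] M') (hp : Function.Surjective p) (f : M →ₗ[k] N)
    (h : LinearMap.ker p ≤ LinearMap.ker f) (x : M) : descend p hp f h (p x) = f x := by
  have : (p.quotKerEquivOfSurjective hp).symm (p x) = Submodule.Quotient.mk x := by
    rw [LinearEquiv.symm_apply_eq]
    rfl
  simp only [descend, LinearMap.comp_apply, LinearEquiv.coe_coe, this]
  exact Submodule.liftQ_apply _ _ _

/-- The quotient of a graded module by a submodule spanned by homogeneous elements is graded. -/
lemma isInternal_quotient {𝒜 : ℤ → Submodule k M} (h : DirectSum.IsInternal 𝒜)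
    {M' : Type*} [AddCommGroup M'] [Module k M'] (p : M →ₗ[k] M') (hp : Function.Surjective p)
    (S : Set M) (hN : LinearMap.ker p = Submodule.span k S)
    (hS : ∀ s ∈ S, ∃ n, s ∈ 𝒜 n) : DirectSum.IsInternal fun n => (𝒜 n).map p := by
  classical
  let π (n : ℤ) : M →ₗ[k] M := gradedLift h fun m => if m = n then (𝒜 m).subtype else 0
  have hπ (m n : ℤ) (x : M) (hx : x ∈ 𝒜 m) : π n x = if m = n then x else 0 := by
    simp only [π, gradedLift_of_mem h _ hx]
    split_ifs <;> rfl
  have hker (n : ℤ) : LinearMap.ker p ≤ LinearMap.ker (p ∘ₗ π n) := by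
    conv_lhs => rw [hN]
    rw [Submodule.span_le]
    intro s hs
    obtain ⟨m, hm⟩ := hS s hs
    have hsN : s ∈ LinearMap.ker p := hN ▸ Submodule.subset_span hs
    rw [LinearMap.mem_ker] at hsN
    simp only [SetLike.mem_coe, LinearMap.mem_ker, LinearMap.comp_apply, hπ m n s hm]
    split_ifs
    exacts [hsN, map_zero p]
  refine isInternal_of_proj (fun n => descend p hp (p ∘ₗ π n) (hker n)) ?_ ?_ ?_
  · rintro n _ ⟨x, hx, rfl⟩
    simp [descend_apply, hπ n n x hx]
  · rintro m n hmn _ ⟨x, hx, rfl⟩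
    simp [descend_apply, hπ m n x hx, hmn]
  · rw [← Submodule.map_iSup, h.submodule_iSup_eq_top, Submodule.map_top,
      LinearMap.range_eq_top.2 hp]

/-- A module with a basis of homogeneous elements is graded. -/
lemma isInternal_basis {Γ : Type*} (b : Module.Basis Γ k M) (deg : Γ → ℤ) :
    DirectSum.IsInternal fun n => Submodule.span k (b '' {c | deg c = n}) := by
  classical
  let π (n : ℤ) : M →ₗ[k] M := b.constr k fun c => if deg c = n then b c else 0
  have hπ (n : ℤ) (c : Γ) : π n (b c) = if deg c = n then b c else 0 := b.constr_basis k _ c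
  refine isInternal_of_proj π ?_ ?_ ?_
  · intro n x hx
    have : Submodule.span k (b '' {c | deg c = n}) ≤ LinearMap.eqLocus (π n) LinearMap.id := by
      rw [Submodule.span_le]
      rintro _ ⟨c, hc, rfl⟩
      simp only [Set.mem_ofPred_eq] at hc
      simp [hπ, hc]
    exact this hx
  · intro m n hmn x hx
    have : Submodule.span k (b '' {c | deg c = m}) ≤ LinearMap.ker (π n) := by
      rw [Submodule.span_le]
      rintro _ ⟨c, hc, rfl⟩
      simp only [Set.mem_ofPred_eq] at hc
      simp [hπ, hc, hmn]
    exact this hx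
  · rw [eq_top_iff, ← b.span_eq, Submodule.span_le]
    rintro _ ⟨c, rfl⟩
    exact Submodule.mem_iSup_of_mem (deg c) (Submodule.subset_span ⟨c, rfl, rfl⟩)

end Graded

/-! ### Differential graded algebras, i.e. monoids in chain complexes -/

/-- A differential (homologically) graded `k`-algebra: a `k`-algebra `A = ⨁ Aₙ`, graded by `ℤ`,
with a differential of degree `-1` that satisfies the graded Leibniz rule. -/
structure DGAlg (k : Type v) [CommRing k] where
  carrier : Type w
  [ring : Ring carrier]
  [algebra : Algebra k carrier]
  grading : ℤ → Submodule k carrier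
  isInternal : DirectSum.IsInternal grading
  one_mem : (1 : carrier) ∈ grading 0
  mul_mem : ∀ {m n : ℤ} {x y : carrier}, x ∈ grading m → y ∈ grading n → x * y ∈ grading (m + n)
  d : carrier →ₗ[k] carrier
  d_mem : ∀ {n : ℤ} {x : carrier}, x ∈ grading n → d x ∈ grading (n - 1)
  d_d : ∀ x, d (d x) = 0
  leibniz : ∀ {n : ℤ} {x : carrier} (y : carrier), x ∈ grading n →
    d (x * y) = d x * y + (n.negOnePow : ℤ) • (x * d y)

namespace DGAlg

variable {k : Type v} [CommRing k]

attribute [instance] ring algebra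

/-- Morphisms of differential graded algebras: algebra maps that preserve degrees and commute with
the differentials. -/
@[ext]
structure Hom (A B : DGAlg.{v, w} k) where
  toAlgHom : A.carrier →ₐ[k] B.carrier
  map_mem : ∀ {n : ℤ} {x : A.carrier}, x ∈ A.grading n → toAlgHom x ∈ B.grading n
  map_d : ∀ x, toAlgHom (A.d x) = B.d (toAlgHom x)

instance : Category (DGAlg.{v, w} k) where
  Hom := Hom
  id A := ⟨AlgHom.id k A.carrier, fun h => h, fun _ => rfl⟩
  comp f g := ⟨g.toAlgHom.comp f.toAlgHom, fun h => g.map_mem (f.map_mem h), fun x => by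
    simp [f.map_d, g.map_d]⟩

end DGAlg

/-! ### Coaugmented differential graded coalgebras -/

/-- A coaugmented differential graded `k`-coalgebra: a `k`-coalgebra `C = ⨁ Cₙ`, graded by `ℤ`,
with a differential of degree `-1` such that the coproduct `Δ : C → C ⊗ C`, the counit `ε : C → k`
and the coaugmentation `ν : k → C` are chain maps (`k` being concentrated in degree `0`), and `ν` is
a map of coalgebras. -/
structure CoaugDGCoalg (k : Type v) [CommRing k] where
  carrier : Type w
  [addCommGroup : AddCommGroup carrier]
  [module : Module k carrier]
  [coalgebra : Coalgebra k carrier]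
  grading : ℤ → Submodule k carrier
  isInternal : DirectSum.IsInternal grading
  counit_of_ne : ∀ {n : ℤ} {x : carrier}, x ∈ grading n → n ≠ 0 →
    Coalgebra.counit (R := k) x = 0
  comul_mem : ∀ {n : ℤ} {x : carrier}, x ∈ grading n → Coalgebra.comul (R := k) x ∈
    ⨆ (i : ℤ) (j : ℤ) (_ : i + j = n),
      LinearMap.range (TensorProduct.map (grading i).subtype (grading j).subtype)
  d : carrier →ₗ[k] carrier
  d_mem : ∀ {n : ℤ} {x : carrier}, x ∈ grading n → d x ∈ grading (n - 1)
  d_d : ∀ x, d (d x) = 0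
  counit_d : ∀ x, Coalgebra.counit (R := k) (d x) = 0
  comul_d : ∀ x, Coalgebra.comul (R := k) (d x) =
    TensorProduct.map d LinearMap.id (Coalgebra.comul (R := k) x) +
      TensorProduct.map (signInv grading isInternal) d (Coalgebra.comul (R := k) x)
  coaug : k →ₗc[k] carrier
  coaug_mem : coaug 1 ∈ grading 0
  d_coaug : d (coaug 1) = 0

namespace CoaugDGCoalg

variable {k : Type v} [CommRing k]

attribute [instance] addCommGroup module coalgebra

/-- Morphisms: coalgebra maps preserving degrees, differentials and coaugmentations. -/
@[ext]
structure Hom (C D : CoaugDGCoalg.{v, w} k) where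
  toCoalgHom : C.carrier →ₗc[k] D.carrier
  map_mem : ∀ {n : ℤ} {x : C.carrier}, x ∈ C.grading n → toCoalgHom x ∈ D.grading n
  map_d : ∀ x, toCoalgHom (C.d x) = D.d (toCoalgHom x)
  map_coaug : toCoalgHom (C.coaug 1) = D.coaug 1

instance : Category (CoaugDGCoalg.{v, w} k) where
  Hom := Hom
  id C := ⟨CoalgHom.id k C.carrier, fun h => h, fun _ => rfl, rfl⟩
  comp f g := ⟨g.toCoalgHom.comp f.toCoalgHom, fun h => g.map_mem (f.map_mem h), fun x => by
    simp [f.map_d, g.map_d], by simp [f.map_coaug, g.map_coaug]⟩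

end CoaugDGCoalg

end

section

section TensorAlg

variable {k : Type v} [CommRing k] {V : Type w} [AddCommGroup V] [Module k V]

/-- Words `s⁻¹v₁ ⋯ s⁻¹vᵣ` in homogeneous elements of a graded module, with their degree
`Σ (|vᵢ| - 1)`. -/
inductive IsWord (𝒱 : ℤ → Submodule k V) : ℤ → TensorAlgebra k V → Prop where
  | one : IsWord 𝒱 0 1
  | cons {p q : ℤ} {v : V} {x : TensorAlgebra k V} (hv : v ∈ 𝒱 p) (hx : IsWord 𝒱 q x) :
      IsWord 𝒱 (p - 1 + q) (TensorAlgebra.ι k v * x)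

/-- The grading of `T(s⁻¹V)`. -/
def wordGrading (𝒱 : ℤ → Submodule k V) (n : ℤ) : Submodule k (TensorAlgebra k V) :=
  Submodule.span k {x | IsWord 𝒱 n x}

variable {𝒱 : ℤ → Submodule k V}

lemma IsWord.mul {p q : ℤ} {x y : TensorAlgebra k V} (hx : IsWord 𝒱 p x) (hy : IsWord 𝒱 q y) :
    IsWord 𝒱 (p + q) (x * y) := by
  induction hx with
  | one => simpa using hy
  | cons hv _ ih => rw [mul_assoc, add_assoc]; exact .cons hv ih

lemma wordGrading_one_mem : (1 : TensorAlgebra k V) ∈ wordGrading 𝒱 0 :=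
  Submodule.subset_span .one

lemma wordGrading_mul_mem {p q : ℤ} {x y : TensorAlgebra k V} (hx : x ∈ wordGrading 𝒱 p)
    (hy : y ∈ wordGrading 𝒱 q) : x * y ∈ wordGrading 𝒱 (p + q) := by
  have := Submodule.mul_mem_mul hx hy
  rw [wordGrading, wordGrading, Submodule.span_mul_span] at this
  refine Submodule.span_mono ?_ this
  rintro _ ⟨a, ha, b, hb, rfl⟩
  exact ha.mul hb

lemma ι_mem_wordGrading {p : ℤ} {v : V} (hv : v ∈ 𝒱 p) :
    TensorAlgebra.ι k v ∈ wordGrading 𝒱 (p - 1) := by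
  have := IsWord.cons hv .one
  rw [mul_one, add_zero] at this
  exact Submodule.subset_span this

instance : SetLike.GradedMonoid (wordGrading 𝒱) where
  one_mem := wordGrading_one_mem
  mul_mem _ _ _ _ hx hy := wordGrading_mul_mem hx hy

lemma isInternal_wordGrading (h : DirectSum.IsInternal 𝒱) :
    DirectSum.IsInternal (wordGrading 𝒱) := by
  let j (p : ℤ) : 𝒱 p →ₗ[k] wordGrading 𝒱 (p - 1) :=
    ((TensorAlgebra.ι k) ∘ₗ (𝒱 p).subtype).codRestrict _ fun v => ι_mem_wordGrading v.2
  let F : TensorAlgebra k V →ₐ[k] DirectSum ℤ (fun n => wordGrading 𝒱 n) :=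
    TensorAlgebra.lift k (gradedLift h fun p =>
      DirectSum.lof k ℤ (fun n => wordGrading 𝒱 n) (p - 1) ∘ₗ j p)
  have hι (p : ℤ) (v : V) (hv : v ∈ 𝒱 p) : F (TensorAlgebra.ι k v) =
      DirectSum.of (fun n => wordGrading 𝒱 n) (p - 1) ⟨TensorAlgebra.ι k v, ι_mem_wordGrading hv⟩ := by
    simp only [F, TensorAlgebra.lift_ι_apply, gradedLift_of_mem h _ hv]
    rfl
  have hw (n : ℤ) (x : TensorAlgebra k V) (hx : IsWord 𝒱 n x) : F x =
      DirectSum.of (fun n => wordGrading 𝒱 n) n ⟨x, Submodule.subset_span hx⟩ := by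
    induction hx with
    | one => rw [map_one]; rfl
    | cons hv hx ih => rw [map_mul, hι _ _ hv, ih, DirectSum.of_mul_of]; rfl
  let G : GradedAlgebra (wordGrading 𝒱) := GradedAlgebra.ofAlgHom (wordGrading 𝒱) F
    (by
      apply TensorAlgebra.hom_ext
      refine graded_ext h fun p v hv => ?_
      simp [hι p v hv])
    (by
      rintro n ⟨x, hx⟩
      dsimp only
      induction hx using Submodule.span_induction with
      | mem x hx => exact hw n x hx
      | zero => simp only [map_zero]; exact (map_zero (DirectSum.of (fun n => wordGrading 𝒱 n) n)).symm
      | add x y hx hy h1 h2 => rw [map_add, h1, h2, ← map_add]; rfl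
      | smul a x hx h1 =>
        rw [map_smul, h1]
        exact (map_smul (DirectSum.lof k ℤ (fun n => wordGrading 𝒱 n) n) a ⟨x, hx⟩).symm)
  exact G.toDecomposition.isInternal

/-- The algebra involution of `T(s⁻¹V)` acting on elements of degree `n` by `(-1)ⁿ`. -/
def wordSign (h : DirectSum.IsInternal 𝒱) : TensorAlgebra k V →ₐ[k] TensorAlgebra k V :=
  TensorAlgebra.lift k (-(TensorAlgebra.ι k ∘ₗ signInv 𝒱 h))

lemma wordSign_of_mem (h : DirectSum.IsInternal 𝒱) {n : ℤ} {x : TensorAlgebra k V}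
    (hx : x ∈ wordGrading 𝒱 n) : wordSign h x = (n.negOnePow : ℤ) • x := by
  induction hx using Submodule.span_induction with
  | mem x hx =>
    induction hx with
    | one => simp
    | cons hv hx ih =>
      rw [map_mul, ih]
      simp only [wordSign, TensorAlgebra.lift_ι_apply, LinearMap.neg_apply, LinearMap.comp_apply,
        signInv_of_mem h hv, map_zsmul, Int.negOnePow_add, Int.negOnePow_sub, Int.negOnePow_one]
      simp only [Units.val_mul, Units.val_neg, smul_mul_assoc, mul_smul_comm,
        neg_mul, mul_neg, mul_one, neg_smul, smul_neg, mul_smul]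
      rw [smul_comm]
  | zero => simp
  | add x y _ _ h1 h2 => rw [map_add, h1, h2, smul_add]
  | smul a x _ h1 => rw [map_smul, h1, smul_comm]

/-- The algebra map `x ↦ !![±x, D x; 0, x]` encoding the derivation `D` that extends `f`. -/
def derivMat (h : DirectSum.IsInternal 𝒱) (f : V →ₗ[k] TensorAlgebra k V) :
    TensorAlgebra k V →ₐ[k] Matrix (Fin 2) (Fin 2) (TensorAlgebra k V) :=
  TensorAlgebra.lift k
    { toFun := fun v => !![wordSign h (TensorAlgebra.ι k v), f v; 0, TensorAlgebra.ι k v]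
      map_add' := fun v w => by ext i j; fin_cases i <;> fin_cases j <;> simp
      map_smul' := fun a v => by ext i j; fin_cases i <;> fin_cases j <;> simp }

/-- The extension of a linear map `f : s⁻¹V → T(s⁻¹V)` of degree `-1` to a derivation of `T(s⁻¹V)`:
the linear map `D` with `D(s⁻¹v) = f(v)` and `D(xy) = D(x)y + (-1)^{|x|} x D(y)`. -/
def derivExt (h : DirectSum.IsInternal 𝒱) (f : V →ₗ[k] TensorAlgebra k V) :
    TensorAlgebra k V →ₗ[k] TensorAlgebra k V :=
  Matrix.entryLinearMap k (TensorAlgebra k V) (0 : Fin 2) (1 : Fin 2) ∘ₗ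
    (derivMat h f).toLinearMap

section derivExt

variable (h : DirectSum.IsInternal 𝒱) (f : V →ₗ[k] TensorAlgebra k V)

lemma derivExt_ι (v : V) : derivExt h f (TensorAlgebra.ι k v) = f v := by
  simp [derivExt, derivMat]

lemma derivMat_apply (x : TensorAlgebra k V) :
    derivMat h f x 0 0 = wordSign h x ∧ derivMat h f x 1 0 = 0 ∧ derivMat h f x 1 1 = x := by
  induction x using TensorAlgebra.induction with
  | algebraMap r => simp [AlgHom.commutes, Matrix.algebraMap_matrix_apply]
  | ι v => simp [derivMat]
  | mul x y hx hy => simp [Matrix.mul_apply, hx, hy]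
  | add x y hx hy => simp [hx, hy]

lemma derivExt_mul (x y : TensorAlgebra k V) :
    derivExt h f (x * y) = derivExt h f x * y + wordSign h x * derivExt h f y := by
  obtain ⟨hx, -, -⟩ := derivMat_apply h f x
  obtain ⟨-, -, hy⟩ := derivMat_apply h f y
  simp [derivExt, Matrix.mul_apply, hx, hy, add_comm]

lemma derivExt_one : derivExt h f 1 = 0 := by
  simp [derivExt]

lemma derivExt_mem (hf : ∀ p, ∀ v ∈ 𝒱 p, f v ∈ wordGrading 𝒱 (p - 2)) {n : ℤ}
    {x : TensorAlgebra k V} (hx : x ∈ wordGrading 𝒱 n) :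
    derivExt h f x ∈ wordGrading 𝒱 (n - 1) := by
  induction hx using Submodule.span_induction with
  | mem x hx =>
    induction hx with
    | one => rw [derivExt_one]; exact zero_mem _
    | @cons p q v x hv hx ih =>
      rw [derivExt_mul, derivExt_ι, wordSign_of_mem h (ι_mem_wordGrading hv), smul_mul_assoc]
      refine add_mem ?_ (zsmul_mem ?_ _)
      · have := wordGrading_mul_mem (hf p v hv) (Submodule.subset_span hx)
        rwa [show p - 2 + q = p - 1 + q - 1 by ring] at this
      · have := wordGrading_mul_mem (ι_mem_wordGrading (𝒱 := 𝒱) hv) ih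
        rwa [show p - 1 + (q - 1) = p - 1 + q - 1 by ring] at this
  | zero => rw [map_zero]; exact zero_mem _
  | add x y _ _ h1 h2 => rw [map_add]; exact add_mem h1 h2
  | smul a x _ h1 => rw [map_smul]; exact Submodule.smul_mem _ _ h1

lemma derivExt_derivExt (hf : ∀ p, ∀ v ∈ 𝒱 p, f v ∈ wordGrading 𝒱 (p - 2))
    (hff : ∀ v, derivExt h f (f v) = 0) (x : TensorAlgebra k V) :
    derivExt h f (derivExt h f x) = 0 := by
  suffices derivExt h f ∘ₗ derivExt h f = 0 from LinearMap.congr_fun this x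
  refine graded_ext (isInternal_wordGrading h) fun n x hx => ?_
  simp only [LinearMap.comp_apply, LinearMap.zero_apply]
  induction hx using Submodule.span_induction with
  | mem x hx =>
    induction hx with
    | one => rw [derivExt_one, map_zero]
    | @cons p q v x hv hx ih =>
      rw [derivExt_mul, derivExt_ι, map_add, derivExt_mul, derivExt_mul, hff, ih,
        wordSign_of_mem h (ι_mem_wordGrading hv), wordSign_of_mem h (hf p v hv), map_zsmul,
        derivExt_ι, show p - 1 = p - 2 + 1 by ring, Int.negOnePow_succ]
      simp
  | zero => simp
  | add x y _ _ h1 h2 => rw [map_add, map_add, h1, h2, add_zero]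
  | smul a x _ h1 => rw [map_smul, map_smul, h1, smul_zero]

end derivExt

end TensorAlg

namespace CoaugDGCoalg

variable {k : Type v} [CommRing k] (C : CoaugDGCoalg.{v, w} k)

/-- The cokernel of the coaugmentation. -/
abbrev Bar : Type w := C.carrier ⧸ LinearMap.range (C.coaug : k →ₗ[k] C.carrier)

/-- The projection to the cokernel of the coaugmentation. -/
abbrev toBar : C.carrier →ₗ[k] C.Bar := Submodule.mkQ _

/-- The grading of the cokernel of the coaugmentation. -/
def barGrading (n : ℤ) : Submodule k C.Bar := (C.grading n).map C.toBar

lemma isInternal_barGrading : DirectSum.IsInternal C.barGrading := by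
  refine isInternal_quotient C.isInternal _ (Submodule.mkQ_surjective _) {C.coaug 1} ?_ ?_
  · rw [Submodule.ker_mkQ]
    apply le_antisymm
    · rintro _ ⟨a, rfl⟩
      rw [Submodule.mem_span_singleton]
      exact ⟨a, by rw [← map_smul, smul_eq_mul, mul_one]; rfl⟩
    · rw [Submodule.span_singleton_le_iff_mem]
      exact ⟨1, rfl⟩
  · rintro _ rfl
    exact ⟨0, C.coaug_mem⟩

lemma toBar_coaug (a : k) : C.toBar (C.coaug a) = 0 :=
  (Submodule.Quotient.mk_eq_zero _).2 ⟨a, rfl⟩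

/-- The map `c ↦ s⁻¹c̄` from `C` to `T(s⁻¹C̄)`. -/
def desusp : C.carrier →ₗ[k] TensorAlgebra k C.Bar := TensorAlgebra.ι k ∘ₗ C.toBar

/-- The sign involution of `C`. -/
abbrev sign : C.carrier →ₗ[k] C.carrier := signInv C.grading C.isInternal

/-- The map `c ↦ (s⁻¹ ⊗ s⁻¹)(Δ c) = Σ (-1)^{|c'|} s⁻¹c' ⊗ s⁻¹c''` from `C` to `T(s⁻¹C̄)`; the sign is
the Koszul sign, `s⁻¹` being of degree `-1`. -/
def quadPart : C.carrier →ₗ[k] TensorAlgebra k C.Bar :=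
  LinearMap.mul' k (TensorAlgebra k C.Bar) ∘ₗ
    TensorProduct.map (C.desusp ∘ₗ C.sign) C.desusp ∘ₗ Coalgebra.comul

/-- The linear map `- s⁻¹ ∘ ∂ ∘ s + (s⁻¹ ⊗ s⁻¹) ∘ Δ ∘ s` on `s⁻¹C̄`. -/
def cobarGen : C.Bar →ₗ[k] TensorAlgebra k C.Bar :=
  Submodule.liftQ _ (-(C.desusp ∘ₗ C.d) + C.quadPart) (by
    rintro _ ⟨a, rfl⟩
    have h1 : C.coaug a = a • C.coaug 1 := by rw [← map_smul, smul_eq_mul, mul_one]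
    have h2 : C.quadPart (C.coaug 1) = 0 := by
      have : Coalgebra.comul (R := k) (C.coaug 1) = C.coaug 1 ⊗ₜ[k] C.coaug 1 := by
        rw [← CoalgHomClass.map_comp_comul_apply]
        simp
      simp only [quadPart, LinearMap.comp_apply, this, TensorProduct.map_tmul, desusp, toBar_coaug,
        map_zero, LinearMap.mul'_apply, mul_zero]
    rw [LinearMap.mem_ker]
    change (-(C.desusp ∘ₗ C.d) + C.quadPart) (C.coaug a) = 0
    rw [h1]
    simp [C.d_coaug, h2])

lemma cobarGen_toBar (c : C.carrier) :
    C.cobarGen (C.toBar c) = -C.desusp (C.d c) + C.quadPart c := rfl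

lemma desusp_mem {n : ℤ} {c : C.carrier} (hc : c ∈ C.grading n) :
    C.desusp c ∈ wordGrading C.barGrading (n - 1) :=
  ι_mem_wordGrading (Submodule.mem_map_of_mem hc)

lemma quadPart_mem {n : ℤ} {c : C.carrier} (hc : c ∈ C.grading n) :
    C.quadPart c ∈ wordGrading C.barGrading (n - 2) := by
  have H : (⨆ (i : ℤ) (j : ℤ) (_ : i + j = n),
      LinearMap.range (TensorProduct.map (C.grading i).subtype (C.grading j).subtype)) ≤
      (wordGrading C.barGrading (n - 2)).comap (LinearMap.mul' k (TensorAlgebra k C.Bar) ∘ₗ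
        TensorProduct.map (C.desusp ∘ₗ C.sign) C.desusp) := by
    refine iSup_le fun i => iSup_le fun j => iSup_le fun hij => ?_
    rintro _ ⟨z, rfl⟩
    induction z with
    | zero => simp
    | add x y hx hy => rw [map_add]; exact add_mem hx hy
    | tmul x y =>
      simp only [Submodule.mem_comap, TensorProduct.map_tmul, LinearMap.comp_apply,
        Submodule.subtype_apply, LinearMap.mul'_apply, signInv_of_mem C.isInternal x.2, map_zsmul,
        smul_mul_assoc]
      have := wordGrading_mul_mem (C.desusp_mem x.2) (C.desusp_mem y.2)
      rw [show i - 1 + (j - 1) = n - 2 by rw [← hij]; ring] at this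
      exact zsmul_mem this _
  exact H (C.comul_mem hc)

lemma cobarGen_mem (p : ℤ) (v : C.Bar) (hv : v ∈ C.barGrading p) :
    C.cobarGen v ∈ wordGrading C.barGrading (p - 2) := by
  obtain ⟨c, hc, rfl⟩ := hv
  rw [cobarGen_toBar]
  refine add_mem (neg_mem ?_) (C.quadPart_mem hc)
  have := C.desusp_mem (C.d_mem hc)
  rwa [show p - 1 - 1 = p - 2 by ring] at this

/-- The differential of the cobar construction. -/
def cobarD : TensorAlgebra k C.Bar →ₗ[k] TensorAlgebra k C.Bar :=
  derivExt C.isInternal_barGrading C.cobarGen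

lemma sign_sign (c : C.carrier) : C.sign (C.sign c) = c := by
  suffices C.sign ∘ₗ C.sign = LinearMap.id from LinearMap.congr_fun this c
  refine graded_ext C.isInternal fun n x hx => ?_
  simp only [LinearMap.comp_apply, signInv_of_mem C.isInternal hx, map_zsmul, smul_smul,
    ← Units.val_mul, Int.units_mul_self, LinearMap.id_apply, Units.val_one, one_smul]

lemma sign_d (c : C.carrier) : C.sign (C.d c) = -C.d (C.sign c) := by
  suffices C.sign ∘ₗ C.d = -(C.d ∘ₗ C.sign) from LinearMap.congr_fun this c
  refine graded_ext C.isInternal fun n x hx => ?_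
  simp [signInv_of_mem C.isInternal hx, signInv_of_mem C.isInternal (C.d_mem hx),
    Int.negOnePow_sub]

lemma wordSign_desusp (c : C.carrier) :
    wordSign C.isInternal_barGrading (C.desusp c) = -C.desusp (C.sign c) := by
  suffices (wordSign C.isInternal_barGrading).toLinearMap ∘ₗ C.desusp = -(C.desusp ∘ₗ C.sign) from
    LinearMap.congr_fun this c
  refine graded_ext C.isInternal fun n x hx => ?_
  simp [signInv_of_mem C.isInternal hx, wordSign_of_mem _ (C.desusp_mem hx),
    Int.negOnePow_sub]

lemma comul_sign (c : C.carrier) : Coalgebra.comul (R := k) (C.sign c) =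
    TensorProduct.map C.sign C.sign (Coalgebra.comul (R := k) c) := by
  suffices Coalgebra.comul (R := k) ∘ₗ C.sign =
    TensorProduct.map C.sign C.sign ∘ₗ Coalgebra.comul (R := k) from LinearMap.congr_fun this c
  refine graded_ext C.isInternal fun n x hx => ?_
  simp only [LinearMap.comp_apply, signInv_of_mem C.isInternal hx, map_zsmul]
  have H : (⨆ (i : ℤ) (j : ℤ) (_ : i + j = n),
      LinearMap.range (TensorProduct.map (C.grading i).subtype (C.grading j).subtype)) ≤
      LinearMap.eqLocus ((n.negOnePow : ℤ) • LinearMap.id) (TensorProduct.map C.sign C.sign) := by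
    refine iSup_le fun i => iSup_le fun j => iSup_le fun hij => ?_
    rintro _ ⟨z, rfl⟩
    induction z with
    | zero => simp
    | add x y hx hy => rw [map_add]; exact add_mem hx hy
    | tmul x y =>
      simp only [LinearMap.mem_eqLocus, TensorProduct.map_tmul, Submodule.subtype_apply,
        signInv_of_mem C.isInternal x.2, signInv_of_mem C.isInternal y.2, LinearMap.smul_apply,
        LinearMap.id_apply, ← hij, Int.negOnePow_add, Units.val_mul, mul_smul]
      simp only [← Int.cast_smul_eq_zsmul k, TensorProduct.smul_tmul', TensorProduct.tmul_smul]
      rw [smul_comm]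
  exact H (C.comul_mem hx)

lemma cobarD_desusp (c : C.carrier) :
    C.cobarD (C.desusp c) = -C.desusp (C.d c) + C.quadPart c :=
  derivExt_ι _ _ _

lemma cobarD_mul (x y : TensorAlgebra k C.Bar) : C.cobarD (x * y) =
    C.cobarD x * y + wordSign C.isInternal_barGrading x * C.cobarD y :=
  derivExt_mul _ _ _ _

lemma cobarD_quad (z : C.carrier ⊗[k] C.carrier) :
    C.cobarD (LinearMap.mul' k _ (TensorProduct.map (C.desusp ∘ₗ C.sign) C.desusp z)) =
      LinearMap.mul' k _ (TensorProduct.map (-(C.desusp ∘ₗ C.d ∘ₗ C.sign) + C.quadPart ∘ₗ C.sign)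
        C.desusp z) -
      LinearMap.mul' k _ (TensorProduct.map C.desusp (-(C.desusp ∘ₗ C.d) + C.quadPart) z) := by
  induction z with
  | zero => simp
  | add x y hx hy => simp only [map_add, hx, hy]; abel
  | tmul x y =>
    simp only [TensorProduct.map_tmul, LinearMap.mul'_apply, LinearMap.comp_apply,
      LinearMap.add_apply, LinearMap.neg_apply]
    rw [cobarD_mul, cobarD_desusp, cobarD_desusp, wordSign_desusp, sign_sign, neg_mul, sub_eq_add_neg]

lemma cobarD_gen (c : C.carrier) : C.cobarD (-C.desusp (C.d c) + C.quadPart c) = 0 := by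
  have hτ : C.quadPart ∘ₗ C.sign = LinearMap.mul' k _ ∘ₗ
      TensorProduct.map C.desusp (C.desusp ∘ₗ C.sign) ∘ₗ Coalgebra.comul := by
    ext c
    simp only [quadPart, LinearMap.comp_apply, comul_sign]
    generalize (Coalgebra.comul (R := k) c) = z
    induction z with
    | zero => simp
    | add x y hx hy => simp only [map_add, hx, hy]
    | tmul x y => simp [sign_sign]
  have h1 : C.quadPart (C.d c) =
      -LinearMap.mul' k _ (TensorProduct.map (C.desusp ∘ₗ C.d ∘ₗ C.sign) C.desusp
        (Coalgebra.comul (R := k) c)) +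
      LinearMap.mul' k _ (TensorProduct.map C.desusp (C.desusp ∘ₗ C.d)
        (Coalgebra.comul (R := k) c)) := by
    simp only [quadPart, LinearMap.comp_apply, C.comul_d]
    generalize (Coalgebra.comul (R := k) c) = z
    induction z with
    | zero => simp
    | add x y hx hy => simp only [map_add, neg_add] at hx hy ⊢; rw [add_add_add_comm, hx, hy]; abel
    | tmul x y => simp [sign_sign, sign_d]
  have h2 : LinearMap.mul' k _ (TensorProduct.map (C.quadPart ∘ₗ C.sign) C.desusp
        (Coalgebra.comul (R := k) c)) =
      LinearMap.mul' k _ (TensorProduct.map C.desusp C.quadPart (Coalgebra.comul (R := k) c)) := by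
    have h := Coalgebra.coassoc_apply (R := k) c
    have e1 (z : C.carrier ⊗[k] C.carrier) :
        TensorProduct.map C.desusp C.quadPart z = TensorProduct.map C.desusp
          (LinearMap.mul' k _ ∘ₗ TensorProduct.map (C.desusp ∘ₗ C.sign) C.desusp)
          (Coalgebra.comul.lTensor _ z) := by
      rw [LinearMap.lTensor, ← LinearMap.comp_apply, ← TensorProduct.map_comp]; rfl
    have e2 (z : C.carrier ⊗[k] C.carrier) :
        TensorProduct.map (C.quadPart ∘ₗ C.sign) C.desusp z = TensorProduct.map
          (LinearMap.mul' k _ ∘ₗ TensorProduct.map C.desusp (C.desusp ∘ₗ C.sign)) C.desusp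
          (Coalgebra.comul.rTensor _ z) := by
      rw [LinearMap.rTensor, ← LinearMap.comp_apply, ← TensorProduct.map_comp, hτ]; rfl
    rw [e1, e2, ← h]
    generalize Coalgebra.comul.rTensor C.carrier (Coalgebra.comul (R := k) c) = z
    induction z with
    | zero => simp
    | add x y hx hy => simp only [map_add, hx, hy]
    | tmul x y =>
      induction x with
      | zero => simp
      | add x x' hx hy => simp only [map_add, hx, hy, TensorProduct.add_tmul]
      | tmul x x' => simp [mul_assoc]
  rw [map_add, map_neg, cobarD_desusp, C.d_d, map_zero, neg_zero, zero_add, h1, quadPart,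
    LinearMap.comp_apply, LinearMap.comp_apply, cobarD_quad, TensorProduct.map_add_left,
    TensorProduct.map_add_right, LinearMap.add_apply, LinearMap.add_apply, map_add, map_add, h2]
  simp only [← neg_one_smul k (C.desusp ∘ₗ C.d), ← neg_one_smul k (C.desusp ∘ₗ C.d ∘ₗ C.sign),
    TensorProduct.map_smul_left, TensorProduct.map_smul_right, LinearMap.smul_apply, map_smul]
  simp only [neg_one_smul]
  abel

/-- The cobar construction of a coaugmented differential graded coalgebra. -/
def cobarObj : DGAlg.{v, max v w} k where
  carrier := TensorAlgebra k C.Bar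
  grading := wordGrading C.barGrading
  isInternal := isInternal_wordGrading C.isInternal_barGrading
  one_mem := wordGrading_one_mem
  mul_mem := wordGrading_mul_mem
  d := C.cobarD
  d_mem := derivExt_mem _ _ C.cobarGen_mem
  d_d := derivExt_derivExt _ _ C.cobarGen_mem fun v => by
    obtain ⟨c, rfl⟩ := Submodule.mkQ_surjective _ v
    exact C.cobarD_gen c
  leibniz y hx := by
    rw [cobarD, derivExt_mul, wordSign_of_mem _ hx, smul_mul_assoc]

section map

variable {C} {D : CoaugDGCoalg.{v, w} k} (f : C ⟶ D)

/-- The map induced on cokernels of coaugmentations. -/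
def barMap : C.Bar →ₗ[k] D.Bar :=
  Submodule.mapQ _ _ (f.toCoalgHom : C.carrier →ₗ[k] D.carrier) (by
    rintro _ ⟨a, rfl⟩
    refine ⟨a, ?_⟩
    have h (E : CoaugDGCoalg.{v, w} k) : E.coaug a = a • E.coaug 1 := by
      rw [← map_smul, smul_eq_mul, mul_one]
    change D.coaug a = f.toCoalgHom (C.coaug a)
    rw [h, h, map_smul, f.map_coaug])

/-- The algebra map induced on cobar constructions. -/
def cobarMap : TensorAlgebra k C.Bar →ₐ[k] TensorAlgebra k D.Bar :=
  TensorAlgebra.lift k (TensorAlgebra.ι k ∘ₗ barMap f)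

lemma cobarMap_desusp (c : C.carrier) : cobarMap f (C.desusp c) = D.desusp (f.toCoalgHom c) := by
  simp [cobarMap, desusp, barMap]

lemma sign_map (c : C.carrier) : D.sign (f.toCoalgHom c) = f.toCoalgHom (C.sign c) := by
  suffices D.sign ∘ₗ (f.toCoalgHom : C.carrier →ₗ[k] D.carrier) =
    (f.toCoalgHom : C.carrier →ₗ[k] D.carrier) ∘ₗ C.sign from LinearMap.congr_fun this c
  refine graded_ext C.isInternal fun n x hx => ?_
  simp [signInv_of_mem C.isInternal hx, signInv_of_mem D.isInternal (f.map_mem hx)]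

lemma cobarMap_quadPart (c : C.carrier) :
    cobarMap f (C.quadPart c) = D.quadPart (f.toCoalgHom c) := by
  simp only [quadPart, LinearMap.comp_apply]
  rw [← CoalgHomClass.map_comp_comul_apply]
  generalize (Coalgebra.comul (R := k) c) = z
  induction z with
  | zero => simp
  | add x y hx hy => simp only [map_add, hx, hy]
  | tmul x y => simp [sign_map, cobarMap_desusp]

lemma wordGrading_map {n : ℤ} {x : TensorAlgebra k C.Bar} (hx : x ∈ wordGrading C.barGrading n) :
    cobarMap f x ∈ wordGrading D.barGrading n := by
  induction hx using Submodule.span_induction with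
  | mem x hx =>
    induction hx with
    | one => rw [map_one]; exact wordGrading_one_mem
    | @cons p q v x hv hx ih =>
      obtain ⟨c, hc, rfl⟩ := hv
      rw [map_mul]
      refine wordGrading_mul_mem ?_ ih
      have := cobarMap_desusp f c
      rw [desusp, LinearMap.comp_apply] at this
      rw [this]
      exact D.desusp_mem (f.map_mem hc)
  | zero => rw [map_zero]; exact zero_mem _
  | add x y _ _ h1 h2 => rw [map_add]; exact add_mem h1 h2
  | smul a x _ h1 => rw [map_smul]; exact Submodule.smul_mem _ _ h1

lemma cobarMap_d (x : TensorAlgebra k C.Bar) :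
    cobarMap f (C.cobarD x) = D.cobarD (cobarMap f x) := by
  suffices (cobarMap f).toLinearMap ∘ₗ C.cobarD = D.cobarD ∘ₗ (cobarMap f).toLinearMap from
    LinearMap.congr_fun this x
  refine graded_ext (isInternal_wordGrading C.isInternal_barGrading) fun n x hx => ?_
  simp only [LinearMap.comp_apply, AlgHom.toLinearMap_apply]
  induction hx using Submodule.span_induction with
  | mem x hx =>
    induction hx with
    | one => simp [cobarD, derivExt_one]
    | @cons p q v x hv hx ih =>
      obtain ⟨c, hc, rfl⟩ := hv
      change cobarMap f (C.cobarD (C.desusp c * x)) = D.cobarD (cobarMap f (C.desusp c * x))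
      rw [cobarD_mul, map_mul, cobarMap_desusp, cobarD_mul, map_add, map_mul, map_mul, ih, wordSign_desusp, wordSign_desusp, map_neg,
        cobarMap_desusp, sign_map]
      congr 2
      rw [cobarD_desusp, cobarD_desusp, map_add, map_neg, cobarMap_desusp, cobarMap_quadPart, f.map_d]
  | zero => simp
  | add x y _ _ h1 h2 => simp only [map_add, h1, h2]
  | smul a x _ h1 => simp only [map_smul, h1]

end map

end CoaugDGCoalg

/-- The cobar construction, as a functor from coaugmented coalgebras to algebras. -/
def cobar (k : Type v) [CommRing k] : CoaugDGCoalg.{v, w} k ⥤ DGAlg.{v, max v w} k where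
  obj C := C.cobarObj
  map f := ⟨CoaugDGCoalg.cobarMap f, CoaugDGCoalg.wordGrading_map f, CoaugDGCoalg.cobarMap_d f⟩
  map_id C := by
    apply DGAlg.Hom.ext
    apply TensorAlgebra.hom_ext
    apply Submodule.linearMap_qext
    ext c
    exact CoaugDGCoalg.cobarMap_desusp (𝟙 C) c
  map_comp {C D E} f g := by
    apply DGAlg.Hom.ext
    apply TensorAlgebra.hom_ext
    apply Submodule.linearMap_qext
    ext c
    refine (CoaugDGCoalg.cobarMap_desusp (f ≫ g) c).trans ?_
    refine (CoaugDGCoalg.cobarMap_desusp g _).symm.trans ?_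
    exact congrArg (CoaugDGCoalg.cobarMap g) (CoaugDGCoalg.cobarMap_desusp f c).symm

end

section

section Simplicial

open Simplicial

/-- The set of all simplices of a simplicial set. -/
abbrev Simplices (X : SSet.{u}) : Type u := Σ n : ℕ, X _⦋n⦌

namespace Simplices

variable {X : SSet.{u}}

/-- The morphism `⦋m⦌ ⟶ ⦋n⦌`, `t ↦ φ t` (truncated at `n`). -/
def vertexMap (m n : ℕ) (φ : ℕ →o ℕ) : ⦋m⦌ ⟶ ⦋n⦌ :=
  SimplexCategory.mkHom
    ⟨fun t => ⟨min (φ t) n, by omega⟩, fun s t h => by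
      have := φ.monotone h
      simp only [Fin.mk_le_mk]
      omega⟩

/-- The `m`-simplex with vertices `φ 0, …, φ m` of a simplex `c`. -/
def pull (c : Simplices X) (m : ℕ) (φ : ℕ →o ℕ) : Simplices X :=
  ⟨m, X.map (vertexMap m c.1 φ).op c.2⟩

/-- The map `t ↦ a + t`. -/
def shift (a : ℕ) : ℕ →o ℕ where
  toFun t := a + t
  monotone' _ _ h := Nat.add_le_add_left h a

lemma shift_apply (a t : ℕ) : shift a t = a + t := rfl

/-- The simplex `[v_a, …, v_b]` of a simplex `[v_0, …, v_n]`, where `a ≤ b ≤ n`. -/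
def seg (c : Simplices X) (a b : ℕ) : Simplices X :=
  c.pull (b - a) (shift a)

lemma map_toOrderHom_ext {m n : ℕ} {f g : ⦋m⦌ ⟶ ⦋n⦌}
    (h : ∀ t : Fin (m + 1), (f.toOrderHom t : ℕ) = g.toOrderHom t) : f = g := by
  ext t : 3
  exact Fin.ext (h t)

lemma pull_congr (c : Simplices X) {m m' : ℕ} (hm : m = m') {φ ψ : ℕ →o ℕ}
    (h : ∀ t ≤ m, min (φ t) c.1 = min (ψ t) c.1) : c.pull m φ = c.pull m' ψ := by
  subst hm
  have : vertexMap m c.1 φ = vertexMap m c.1 ψ :=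
    map_toOrderHom_ext fun t => h t (by omega)
  rw [pull, pull, this]

lemma pull_self (c : Simplices X) {m : ℕ} (hm : m = c.1) {φ : ℕ →o ℕ}
    (h : ∀ t ≤ m, min (φ t) c.1 = t) : c.pull m φ = c := by
  subst hm
  have : vertexMap c.1 c.1 φ = 𝟙 _ := map_toOrderHom_ext fun t => h t (by omega)
  rw [pull, this]
  simp

lemma pull_pull (c : Simplices X) {m m' l : ℕ} {φ ψ χ : ℕ →o ℕ} (hl : m' = l)
    (h : ∀ t ≤ m', min (φ (min (ψ t) m)) c.1 = min (χ t) c.1) :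
    (c.pull m φ).pull m' ψ = c.pull l χ := by
  subst hl
  have : vertexMap m' m ψ ≫ vertexMap m c.1 φ = vertexMap m' c.1 χ :=
    map_toOrderHom_ext fun t => h t (by omega)
  simp only [pull]
  rw [← this, op_comp, Functor.map_comp]
  rfl

/-- The map `δ^i` on vertices. -/
def skip (i : ℕ) : ℕ →o ℕ where
  toFun t := if t < i then t else t + 1
  monotone' s t h := by dsimp only; split_ifs <;> omega

lemma skip_apply (i t : ℕ) : skip i t = if t < i then t else t + 1 := rfl

/-- The `i`-th face. -/
def dface (c : Simplices X) (i : ℕ) : Simplices X := c.pull (c.1 - 1) (skip i)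

lemma dface_eq {n : ℕ} (x : X _⦋n + 1⦌) (i : Fin (n + 2)) :
    dface ⟨n + 1, x⟩ i = ⟨n, X.δ i x⟩ := by
  have : vertexMap n (n + 1) (skip i) = SimplexCategory.δ i := by
    refine map_toOrderHom_ext fun t => ?_
    change min (if (t : ℕ) < i then (t : ℕ) else t + 1) (n + 1) = (Fin.succAbove i t : ℕ)
    simp only [Fin.succAbove, Fin.lt_def, Fin.val_castSucc]
    split_ifs <;> simp <;> omega
  change (⟨n, X.map (vertexMap n (n + 1) (skip i)).op x⟩ : Simplices X) = _
  rw [this]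
  rfl

lemma seg_seg (c : Simplices X) {a b a' b' : ℕ} (h1 : a ≤ b) (h2 : b ≤ c.1) (h3 : a' ≤ b')
    (h4 : b' ≤ b - a) : (c.seg a b).seg a' b' = c.seg (a + a') (a + b') := by
  refine c.pull_pull (by omega) fun t ht => ?_
  simp only [shift_apply]
  omega

lemma seg_self (c : Simplices X) : c.seg 0 c.1 = c :=
  c.pull_self (by omega) fun t ht => by simp only [shift_apply]; omega

lemma dface_dface (c : Simplices X) {i j : ℕ} (h : i ≤ j) (hj : j + 1 ≤ c.1) (hc : 2 ≤ c.1) :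
    (c.dface i).dface j = (c.dface (j + 1)).dface i := by
  have e : (c.dface i).dface j = c.pull (c.1 - 1 - 1) ((skip i).comp (skip j)) := by
    refine c.pull_pull rfl fun t ht => ?_
    simp only [skip_apply, shift_apply, OrderHom.comp_coe, Function.comp_apply] at ht ⊢
    simp only [dface, pull] at ht
    split_ifs <;> omega
  rw [e]
  symm
  refine c.pull_pull rfl fun t ht => ?_
  simp only [skip_apply, shift_apply, OrderHom.comp_coe, Function.comp_apply] at ht ⊢
  simp only [dface, pull] at ht
  split_ifs <;> omega

lemma seg_dface_front (c : Simplices X) {i j : ℕ} (hj : j + 1 ≤ c.1) :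
    (c.dface i).seg 0 j = if i ≤ j then (c.seg 0 (j + 1)).dface i else c.seg 0 j := by
  split_ifs with h
  · have e : (c.dface i).seg 0 j = c.pull j (skip i) := by
      refine c.pull_pull rfl fun t ht => ?_
      simp only [skip_apply, shift_apply] at ht ⊢
      split_ifs <;> omega
    rw [e]
    symm
    refine c.pull_pull ?_ fun t ht => ?_
    · simp [seg, pull]
    · simp only [skip_apply, shift_apply, seg, pull] at ht ⊢
      split_ifs <;> omega
  · refine c.pull_pull rfl fun t ht => ?_
    simp only [skip_apply, shift_apply] at ht ⊢
    split_ifs <;> omega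

lemma seg_dface_back (c : Simplices X) {i j : ℕ} (hj : j + 1 ≤ c.1) :
    (c.dface i).seg j (c.1 - 1) =
      if i ≤ j then c.seg (j + 1) c.1 else (c.seg j c.1).dface (i - j) := by
  split_ifs with h
  · refine c.pull_pull (by omega) fun t ht => ?_
    simp only [skip_apply, shift_apply] at ht ⊢
    split_ifs <;> omega
  · have e : (c.dface i).seg j (c.1 - 1) =
        c.pull (c.1 - 1 - j) ((skip i).comp (shift j)) := by
      refine c.pull_pull rfl fun t ht => ?_
      simp only [skip_apply, shift_apply, OrderHom.comp_coe, Function.comp_apply] at ht ⊢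
      split_ifs <;> omega
    rw [e]
    symm
    refine c.pull_pull ?_ fun t ht => ?_
    · simp only [seg, pull]; omega
    · simp only [skip_apply, shift_apply, seg, pull, OrderHom.comp_coe, Function.comp_apply] at ht ⊢
      split_ifs <;> omega

lemma dface_seg_last (c : Simplices X) {j : ℕ} (hj : j + 1 ≤ c.1) :
    (c.seg 0 (j + 1)).dface (j + 1) = c.seg 0 j := by
  refine c.pull_pull ?_ fun t ht => ?_
  · simp [seg, pull]
  · simp only [skip_apply, shift_apply, seg, pull] at ht ⊢
    split_ifs <;> omega

lemma dface_seg_first (c : Simplices X) {j : ℕ} (hj : j + 1 ≤ c.1) :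
    (c.seg j c.1).dface 0 = c.seg (j + 1) c.1 := by
  refine c.pull_pull ?_ fun t ht => ?_
  · simp only [seg, pull]; omega
  · simp only [skip_apply, shift_apply, seg, pull] at ht ⊢
    split_ifs <;> omega

/-- A simplex is degenerate. -/
def IsDegenerate (c : Simplices X) : Prop := c.2 ∈ X.degenerate c.1

lemma isDegenerate_of_not_injective {m : ℕ} {n : SimplexCategory} (θ : ⦋m⦌ ⟶ n)
    (x : X.obj (op n)) {s t : Fin (m + 1)} (hst : s ≠ t) (h : θ.toOrderHom s = θ.toOrderHom t) :
    IsDegenerate ⟨m, X.map θ.op x⟩ := by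
  obtain _ | m := m
  · exact absurd (Subsingleton.elim (α := Fin 1) s t) hst
  · obtain ⟨i, θ', rfl⟩ := SimplexCategory.eq_σ_comp_of_not_injective θ fun hi => hst (hi h)
    refine ⟨m, Nat.lt_succ_self m, SimplexCategory.σ i, X.map θ'.op x, ?_⟩
    rw [op_comp, Functor.map_comp]
    rfl

lemma isDegenerate_cases {c : Simplices X} (h : c.IsDegenerate) :
    ∃ (n : ℕ) (i : Fin (n + 1)) (y : X _⦋n⦌), c = ⟨n + 1, X.map (SimplexCategory.σ i).op y⟩ := by
  obtain ⟨n, x⟩ := c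
  obtain _ | n := n
  · simp [IsDegenerate] at h
  · have h' : x ∈ X.degenerate (n + 1) := h
    rw [SSet.degenerate_eq_iUnion_range_σ, Set.mem_iUnion] at h'
    obtain ⟨i, y, rfl⟩ := h'
    exact ⟨n, i, y, rfl⟩

lemma IsDegenerate.seg {c : Simplices X} (h : c.IsDegenerate) (i : ℕ) (hi : i ≤ c.1) :
    (c.seg 0 i).IsDegenerate ∨ (c.seg i c.1).IsDegenerate := by
  obtain ⟨n, j, y, rfl⟩ := isDegenerate_cases h
  simp only at hi
  have hσ (a : ℕ) (ha : a < n + 2) : ((SimplexCategory.σ j).toOrderHom ⟨a, ha⟩ : ℕ) =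
      if a ≤ j then a else a - 1 := by
    change ((Fin.predAbove j ⟨a, ha⟩ : Fin (n + 1)) : ℕ) = _
    simp only [Fin.predAbove, Fin.lt_def, Fin.val_castSucc]
    split_ifs <;> simp <;> omega
  by_cases hij : i ≤ j
  · right
    have := isDegenerate_of_not_injective (X := X) (m := n + 1 - i)
      (vertexMap (n + 1 - i) (n + 1) (shift i) ≫
        SimplexCategory.σ j) y (s := ⟨j - i, by omega⟩) (t := ⟨j + 1 - i, by omega⟩)
      (by simp; omega) (by
        apply Fin.ext
        simp only [SimplexCategory.comp_toOrderHom, OrderHom.comp_coe, Function.comp_apply]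
        erw [hσ (min (i + (j - i)) (n + 1)) (by omega), hσ (min (i + (j + 1 - i)) (n + 1)) (by omega)]
        split_ifs <;> omega)
    rw [op_comp, Functor.map_comp] at this
    exact this
  · left
    have := isDegenerate_of_not_injective (X := X) (m := i - 0)
      (vertexMap (i - 0) (n + 1) (shift 0) ≫
        SimplexCategory.σ j) y (s := ⟨j, by omega⟩) (t := ⟨j + 1, by omega⟩)
      (by simp) (by
        apply Fin.ext
        simp only [SimplexCategory.comp_toOrderHom, OrderHom.comp_coe, Function.comp_apply]
        erw [hσ (min (0 + j) (n + 1)) (by omega), hσ (min (0 + (j + 1)) (n + 1)) (by omega)]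
        split_ifs <;> omega)
    rw [op_comp, Functor.map_comp] at this
    exact this

end Simplices

end Simplicial

/-- Cancellation behind `∂ ∘ ∂ = 0`. -/
lemma sum_alternating_eq_zero {A : Type*} [AddCommGroup A] (n : ℕ) (D : ℕ → ℕ → A)
    (h : ∀ i j, i ≤ j → j ≤ n → D i j = D (j + 1) i) :
    ∑ i ∈ Finset.range (n + 2), ∑ j ∈ Finset.range (n + 1), ((-1 : ℤ) ^ (i + j)) • D i j = 0 := by
  rw [← Finset.sum_product']
  rw [← Finset.sum_filter_add_sum_filter_not _ (fun p : ℕ × ℕ => p.1 ≤ p.2)]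
  rw [add_eq_zero_iff_eq_neg, ← Finset.sum_neg_distrib]
  refine Finset.sum_bij' (fun p _ => (p.2 + 1, p.1)) (fun p _ => (p.2, p.1 - 1)) ?_ ?_ ?_ ?_ ?_
  · simp only [Finset.mem_filter, Finset.mem_product, Finset.mem_range]; omega
  · simp only [Finset.mem_filter, Finset.mem_product, Finset.mem_range]; omega
  · simp
  · rintro ⟨i, j⟩ hp
    simp only [Finset.mem_filter, Finset.mem_product, Finset.mem_range] at hp
    ext <;> simp
    omega
  · rintro ⟨i, j⟩ hp
    simp only [Finset.mem_filter, Finset.mem_product, Finset.mem_range] at hp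
    rw [h i j hp.2 (by omega), show j + 1 + i = i + j + 1 by ring, pow_succ]
    simp

section Chains

variable (k : Type v) [CommRing k] (X : SSet.{u})

/-- The span of the degenerate simplices. -/
def degenerateChains : Submodule k (Simplices X →₀ k) :=
  Submodule.span k ((fun c => Finsupp.single c 1) '' {c | c.IsDegenerate})

/-- The (normalized) chains of a simplicial set: the free module on all simplices modulo the
degenerate ones. -/
abbrev SChains : Type (max u v) := (Simplices X →₀ k) ⧸ degenerateChains k X

variable {X}

/-- The class of a simplex in the chains. -/
def scell (c : Simplices X) : SChains k X := Submodule.Quotient.mk (Finsupp.single c 1)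

variable {k}

lemma scell_degenerate {c : Simplices X} (h : c.IsDegenerate) : scell k c = 0 :=
  (Submodule.Quotient.mk_eq_zero _).2 (Submodule.subset_span ⟨c, h, rfl⟩)

/-- The linear map out of the chains with given values on simplices. -/
def schainsLift {N : Type*} [AddCommGroup N] [Module k N] (f : Simplices X → N)
    (hf : ∀ c, c.IsDegenerate → f c = 0) : SChains k X →ₗ[k] N :=
  Submodule.liftQ _ (Finsupp.linearCombination k f) (by
    rw [degenerateChains, Submodule.span_le]
    rintro _ ⟨c, hc, rfl⟩
    simp [hf c hc])

@[simp]
lemma schainsLift_scell {N : Type*} [AddCommGroup N] [Module k N] (f : Simplices X → N)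
    (hf : ∀ c, c.IsDegenerate → f c = 0) (c : Simplices X) :
    schainsLift f hf (scell k c) = f c := by
  simp [schainsLift, scell]

lemma schains_ext {N : Type*} [AddCommGroup N] [Module k N] {f g : SChains k X →ₗ[k] N}
    (h : ∀ c, f (scell k c) = g (scell k c)) : f = g := by
  apply Submodule.linearMap_qext
  ext c
  exact h c

variable (k X)

/-- Chains of degree `n`. -/
def schainsGrading (n : ℤ) : Submodule k (SChains k X) :=
  (Submodule.span k (Finsupp.basisSingleOne '' {c : Simplices X | (c.1 : ℤ) = n})).map
    (Submodule.mkQ _)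

lemma isInternal_schainsGrading : DirectSum.IsInternal (schainsGrading k X) := by
  have h := isInternal_basis (Finsupp.basisSingleOne (R := k)) fun c : Simplices X => (c.1 : ℤ)
  refine isInternal_quotient h (degenerateChains k X).mkQ (Submodule.mkQ_surjective _) _
    (by rw [Submodule.ker_mkQ, degenerateChains]) ?_
  rintro _ ⟨c, -, rfl⟩
  exact ⟨c.1, Submodule.subset_span ⟨c, rfl, by simp⟩⟩

lemma schainsGrading_eq (n : ℤ) :
    schainsGrading k X n = Submodule.span k (scell k '' {c : Simplices X | (c.1 : ℤ) = n}) := by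
  rw [schainsGrading, Submodule.map_span, Set.image_image]
  congr 1

variable {X}

lemma scell_mem (c : Simplices X) : scell k c ∈ schainsGrading k X c.1 := by
  rw [schainsGrading_eq]
  exact Submodule.subset_span ⟨c, rfl, rfl⟩

variable {k}

lemma schainsGrading_induction {n : ℤ} {N : Submodule k (SChains k X)}
    (h : ∀ c : Simplices X, (c.1 : ℤ) = n → scell k c ∈ N) : schainsGrading k X n ≤ N := by
  rw [schainsGrading_eq, Submodule.span_le]
  rintro _ ⟨c, hc, rfl⟩
  exact h c hc

/-- The boundary `Σ (-1)^i δ_i x` of a simplex. -/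
def sboundary : Simplices X → SChains k X
  | ⟨0, _⟩ => 0
  | ⟨n + 1, x⟩ => ∑ i : Fin (n + 2), ((-1 : ℤ) ^ (i : ℕ)) • scell k ⟨n, X.δ i x⟩

lemma sboundary_eq (c : Simplices X) : sboundary c = if c.1 = 0 then 0 else
    ∑ i ∈ Finset.range (c.1 + 1), ((-1 : ℤ) ^ i) • scell k (c.dface i) := by
  obtain ⟨_ | n, x⟩ := c
  · simp [sboundary]
  · simp only [sboundary, Nat.add_eq_zero_iff, one_ne_zero, and_false, if_false]
    rw [Finset.sum_range]
    exact Finset.sum_congr rfl fun i _ => by rw [Simplices.dface_eq]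

lemma sboundary_degenerate (c : Simplices X) (h : c.IsDegenerate) :
    sboundary (k := k) c = 0 := by
  obtain ⟨n, j, y, rfl⟩ := Simplices.isDegenerate_cases h
  simp only [sboundary]
  rw [Finset.sum_eq_add_of_mem j.castSucc j.succ (Finset.mem_univ _) (Finset.mem_univ _)
    (by simp [Fin.ext_iff]) ?_]
  · have h1 : X.δ j.castSucc (X.σ j y) = y := by
      rw [SimplicialObject.δ, SimplicialObject.σ, ← CategoryTheory.comp_apply, ← X.map_comp,
        ← op_comp, SimplexCategory.δ_comp_σ_self]
      simp
    have h2 : X.δ j.succ (X.σ j y) = y := by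
      rw [SimplicialObject.δ, SimplicialObject.σ, ← CategoryTheory.comp_apply, ← X.map_comp,
        ← op_comp, SimplexCategory.δ_comp_σ_succ]
      simp
    simp only [SimplicialObject.σ] at h1 h2
    rw [h1, h2]
    simp [pow_succ]
  · rintro i - ⟨hi1, hi2⟩
    rw [scell_degenerate, smul_zero]
    obtain ⟨s, hs⟩ := Fin.exists_succAbove_eq (Ne.symm hi1)
    obtain ⟨t, ht⟩ := Fin.exists_succAbove_eq (Ne.symm hi2)
    have := Simplices.isDegenerate_of_not_injective (X := X) (SimplexCategory.δ i ≫ SimplexCategory.σ j) y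
      (s := s) (t := t) (by
        rintro rfl
        rw [hs] at ht
        simp [Fin.ext_iff] at ht) (by
        change Fin.predAbove j (Fin.succAbove i s) = Fin.predAbove j (Fin.succAbove i t)
        rw [hs, ht]
        simp)
    rw [op_comp, Functor.map_comp] at this
    exact this

variable (k X)

/-- The differential of the chains. -/
def sd : SChains k X →ₗ[k] SChains k X := schainsLift sboundary sboundary_degenerate

variable {k X}

lemma sd_scell (c : Simplices X) : sd k X (scell k c) = if c.1 = 0 then 0 else
    ∑ i ∈ Finset.range (c.1 + 1), ((-1 : ℤ) ^ i) • scell k (c.dface i) := by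
  rw [sd, schainsLift_scell, sboundary_eq]

lemma sd_sd (x : SChains k X) : sd k X (sd k X x) = 0 := by
  suffices sd k X ∘ₗ sd k X = 0 from LinearMap.congr_fun this x
  refine schains_ext fun c => ?_
  simp only [LinearMap.comp_apply, sd_scell, LinearMap.zero_apply]
  obtain ⟨_ | _ | n, x⟩ := c
  · simp
  · simp [sd_scell, Simplices.dface, Simplices.pull]
  · rw [if_neg (by simp), map_sum]
    rw [← sum_alternating_eq_zero (n + 1) (fun i j => scell k
      ((Simplices.dface ⟨n + 2, x⟩ i).dface j))]
    · refine Finset.sum_congr rfl fun i _ => ?_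
      rw [map_zsmul, sd_scell, if_neg (by simp [Simplices.dface, Simplices.pull]), Finset.smul_sum]
      refine Finset.sum_congr rfl fun j _ => ?_
      rw [smul_smul, pow_add]
    · intro i j hij hj
      rw [Simplices.dface_dface _ hij (by simpa using hj) (by simp)]

lemma sd_mem {n : ℤ} {x : SChains k X} (hx : x ∈ schainsGrading k X n) :
    sd k X x ∈ schainsGrading k X (n - 1) := by
  refine schainsGrading_induction (N := (schainsGrading k X (n - 1)).comap (sd k X)) ?_ hx
  intro c hc
  rw [Submodule.mem_comap, sd_scell]
  split_ifs with h
  · exact zero_mem _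
  · refine sum_mem fun i _ => zsmul_mem ?_ _
    have := scell_mem k (c.dface i)
    rwa [show ((c.dface i).1 : ℤ) = n - 1 by simp only [Simplices.dface, Simplices.pull]; omega]
      at this

/-- The augmentation. -/
def scounit : SChains k X →ₗ[k] k :=
  schainsLift (fun c => if c.1 = 0 then 1 else 0) (by
    rintro ⟨_ | n, x⟩ h
    · simp [Simplices.IsDegenerate] at h
    · simp)

/-- The Alexander--Whitney coproduct `Σ [v_0, …, v_i] ⊗ [v_i, …, v_n]`. -/
def scomul : SChains k X →ₗ[k] SChains k X ⊗[k] SChains k X :=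
  schainsLift (fun c => ∑ i ∈ Finset.range (c.1 + 1), scell k (c.seg 0 i) ⊗ₜ[k] scell k (c.seg i c.1))
    (by
      intro c h
      refine Finset.sum_eq_zero fun i hi => ?_
      rcases h.seg i (by simpa [Nat.lt_succ_iff] using hi) with h | h
      · rw [scell_degenerate h, TensorProduct.zero_tmul]
      · rw [scell_degenerate h, TensorProduct.tmul_zero])

lemma scounit_scell (c : Simplices X) : scounit (scell k c) = if c.1 = 0 then 1 else 0 :=
  schainsLift_scell _ _ _

lemma scomul_scell (c : Simplices X) : scomul (scell k c) =
    ∑ i ∈ Finset.range (c.1 + 1), scell k (c.seg 0 i) ⊗ₜ[k] scell k (c.seg i c.1) :=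
  schainsLift_scell _ _ _

instance : Coalgebra k (SChains k X) where
  comul := scomul
  counit := scounit
  coassoc := by
    refine schains_ext fun c => ?_
    simp only [LinearMap.comp_apply, LinearEquiv.coe_coe, scomul_scell, map_sum,
      LinearMap.rTensor_tmul, LinearMap.lTensor_tmul, TensorProduct.sum_tmul,
      TensorProduct.tmul_sum, TensorProduct.assoc_tmul]
    rw [Finset.sum_sigma', Finset.sum_sigma']
    refine Finset.sum_bij' (fun p _ => ⟨p.2, p.1 - p.2⟩) (fun p _ => ⟨p.1 + p.2, p.1⟩) ?_ ?_ ?_ ?_ ?_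
    · rintro ⟨i, j⟩ hp
      simp only [Finset.mem_sigma, Finset.mem_range, Simplices.seg, Simplices.pull] at hp ⊢
      omega
    · rintro ⟨i, j⟩ hp
      simp only [Finset.mem_sigma, Finset.mem_range, Simplices.seg, Simplices.pull] at hp ⊢
      omega
    · rintro ⟨i, j⟩ hp
      simp only [Finset.mem_sigma, Finset.mem_range, Simplices.seg, Simplices.pull] at hp ⊢
      simp only [Sigma.mk.injEq, heq_eq_eq, and_true]
      omega
    · rintro ⟨i, j⟩ hp
      simp
    · rintro ⟨i, j⟩ hp
      simp only [Finset.mem_sigma, Finset.mem_range] at hp ⊢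
      have hi : (c.seg 0 i).1 = i := by simp [Simplices.seg, Simplices.pull]
      have hj : (c.seg j c.1).1 = c.1 - j := rfl
      rw [hi] at hp ⊢
      rw [hj, c.seg_seg (by omega) (by omega) (by omega) (by omega),
        c.seg_seg (by omega) (by omega) (by omega) (by omega),
        c.seg_seg (by omega) (by omega) (by omega) (by omega),
        c.seg_seg (by omega) (by omega) (by omega) (by omega)]
      have e1 : j + (i - j) = i := by omega
      have e2 : j + (c.1 - j) = c.1 := by omega
      simp only [zero_add, add_zero, e1, e2]
  rTensor_counit_comp_comul := by
    refine schains_ext fun c => ?_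
    simp only [LinearMap.comp_apply, scomul_scell, map_sum, LinearMap.rTensor_tmul,
      TensorProduct.mk_apply, scounit_scell]
    rw [Finset.sum_eq_single 0]
    · rw [c.seg_self, if_pos (by simp [Simplices.seg, Simplices.pull])]
    · intro i _ hi
      simp [Simplices.seg, Simplices.pull, hi]
    · simp
  lTensor_counit_comp_comul := by
    refine schains_ext fun c => ?_
    simp only [LinearMap.comp_apply, scomul_scell, map_sum, LinearMap.lTensor_tmul,
      LinearMap.flip_apply, TensorProduct.mk_apply, scounit_scell]
    rw [Finset.sum_eq_single c.1]
    · rw [c.seg_self, if_pos]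
      simp [Simplices.seg, Simplices.pull]
    · intro i hi h
      rw [if_neg, TensorProduct.tmul_zero]
      simp only [Finset.mem_range] at hi
      simp only [Simplices.seg, Simplices.pull]
      omega
    · simp

lemma comul_scell (c : Simplices X) : Coalgebra.comul (R := k) (scell k c) =
    ∑ i ∈ Finset.range (c.1 + 1), scell k (c.seg 0 i) ⊗ₜ[k] scell k (c.seg i c.1) :=
  scomul_scell c

lemma counit_scell (c : Simplices X) :
    Coalgebra.counit (R := k) (scell k c) = if c.1 = 0 then 1 else 0 :=
  scounit_scell c

lemma comul_sd (x : SChains k X) : Coalgebra.comul (R := k) (sd k X x) =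
    TensorProduct.map (sd k X) LinearMap.id (Coalgebra.comul (R := k) x) +
      TensorProduct.map (signInv _ (isInternal_schainsGrading k X)) (sd k X)
        (Coalgebra.comul (R := k) x) := by
  suffices Coalgebra.comul (R := k) ∘ₗ sd k X =
      TensorProduct.map (sd k X) LinearMap.id ∘ₗ Coalgebra.comul (R := k) +
      TensorProduct.map (signInv _ (isInternal_schainsGrading k X)) (sd k X) ∘ₗ
        Coalgebra.comul (R := k) from LinearMap.congr_fun this x
  refine schains_ext fun c => ?_
  simp only [LinearMap.comp_apply, LinearMap.add_apply, sd_scell, comul_scell, map_sum,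
    TensorProduct.map_tmul, LinearMap.id_apply,
    signInv_of_mem (isInternal_schainsGrading k X) (scell_mem k _)]
  obtain ⟨n, hn⟩ : ∃ n, c.1 = n := ⟨_, rfl⟩
  have h1 (i : ℕ) : (c.seg 0 i).1 = i := by simp [Simplices.seg, Simplices.pull]
  have h2 (i : ℕ) : (c.seg i n).1 = n - i := by simp [Simplices.seg, Simplices.pull]
  have hd (i : ℕ) : (c.dface i).1 = n - 1 := by simp [Simplices.dface, Simplices.pull, hn]
  rw [hn]
  simp only [h1, h2]
  obtain _ | n := n
  · simp
  · rw [if_neg (by simp), map_sum]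
    have L : ∑ i ∈ Finset.range (n + 2), Coalgebra.comul (R := k)
          (((-1 : ℤ) ^ i) • scell k (c.dface i)) =
        ∑ j ∈ Finset.range (n + 1), ∑ i ∈ Finset.range (n + 2), ((-1 : ℤ) ^ i) •
          (scell k (if i ≤ j then (c.seg 0 (j + 1)).dface i else c.seg 0 j) ⊗ₜ[k]
            scell k (if i ≤ j then c.seg (j + 1) (n + 1) else (c.seg j (n + 1)).dface (i - j))) := by
      rw [Finset.sum_comm]
      refine Finset.sum_congr rfl fun i _ => ?_
      rw [map_zsmul, comul_scell, Finset.smul_sum, hd]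
      refine Finset.sum_congr rfl fun j hj => ?_
      simp only [Finset.mem_range] at hj
      rw [c.seg_dface_front (by omega)]
      have := c.seg_dface_back (i := i) (j := j) (by omega)
      rw [hn] at this
      rw [this]
    have R1 : ∑ j ∈ Finset.range (n + 2), (if j = 0 then (0 : SChains k X) else
          ∑ i ∈ Finset.range (j + 1), ((-1 : ℤ) ^ i) • scell k ((c.seg 0 j).dface i)) ⊗ₜ[k]
            scell k (c.seg j (n + 1)) =
        ∑ j ∈ Finset.range (n + 1), (∑ i ∈ Finset.range (j + 1),
          ((-1 : ℤ) ^ i) • (scell k ((c.seg 0 (j + 1)).dface i) ⊗ₜ[k]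
            scell k (c.seg (j + 1) (n + 1))) +
          ((-1 : ℤ) ^ (j + 1)) • (scell k (c.seg 0 j) ⊗ₜ[k] scell k (c.seg (j + 1) (n + 1)))) := by
      rw [Finset.sum_range_succ']
      simp only [if_true, TensorProduct.zero_tmul, add_zero]
      refine Finset.sum_congr rfl fun j hj => ?_
      simp only [Finset.mem_range] at hj
      rw [if_neg (by simp), Finset.sum_range_succ, TensorProduct.add_tmul,
        c.dface_seg_last (by omega), TensorProduct.sum_tmul]
      simp only [← Int.cast_smul_eq_zsmul k, TensorProduct.smul_tmul']
    have R2 : ∑ j ∈ Finset.range (n + 2), (((j : ℤ).negOnePow : ℤ) • scell k (c.seg 0 j)) ⊗ₜ[k]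
          (if n + 1 - j = 0 then (0 : SChains k X) else ∑ i ∈ Finset.range (n + 1 - j + 1),
            ((-1 : ℤ) ^ i) • scell k ((c.seg j (n + 1)).dface i)) =
        ∑ j ∈ Finset.range (n + 1), (∑ i ∈ Finset.Ico (j + 1) (n + 2),
          ((-1 : ℤ) ^ i) • (scell k (c.seg 0 j) ⊗ₜ[k]
            scell k ((c.seg j (n + 1)).dface (i - j))) +
          ((-1 : ℤ) ^ j) • (scell k (c.seg 0 j) ⊗ₜ[k] scell k (c.seg (j + 1) (n + 1)))) := by
      rw [Finset.sum_range_succ]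
      simp only [Nat.sub_self, if_true, TensorProduct.tmul_zero, add_zero]
      refine Finset.sum_congr rfl fun j hj => ?_
      simp only [Finset.mem_range] at hj
      have hs : ((j : ℤ).negOnePow : ℤ) = (-1 : ℤ) ^ j := by simp [Int.negOnePow_def]
      have hf := c.dface_seg_first (j := j) (by omega)
      rw [hn] at hf
      rw [if_neg (by omega), hs, Finset.sum_range_succ', hf, Finset.sum_Ico_eq_sum_range,
        show n + 2 - (j + 1) = n + 1 - j by omega, TensorProduct.tmul_add, TensorProduct.tmul_sum]
      simp only [← Int.cast_smul_eq_zsmul k, TensorProduct.smul_tmul', TensorProduct.tmul_smul,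
        smul_smul]
      congr 1
      · refine Finset.sum_congr rfl fun i _ => ?_
        rw [show j + 1 + i - j = i + 1 by omega]
        congr 1
        push_cast
        ring_nf
      · simp
    rw [L, R1, R2, ← Finset.sum_add_distrib]
    refine Finset.sum_congr rfl fun j hj => ?_
    simp only [Finset.mem_range] at hj
    rw [← Finset.sum_range_add_sum_Ico _ (show j + 1 ≤ n + 2 by omega), pow_succ]
    have e1 : ∀ i ∈ Finset.range (j + 1), i ≤ j := fun i hi => by
      simp only [Finset.mem_range] at hi; omega
    have e2 : ∀ i ∈ Finset.Ico (j + 1) (n + 2), ¬ i ≤ j := fun i hi => by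
      simp only [Finset.mem_Ico] at hi; omega
    rw [Finset.sum_congr rfl fun i hi => by rw [if_pos (e1 i hi), if_pos (e1 i hi)],
      Finset.sum_congr (s₁ := Finset.Ico (j + 1) (n + 2)) rfl fun i hi => by
        rw [if_neg (e2 i hi), if_neg (e2 i hi)]]
    simp only [mul_neg, mul_one, neg_smul]
    abel

lemma scounit_sd (x : SChains k X) : Coalgebra.counit (R := k) (sd k X x) = 0 := by
  suffices Coalgebra.counit (R := k) ∘ₗ sd k X = 0 from LinearMap.congr_fun this x
  refine schains_ext fun c => ?_
  simp only [LinearMap.comp_apply, sd_scell, LinearMap.zero_apply]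
  obtain ⟨_ | _ | n, x⟩ := c
  · simp
  · simp [Finset.sum_range_succ, counit_scell, Simplices.dface, Simplices.pull]
  · simp [counit_scell, Simplices.dface, Simplices.pull]

lemma scounit_of_ne {n : ℤ} {x : SChains k X} (hx : x ∈ schainsGrading k X n) (hn : n ≠ 0) :
    Coalgebra.counit (R := k) x = 0 := by
  refine schainsGrading_induction (N := LinearMap.ker (Coalgebra.counit (R := k))) ?_ hx
  intro c hc
  rw [LinearMap.mem_ker, counit_scell, if_neg (by omega)]

lemma scomul_mem {n : ℤ} {x : SChains k X} (hx : x ∈ schainsGrading k X n) :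
    Coalgebra.comul (R := k) x ∈ ⨆ (i : ℤ) (j : ℤ) (_ : i + j = n), LinearMap.range
      (TensorProduct.map (schainsGrading k X i).subtype (schainsGrading k X j).subtype) := by
  refine schainsGrading_induction (N := (⨆ (i : ℤ) (j : ℤ) (_ : i + j = n), LinearMap.range
      (TensorProduct.map (schainsGrading k X i).subtype (schainsGrading k X j).subtype)).comap
        (Coalgebra.comul (R := k))) ?_ hx
  intro c hc
  rw [Submodule.mem_comap, comul_scell]
  refine sum_mem fun i hi => ?_
  simp only [Finset.mem_range] at hi
  refine Submodule.mem_iSup_of_mem (c.seg 0 i).1 (Submodule.mem_iSup_of_mem (c.seg i c.1).1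
    (Submodule.mem_iSup_of_mem ?_ ⟨⟨_, scell_mem k _⟩ ⊗ₜ ⟨_, scell_mem k _⟩, rfl⟩))
  simp only [Simplices.seg, Simplices.pull]
  omega

section map

variable {Y Z : SSet.{u}}

/-- The image of a simplex under a simplicial map. -/
def Simplices.map (f : X ⟶ Y) (c : Simplices X) : Simplices Y := ⟨c.1, f.app _ c.2⟩

lemma Simplices.map_pull (f : X ⟶ Y) (c : Simplices X) (m : ℕ) (φ : ℕ →o ℕ) :
    (c.pull m φ).map f = (c.map f).pull m φ := by
  simp only [Simplices.map, Simplices.pull]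
  exact congrArg (Sigma.mk m) (NatTrans.naturality_apply f (vertexMap m c.1 φ).op c.2)

lemma Simplices.IsDegenerate.map {c : Simplices X} (h : c.IsDegenerate) (f : X ⟶ Y) :
    (c.map f).IsDegenerate :=
  SSet.degenerate_app_apply h f

variable (k)

/-- The map induced on chains. -/
def schainsMap (f : X ⟶ Y) : SChains k X →ₗ[k] SChains k Y :=
  schainsLift (fun c => scell k (c.map f)) fun _ h => scell_degenerate (h.map f)

lemma schainsMap_scell (f : X ⟶ Y) (c : Simplices X) :
    schainsMap k f (scell k c) = scell k (c.map f) :=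
  schainsLift_scell _ _ _

lemma schainsMap_sd (f : X ⟶ Y) (x : SChains k X) :
    schainsMap k f (sd k X x) = sd k Y (schainsMap k f x) := by
  suffices schainsMap k f ∘ₗ sd k X = sd k Y ∘ₗ schainsMap k f from LinearMap.congr_fun this x
  refine schains_ext fun c => ?_
  simp only [LinearMap.comp_apply, sd_scell, schainsMap_scell]
  have h : (c.map f).1 = c.1 := rfl
  rw [h]
  split_ifs
  · simp
  · simp only [map_sum, map_zsmul, schainsMap_scell, Simplices.dface, Simplices.map_pull, h]

/-- The map induced on chains, as a map of coalgebras. -/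
def schainsCoalgMap (f : X ⟶ Y) : SChains k X →ₗc[k] SChains k Y where
  __ := schainsMap k f
  counit_comp := by
    refine schains_ext fun c => ?_
    simp only [LinearMap.comp_apply, schainsMap_scell, counit_scell, Simplices.map]
  map_comp_comul := by
    refine schains_ext fun c => ?_
    simp only [LinearMap.comp_apply, schainsMap_scell, comul_scell, map_sum,
      TensorProduct.map_tmul, Simplices.seg, Simplices.map_pull]
    rfl

end map

end Chains

/-- Reduced simplicial sets: those with exactly one `0`-simplex. -/
abbrev ReducedSSet : Type (u + 1) :=
  ObjectProperty.FullSubcategory fun X : SSet.{u} =>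
    Nonempty (Unique (X.obj (op (SimplexCategory.mk 0))))

namespace ReducedSSet

instance (X : ReducedSSet.{u}) : Unique (X.obj.obj (op (SimplexCategory.mk 0))) :=
  X.property.some

/-- The unique `0`-simplex. -/
def pt (X : ReducedSSet.{u}) : Simplices X.obj := ⟨0, default⟩

lemma eq_pt {X : ReducedSSet.{u}} (c : Simplices X.obj) (h : c.1 = 0) : c = X.pt := by
  obtain ⟨n, x⟩ := c
  obtain rfl : n = 0 := h
  rw [pt, Subsingleton.elim x default]

/-- The Alexander--Whitney coalgebra of a reduced simplicial set, coaugmented by its unique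
`0`-simplex. -/
def awObj (k : Type v) [CommRing k] (X : ReducedSSet.{u}) : CoaugDGCoalg.{v, max u v} k where
  carrier := SChains k X.obj
  grading := schainsGrading k X.obj
  isInternal := isInternal_schainsGrading k X.obj
  counit_of_ne := scounit_of_ne
  comul_mem := scomul_mem
  d := sd k X.obj
  d_mem := sd_mem
  d_d := sd_sd
  counit_d := scounit_sd
  comul_d := comul_sd
  coaug :=
    { LinearMap.toSpanSingleton k _ (scell k X.pt) with
      counit_comp := by
        ext
        simp [counit_scell, pt]
      map_comp_comul := by
        ext
        have h : X.pt.seg 0 0 = X.pt := eq_pt _ rfl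
        have h0 : X.pt.1 = 0 := rfl
        simp [comul_scell, h0, h] }
  coaug_mem := by
    have : scell k X.pt ∈ schainsGrading k X.obj 0 := scell_mem k X.pt
    simpa using this
  d_coaug := by
    change sd k X.obj ((1 : k) • scell k X.pt) = 0
    have h0 : X.pt.1 = 0 := rfl
    rw [one_smul, sd_scell, if_pos h0]

end ReducedSSet

/-- The functor of Alexander--Whitney chains. -/
def awChains (k : Type v) [CommRing k] : ReducedSSet.{u} ⥤ CoaugDGCoalg.{v, max u v} k where
  obj X := X.awObj k
  map {X Y} f :=
    { toCoalgHom := schainsCoalgMap k f.hom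
      map_mem := by
        intro n x hx
        refine schainsGrading_induction
          (N := (schainsGrading k Y.obj n).comap (schainsMap k f.hom)) ?_ hx
        rintro c rfl
        rw [Submodule.mem_comap, schainsMap_scell]
        exact scell_mem k (c.map f.hom)
      map_d := schainsMap_sd k f.hom
      map_coaug := by
        change schainsMap k f.hom ((1 : k) • scell k X.pt) = (1 : k) • scell k Y.pt
        rw [one_smul, one_smul, schainsMap_scell, ReducedSSet.eq_pt (X.pt.map f.hom) rfl] }
  map_id X := by
    apply CoaugDGCoalg.Hom.ext
    apply CoalgHom.coe_linearMap_injective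
    exact schains_ext fun c => schainsMap_scell k _ c
  map_comp f g := by
    apply CoaugDGCoalg.Hom.ext
    apply CoalgHom.coe_linearMap_injective
    refine schains_ext fun c => ?_
    change schainsMap k (f ≫ g).hom (scell k c) = schainsMap k g.hom (schainsMap k f.hom (scell k c))
    rw [schainsMap_scell, schainsMap_scell, schainsMap_scell]
    rfl

end

section

/-! ### The cube category with connections -/

section Cubes

/-- The coface map `δ_i^ε : 2ⁿ → 2ⁿ⁺¹`, inserting `ε` as the `i`-th coordinate. -/
def cubeFace {n : ℕ} (i : Fin (n + 1)) (ε : Bool) (x : Fin n → Bool) : Fin (n + 1) → Bool :=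
  i.insertNth ε x

/-- The codegeneracy map `σ_i : 2ⁿ⁺¹ → 2ⁿ`, omitting the `i`-th coordinate. -/
def cubeDegen {n : ℕ} (i : Fin (n + 1)) (x : Fin (n + 1) → Bool) : Fin n → Bool :=
  fun j => x (i.succAbove j)

/-- The coconnection map `γ_i : 2ⁿ⁺¹ → 2ⁿ`, replacing the coordinates number `i` and `i + 1` by
their maximum. -/
def cubeConn {n : ℕ} (i : Fin n) (x : Fin (n + 1) → Bool) : Fin n → Bool :=
  fun j => if j = i then x i.castSucc || x i.succ else x (i.castSucc.succAbove j)

/-- The maps `2ᵐ → 2ⁿ` generated by cofaces, codegeneracies and coconnections. -/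
inductive IsCubical : ∀ {m n : ℕ}, ((Fin m → Bool) → (Fin n → Bool)) → Prop
  | id (n : ℕ) : IsCubical (fun x : Fin n → Bool => x)
  | face {n : ℕ} (i : Fin (n + 1)) (ε : Bool) : IsCubical (cubeFace i ε)
  | degen {n : ℕ} (i : Fin (n + 1)) : IsCubical (cubeDegen i)
  | conn {n : ℕ} (i : Fin n) : IsCubical (cubeConn i)
  | comp {l m n : ℕ} {f : (Fin l → Bool) → (Fin m → Bool)} {g : (Fin m → Bool) → (Fin n → Bool)} :
      IsCubical f → IsCubical g → IsCubical (fun x => g (f x))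

/-- A description of a map of cubes through a relation `R` between the input and the output
coordinates, and the set `c` of the output coordinates that are constantly `1`. -/
structure CubeNF {m n : ℕ} (f : (Fin m → Bool) → (Fin n → Bool)) (R : Fin m → Fin n → Prop)
    (c : Fin n → Prop) : Prop where
  mono : ∀ {a a' b b'}, R a b → R a' b' → a ≤ a' → b ≤ b'
  eq_true_iff : ∀ x b, f x b = true ↔ c b ∨ ∃ a, R a b ∧ x a = true

namespace CubeNF

variable {l m n : ℕ} {f : (Fin m → Bool) → (Fin n → Bool)} {R : Fin m → Fin n → Prop}
  {c : Fin n → Prop}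

lemma functional (h : CubeNF f R c) {a b b'} (h1 : R a b) (h2 : R a b') : b = b' :=
  le_antisymm (h.mono h1 h2 le_rfl) (h.mono h2 h1 le_rfl)

lemma comp {g : (Fin l → Bool) → (Fin m → Bool)} {S : Fin l → Fin m → Prop} {d : Fin m → Prop}
    (h : CubeNF f R c) (h' : CubeNF g S d) :
    CubeNF (fun x => f (g x)) (fun a b => ∃ i, S a i ∧ R i b)
      (fun b => c b ∨ ∃ i, R i b ∧ d i) where
  mono := by
    rintro a a' b b' ⟨i, hi, hb⟩ ⟨i', hi', hb'⟩ ha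
    exact h.mono hb hb' (h'.mono hi hi' ha)
  eq_true_iff x b := by
    rw [h.eq_true_iff]
    simp only [h'.eq_true_iff]
    constructor
    · rintro (h | ⟨a, ha, h | ⟨i, hi, hx⟩⟩)
      exacts [Or.inl (Or.inl h), Or.inl (Or.inr ⟨a, ha, h⟩), Or.inr ⟨i, ⟨a, hi, ha⟩, hx⟩]
    · rintro ((h | ⟨a, ha, h⟩) | ⟨i, ⟨a, hi, ha⟩, hx⟩)
      exacts [Or.inl h, Or.inr ⟨a, ha, Or.inl h⟩, Or.inr ⟨a, ha, Or.inr ⟨i, hi, hx⟩⟩]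

lemma ext {f' : (Fin m → Bool) → (Fin n → Bool)} (h : CubeNF f R c) (h' : CubeNF f' R c) :
    f = f' := by
  funext x b
  rw [Bool.eq_iff_iff, h.eq_true_iff, h'.eq_true_iff]

end CubeNF

lemma IsCubical.exists_nf {m n : ℕ} {f : (Fin m → Bool) → (Fin n → Bool)} (h : IsCubical f) :
    ∃ R c, CubeNF f R c := by
  induction h with
  | id n => exact ⟨fun a b => a = b, fun _ => False, fun h1 h2 h => by subst h1 h2; exact h,
      fun x b => by simp⟩
  | face i ε =>
    refine ⟨fun a b => i.succAbove a = b, fun b => b = i ∧ ε = true, ?_, fun x b => ?_⟩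
    · rintro a a' _ _ rfl rfl h
      exact i.strictMono_succAbove.monotone h
    · cases b using i.succAboveCases with
      | x => simp [cubeFace]
      | p j => simp [cubeFace]
  | degen i =>
    refine ⟨fun a b => a = i.succAbove b, fun b => False, ?_, fun x b => ?_⟩
    · rintro _ _ b b' rfl rfl h
      exact i.strictMono_succAbove.le_iff_le.1 h
    · simp [cubeDegen]
  | conn i =>
    refine ⟨fun a b => if b = i then a = i.castSucc ∨ a = i.succ else a = i.castSucc.succAbove b,
      fun b => False, ?_, fun x b => ?_⟩
    · intro a a' b b' h1 h2 h
      split_ifs at h1 h2 <;>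
      simp only [Fin.ext_iff, Fin.le_def, Fin.succAbove, Fin.lt_def] at * <;>
      grind
    · simp only [cubeConn]
      split_ifs <;> simp
  | comp _ _ h1 h2 =>
    obtain ⟨R, c, h1⟩ := h1
    obtain ⟨S, d, h2⟩ := h2
    exact ⟨_, _, h2.comp h1⟩

lemma CubeNF.isCubical : ∀ (N : ℕ) {m n : ℕ}, m + n = N → ∀ {f : (Fin m → Bool) → (Fin n → Bool)}
    {R : Fin m → Fin n → Prop} {c : Fin n → Prop}, CubeNF f R c → IsCubical f
  | N, m, n, hN, f, R, c, h => by
    classical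
    by_cases h1 : ∃ a, ∀ b, R a b → c b
    · obtain ⟨a, ha⟩ := h1
      obtain _ | m := m
      · exact a.elim0
      let f' : (Fin m → Bool) → (Fin n → Bool) := fun y => f (a.insertNth false y)
      have hf' : CubeNF f' (fun i b => R (a.succAbove i) b) c := by
        refine ⟨fun h1 h2 h3 => h.mono h1 h2 (a.strictMono_succAbove.monotone h3), fun x b => ?_⟩
        simp [f', h.eq_true_iff, Fin.exists_iff_succAbove a]
      have hf : f = fun x => f' (cubeDegen a x) := by
        funext x b
        rw [Bool.eq_iff_iff, h.eq_true_iff, hf'.eq_true_iff, Fin.exists_iff_succAbove a]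
        simp only [cubeDegen]
        have := ha b
        tauto
      rw [hf]
      exact .comp (.degen a) (CubeNF.isCubical (m + n) rfl hf')
    by_cases h2 : ∃ (i i' : Fin m) (b : Fin n), i'.val = i.val + 1 ∧ R i b ∧ R i' b
    · obtain ⟨i, i', b, hii, h3, h4⟩ := h2
      obtain _ | m := m
      · exact i.elim0
      obtain ⟨i, rfl⟩ : ∃ j : Fin m, i = j.castSucc := ⟨⟨i, by omega⟩, rfl⟩
      obtain rfl : i' = i.succ := Fin.ext hii
      let f' : (Fin m → Bool) → (Fin n → Bool) := fun y b =>
        decide (c b ∨ ∃ a, R (i.castSucc.succAbove a) b ∧ y a = true)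
      have hf' : CubeNF f' (fun a b => R (i.castSucc.succAbove a) b) c :=
        ⟨fun h1 h2 h3 => h.mono h1 h2 (i.castSucc.strictMono_succAbove.monotone h3), fun x b => by
          simp [f']⟩
      have hf : f = fun x => f' (cubeConn i x) := by
        funext x b'
        rw [Bool.eq_iff_iff, h.eq_true_iff, hf'.eq_true_iff, Fin.exists_iff_succAbove i.castSucc]
        refine or_congr Iff.rfl ?_
        simp only [cubeConn]
        constructor
        · rintro (⟨h5, h6⟩ | ⟨a, ha, hx⟩)
          · refine ⟨i, ?_, by simp [h6]⟩
            obtain rfl := h.functional h3 h5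
            simpa using h4
          · refine ⟨a, ha, ?_⟩
            split_ifs with hai
            · subst hai
              simp at hx
              simp [hx]
            · exact hx
        · rintro ⟨a, ha, hx⟩
          split_ifs at hx with hai
          · subst hai
            simp only [Bool.or_eq_true] at hx
            simp only [Fin.succAbove_castSucc_self] at ha
            obtain rfl := h.functional h4 ha
            rcases hx with hx | hx
            · exact Or.inl ⟨h3, hx⟩
            · exact Or.inr ⟨a, by simpa using ha, by simpa using hx⟩
          · exact Or.inr ⟨a, ha, hx⟩
      rw [hf]
      exact .comp (.conn i) (CubeNF.isCubical (m + n) (by omega) hf')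
    by_cases h3 : ∃ b, ∀ a, ¬ R a b
    · obtain ⟨b, hb⟩ := h3
      obtain _ | n := n
      · exact b.elim0
      let f' : (Fin m → Bool) → (Fin n → Bool) := fun x j => f x (b.succAbove j)
      have hf' : CubeNF f' (fun a j => R a (b.succAbove j)) (fun j => c (b.succAbove j)) :=
        ⟨fun h1 h2 h3 => b.strictMono_succAbove.le_iff_le.1 (h.mono h1 h2 h3), fun x j => by
          simp [f', h.eq_true_iff]⟩
      have hf : f = fun x => cubeFace b (decide (c b)) (f' x) := by
        funext x j
        cases j using b.succAboveCases with
        | x =>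
          rw [Bool.eq_iff_iff, h.eq_true_iff]
          simp [cubeFace, hb]
        | p j => simp [cubeFace, f']
      rw [hf]
      exact .comp (CubeNF.isCubical (m + n) (by omega) hf') (.face b _)
    push Not at h1 h2 h3
    choose g hg hgc using h1
    have hmono : StrictMono g := by
      obtain _ | m := m
      · exact fun a => a.elim0
      rw [Fin.strictMono_iff_lt_succ]
      intro i
      refine lt_of_le_of_ne (h.mono (hg _) (hg _) (Fin.castSucc_lt_succ).le) fun he => ?_
      exact h2 i.castSucc i.succ (g i.castSucc) rfl (hg _) (he ▸ hg _)
    have hsurj : Function.Surjective g := fun b => by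
      obtain ⟨a, ha⟩ := h3 b
      exact ⟨a, h.functional (hg a) ha⟩
    obtain rfl : m = n := by
      simpa using Fintype.card_of_bijective ⟨hmono.injective, hsurj⟩
    have hid : ∀ a, g a = a := fun a => by
      have := Subsingleton.elim (hmono.orderIsoOfSurjective g hsurj) (OrderIso.refl (Fin m))
      exact DFunLike.congr_fun this a
    have hf : f = fun x => x := by
      funext x b
      rw [Bool.eq_iff_iff, h.eq_true_iff]
      constructor
      · rintro (hc | ⟨a, ha, hx⟩)
        · exact (hgc b (by rwa [hid])).elim
        · rwa [← h.functional (hg a) ha, hid]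
      · intro hx
        exact Or.inr ⟨b, by simpa only [hid] using hg b, hx⟩
    rw [hf]
    exact .id _
  termination_by N => N
  decreasing_by all_goals omega

/-- The boolean with index `i` of a vertex of a cube, `false` for `i` out of range. -/
def bit {n : ℕ} (x : Fin n → Bool) (i : ℕ) : Bool := if h : i < n then x ⟨i, h⟩ else false

lemma bit_val {n : ℕ} (x : Fin n → Bool) (i : Fin n) : bit x i = x i := by simp [bit]

lemma bit_ext {n : ℕ} {x y : Fin n → Bool} (h : ∀ i < n, bit x i = bit y i) : x = y := by
  funext i
  rw [← bit_val x, ← bit_val y, h i i.2]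

lemma bit_append {m n : ℕ} (x : Fin m → Bool) (y : Fin n → Bool) (i : ℕ) :
    bit (Fin.append x y) i = if i < m then bit x i else bit y (i - m) := by
  unfold bit
  split_ifs with h1 h2 h3 h3
  · exact Fin.append_left x y ⟨i, h2⟩
  · have := Fin.append_right x y ⟨i - m, h3⟩
    rw [← this]
    congr 1
    ext
    simp
    omega
  all_goals first | omega | rfl

lemma bit_append_assoc {l m n : ℕ} (x : Fin l → Bool) (y : Fin m → Bool) (z : Fin n → Bool)
    (i : ℕ) : bit (Fin.append (Fin.append x y) z) i = bit (Fin.append x (Fin.append y z)) i := by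
  simp only [bit_append]
  split_ifs <;> first | omega | rfl | (congr 1; omega)

lemma bit_castAdd {m n : ℕ} (x : Fin (m + n) → Bool) (i : ℕ) :
    bit (fun j : Fin m => x (Fin.castAdd n j)) i = if i < m then bit x i else false := by
  unfold bit
  split_ifs <;> first | omega | rfl

lemma bit_natAdd {m n : ℕ} (x : Fin (m + n) → Bool) (i : ℕ) :
    bit (fun j : Fin n => x (Fin.natAdd m j)) i = bit x (m + i) := by
  unfold bit
  split_ifs <;> first | omega | rfl

lemma bit_cast {m n : ℕ} (h : n = m) (x : Fin m → Bool) (i : ℕ) :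
    bit (fun j : Fin n => x (Fin.cast h j)) i = bit x i := by
  subst h
  rfl

lemma bit_of_le {n : ℕ} (x : Fin n → Bool) {i : ℕ} (h : n ≤ i) : bit x i = false := by
  simp [bit, h]

end Cubes

/-- The cube category: its objects are the sets `2ⁿ = {0, 1}ⁿ`, its morphisms the maps generated by
cofaces, codegeneracies and coconnections. -/
structure Cube where
  dim : ℕ

namespace Cube

instance : Category Cube where
  Hom A B := {f : (Fin A.dim → Bool) → (Fin B.dim → Bool) // IsCubical f}
  id A := ⟨fun x => x, .id _⟩
  comp f g := ⟨fun x => g.1 (f.1 x), .comp f.2 g.2⟩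

lemma hom_ext {A B : Cube} {f g : A ⟶ B} (h : ∀ x, ∀ i < B.dim, bit (f.1 x) i = bit (g.1 x) i) :
    f = g :=
  Subtype.ext (funext fun x => bit_ext (h x))

@[simp] lemma id_val (A : Cube) (x) : (𝟙 A : A ⟶ A).1 x = x := rfl
@[simp] lemma comp_val {A B C : Cube} (f : A ⟶ B) (g : B ⟶ C) (x) : (f ≫ g).1 x = g.1 (f.1 x) := rfl

/-- The product of two maps of cubes. -/
def tensorMap {A B A' B' : Cube} (f : A ⟶ B) (g : A' ⟶ B') :
    (Cube.mk (A.dim + A'.dim)) ⟶ (Cube.mk (B.dim + B'.dim)) :=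
  ⟨fun x => Fin.append (f.1 fun i => x (Fin.castAdd _ i)) (g.1 fun i => x (Fin.natAdd _ i)), by
    obtain ⟨f, hf⟩ := f
    obtain ⟨g, hg⟩ := g
    obtain ⟨R, c, hf⟩ := hf.exists_nf
    obtain ⟨S, d, hg⟩ := hg.exists_nf
    refine CubeNF.isCubical (R := fun a b =>
      (∃ i j, a = Fin.castAdd _ i ∧ b = Fin.castAdd _ j ∧ R i j) ∨
      (∃ i j, a = Fin.natAdd _ i ∧ b = Fin.natAdd _ j ∧ S i j))
      (c := fun b => (∃ j, b = Fin.castAdd _ j ∧ c j) ∨ ∃ j, b = Fin.natAdd _ j ∧ d j) _ rfl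
      ⟨?_, fun x b => ?_⟩
    · rintro a a' b b' (⟨i, j, rfl, rfl, h1⟩ | ⟨i, j, rfl, rfl, h1⟩)
        (⟨i', j', rfl, rfl, h2⟩ | ⟨i', j', rfl, rfl, h2⟩) h
      · exact hf.mono h1 h2 h
      · simp only [Fin.le_def, Fin.val_castAdd, Fin.val_natAdd]
        omega
      · simp only [Fin.le_def, Fin.val_castAdd, Fin.val_natAdd] at h
        omega
      · simp only [Fin.le_def, Fin.val_natAdd, add_le_add_iff_left] at h ⊢
        exact hg.mono h1 h2 h
    · cases b using Fin.addCases with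
      | left b =>
        have h1 : ∀ j, Fin.castAdd B'.dim b ≠ Fin.natAdd B.dim j := fun j h => by
          simp [Fin.ext_iff] at h; omega
        have h2 : ∀ j, Fin.castAdd B'.dim b = Fin.castAdd B'.dim j ↔ j = b := fun j => by
          simp [Fin.ext_iff, eq_comm]
        simp only [Fin.append_left, hf.eq_true_iff, h1, h2, false_and, and_false, exists_false,
          or_false, exists_eq_left]
        refine or_congr Iff.rfl ⟨?_, ?_⟩
        · rintro ⟨a, h, hx⟩
          exact ⟨_, ⟨a, b, rfl, rfl, h⟩, hx⟩
        · rintro ⟨_, ⟨a, j, rfl, rfl, h⟩, hx⟩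
          exact ⟨a, h, hx⟩
      | right b =>
        have h1 : ∀ j, Fin.natAdd B.dim b ≠ Fin.castAdd B'.dim j := fun j h => by
          simp [Fin.ext_iff] at h; omega
        have h2 : ∀ j, Fin.natAdd B.dim b = Fin.natAdd B.dim j ↔ j = b := fun j => by
          simp [Fin.ext_iff, eq_comm]
        simp only [Fin.append_right, hg.eq_true_iff, h1, h2, false_and, and_false, exists_false,
          false_or, exists_eq_left]
        refine or_congr Iff.rfl ⟨?_, ?_⟩
        · rintro ⟨a, h, hx⟩
          exact ⟨_, ⟨a, b, rfl, rfl, h⟩, hx⟩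
        · rintro ⟨_, ⟨a, j, rfl, rfl, h⟩, hx⟩
          exact ⟨a, h, hx⟩⟩

/-- The isomorphism between two cubes of the same dimension. -/
def castHom {A B : Cube} (h : A.dim = B.dim) : A ⟶ B :=
  ⟨fun x i => x (Fin.cast h.symm i), by
    refine CubeNF.isCubical (R := fun a b => a.val = b.val) (c := fun _ => False) _ rfl
      ⟨fun h1 h2 h => ?_, fun x b => ?_⟩
    · simp only [Fin.le_def] at *
      omega
    · simp only [false_or]
      constructor
      · intro hx
        exact ⟨_, rfl, hx⟩
      · rintro ⟨a, ha, hx⟩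
        obtain rfl : a = Fin.cast h.symm b := Fin.ext ha
        exact hx⟩

lemma bit_tensorMap {A B A' B' : Cube} (f : A ⟶ B) (g : A' ⟶ B') (x) (i : ℕ) :
    bit ((tensorMap f g).1 x) i = if i < B.dim then bit (f.1 fun i => x (Fin.castAdd _ i)) i
      else bit (g.1 fun i => x (Fin.natAdd _ i)) (i - B.dim) :=
  bit_append _ _ _

lemma bit_castHom {A B : Cube} (h : A.dim = B.dim) (x) (i : ℕ) :
    bit ((castHom h).1 x) i = bit x i :=
  bit_cast h.symm x i

/-- The isomorphism between two cubes of the same dimension. -/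
def castIso {A B : Cube} (h : A.dim = B.dim) : A ≅ B where
  hom := castHom h
  inv := castHom h.symm

instance : MonoidalCategoryStruct Cube where
  tensorObj A B := ⟨A.dim + B.dim⟩
  tensorHom f g := tensorMap f g
  whiskerLeft A _ _ f := tensorMap (𝟙 A) f
  whiskerRight f A := tensorMap f (𝟙 A)
  tensorUnit := ⟨0⟩
  associator A B C := castIso (Nat.add_assoc A.dim B.dim C.dim)
  leftUnitor A := castIso (Nat.zero_add A.dim)
  rightUnitor A := castIso (Nat.add_zero A.dim)

/-- The vertex of a product of cubes with given components. -/
def tens {A B : Cube} (x : Fin A.dim → Bool) (y : Fin B.dim → Bool) : Fin (A ⊗ B).dim → Bool :=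
  Fin.append x y

lemma tens_pieces {A B : Cube} (x : Fin (A ⊗ B).dim → Bool) :
    tens (A := A) (B := B) (fun i => x (Fin.castAdd _ i)) (fun i => x (Fin.natAdd _ i)) = x := by
  funext i
  cases i using Fin.addCases (m := A.dim) (n := B.dim) <;> simp [tens]

lemma tensor_ext {A B C : Cube} {f g : A ⊗ B ⟶ C}
    (h : ∀ (x : Fin A.dim → Bool) (y : Fin B.dim → Bool), f.1 (tens x y) = g.1 (tens x y)) :
    f = g :=
  Subtype.ext (funext fun x => by
    rw [← tens_pieces x]
    exact h _ _)

lemma tensor_ext₃ {A B C D : Cube} {f g : (A ⊗ B) ⊗ C ⟶ D}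
    (h : ∀ (x : Fin A.dim → Bool) (y : Fin B.dim → Bool) (z : Fin C.dim → Bool),
      f.1 (tens (tens x y) z) = g.1 (tens (tens x y) z)) : f = g :=
  tensor_ext fun x z => by
    rw [← tens_pieces x]
    exact h _ _ _

lemma tensorHom_tens {A B A' B' : Cube} (f : A ⟶ B) (g : A' ⟶ B') (x : Fin A.dim → Bool)
    (y : Fin A'.dim → Bool) : (f ⊗ₘ g).1 (tens x y) = tens (f.1 x) (g.1 y) := by
  change Fin.append (f.1 fun i => Fin.append x y (Fin.castAdd _ i))
    (g.1 fun i => Fin.append x y (Fin.natAdd _ i)) = _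
  simp only [Fin.append_left, Fin.append_right]
  rfl

lemma whiskerLeft_tens (A : Cube) {B C : Cube} (f : B ⟶ C) (x : Fin A.dim → Bool)
    (y : Fin B.dim → Bool) : (A ◁ f).1 (tens x y) = tens x (f.1 y) :=
  tensorHom_tens (𝟙 A) f x y

lemma whiskerRight_tens (A : Cube) {B C : Cube} (f : B ⟶ C) (x : Fin B.dim → Bool)
    (y : Fin A.dim → Bool) : (f ▷ A).1 (tens x y) = tens (f.1 x) y :=
  tensorHom_tens f (𝟙 A) x y

lemma associator_tens {A B C : Cube} (x : Fin A.dim → Bool) (y : Fin B.dim → Bool)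
    (z : Fin C.dim → Bool) :
    (α_ A B C).hom.1 (tens (tens x y) z) = tens x (tens y z) :=
  bit_ext fun i _ =>
    (bit_castHom (Nat.add_assoc A.dim B.dim C.dim) _ i).trans (bit_append_assoc x y z i)

lemma leftUnitor_tens {A : Cube} (x : Fin (𝟙_ Cube).dim → Bool) (y : Fin A.dim → Bool) :
    (λ_ A).hom.1 (tens x y) = y :=
  bit_ext fun i _ => (bit_castHom (Nat.zero_add A.dim) _ i).trans (bit_append x y i)

lemma rightUnitor_tens {A : Cube} (x : Fin A.dim → Bool) (y : Fin (𝟙_ Cube).dim → Bool) :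
    (ρ_ A).hom.1 (tens x y) = x :=
  bit_ext fun i hi =>
    ((bit_castHom (Nat.add_zero A.dim) _ i).trans (bit_append x y i)).trans (if_pos hi)

instance : MonoidalCategory Cube where
  tensorHom_def f g := tensor_ext fun x y => by
    simp only [comp_val, tensorHom_tens, whiskerRight_tens, whiskerLeft_tens]
  id_tensorHom_id A B := tensor_ext fun x y => by
    simp only [tensorHom_tens, id_val]
  tensorHom_comp_tensorHom f₁ f₂ g₁ g₂ := tensor_ext fun x y => by
    simp only [comp_val, tensorHom_tens]
  whiskerLeft_id A B := tensor_ext fun x y => by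
    simp only [whiskerLeft_tens, id_val]
  id_whiskerRight A B := tensor_ext fun x y => by
    simp only [whiskerRight_tens, id_val]
  associator_naturality f g h := tensor_ext₃ fun x y z => by
    simp only [comp_val, tensorHom_tens, associator_tens]
  leftUnitor_naturality f := tensor_ext fun x y => by
    simp only [comp_val, whiskerLeft_tens, leftUnitor_tens]
  rightUnitor_naturality f := tensor_ext fun x y => by
    simp only [comp_val, whiskerRight_tens, rightUnitor_tens]
  pentagon A B C D := tensor_ext₃ fun x y z => by
    rw [← tens_pieces x]
    simp only [comp_val, whiskerLeft_tens, whiskerRight_tens, associator_tens]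
  triangle A B := tensor_ext₃ fun x y z => by
    simp only [comp_val, whiskerLeft_tens, whiskerRight_tens, associator_tens, leftUnitor_tens,
      rightUnitor_tens]

end Cube

end

section

/-! ### Lax monoidal functors to sets

For a small monoidal category `C`, monoids in the category of presheaves on `C` with respect to Day
convolution are the same as lax monoidal functors from `Cᵒᵖ` to the cartesian monoidal category of
sets: the product corresponds to the maps `Y(A) × Y(B) → Y(A ⊗ B)`, the unit to an element of `Y(𝟙)`.
-/

section LaxMonoidal

lemma types_congr {X Y : Type u} {f g : X ⟶ Y} (h : f = g) (x : X) : f x = g x := by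
  rw [h]

variable {C : Type*} [Category C] [MonoidalCategory C] (F : C ⥤ Type u) [F.LaxMonoidal]

/-- The product of two elements. -/
def lmul {A B : C} (x : F.obj A) (y : F.obj B) : F.obj (A ⊗ B) :=
  Functor.LaxMonoidal.μ F A B ((x, y) : F.obj A × F.obj B)

/-- The unit element. -/
def lone : F.obj (𝟙_ C) := Functor.LaxMonoidal.ε F PUnit.unit

lemma map_lmul {A B A' B' : C} (f : A ⟶ A') (g : B ⟶ B') (x : F.obj A) (y : F.obj B) :
    F.map (f ⊗ₘ g) (lmul F x y) = lmul F (F.map f x) (F.map g y) :=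
  (types_congr (Functor.LaxMonoidal.μ_natural F f g)
    (x, y)).symm

lemma lmul_assoc {A B D : C} (x : F.obj A) (y : F.obj B) (z : F.obj D) :
    F.map (α_ A B D).hom (lmul F (lmul F x y) z) = lmul F x (lmul F y z) :=
  types_congr (Functor.LaxMonoidal.associativity F A B D)
    ((x, y), z)

lemma lone_lmul {A : C} (x : F.obj A) : F.map (λ_ A).hom (lmul F (lone F) x) = x :=
  (types_congr (Functor.LaxMonoidal.left_unitality F A)
    (PUnit.unit, x)).symm

lemma lmul_lone {A : C} (x : F.obj A) : F.map (ρ_ A).hom (lmul F x (lone F)) = x :=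
  (types_congr (Functor.LaxMonoidal.right_unitality F A)
    (x, PUnit.unit)).symm

variable {F}

lemma app_lmul {G : C ⥤ Type u} [G.LaxMonoidal] (α : F ⟶ G) [NatTrans.IsMonoidal α] {A B : C}
    (x : F.obj A) (y : F.obj B) :
    α.app _ (lmul F x y) = lmul G (α.app _ x) (α.app _ y) :=
  types_congr (NatTrans.IsMonoidal.tensor (τ := α) A B)
    (x, y)

lemma app_lone {G : C ⥤ Type u} [G.LaxMonoidal] (α : F ⟶ G) [NatTrans.IsMonoidal α] :
    α.app _ (lone F) = lone G :=
  types_congr (NatTrans.IsMonoidal.unit (τ := α)) PUnit.unit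

/-- A functor to sets is lax monoidal if it carries suitable products of elements and a unit. -/
@[reducible] def laxMonoidalOfMul (F : C ⥤ Type u)
    (mul : ∀ {A B : C}, F.obj A → F.obj B → F.obj (A ⊗ B)) (one : F.obj (𝟙_ C))
    (map_mul : ∀ {A B A' B' : C} (f : A ⟶ A') (g : B ⟶ B') (x : F.obj A) (y : F.obj B),
      F.map (f ⊗ₘ g) (mul x y) = mul (F.map f x) (F.map g y))
    (mul_assoc : ∀ {A B D : C} (x : F.obj A) (y : F.obj B) (z : F.obj D),
      F.map (α_ A B D).hom (mul (mul x y) z) = mul x (mul y z))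
    (one_mul : ∀ {A : C} (x : F.obj A), F.map (λ_ A).hom (mul one x) = x)
    (mul_one : ∀ {A : C} (x : F.obj A), F.map (ρ_ A).hom (mul x one) = x) :
    F.LaxMonoidal where
  ε := ↾fun _ => one
  μ A B := ↾fun p : F.obj A × F.obj B => mul p.1 p.2
  μ_natural_left {A B} f X' := by
    ext p
    have := map_mul f (𝟙 X') p.1 p.2
    rw [tensorHom_id, F.map_id] at this
    exact this.symm
  μ_natural_right X' f := by
    ext p
    have := map_mul (𝟙 X') f p.1 p.2
    rw [id_tensorHom, F.map_id] at this
    exact this.symm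
  associativity A B D := by
    ext p
    exact mul_assoc p.1.1 p.1.2 p.2
  left_unitality A := by
    ext p
    exact (one_mul p.2).symm
  right_unitality A := by
    ext p
    exact (mul_one p.1).symm

end LaxMonoidal

end

section

namespace Cube

/-- The coface `δ_i^ε` as a morphism. -/
def face {n : ℕ} (i : Fin (n + 1)) (ε : Bool) : Cube.mk n ⟶ Cube.mk (n + 1) :=
  ⟨cubeFace i ε, .face i ε⟩

/-- The codegeneracy `σ_i` as a morphism. -/
def degen {n : ℕ} (i : Fin (n + 1)) : Cube.mk (n + 1) ⟶ Cube.mk n := ⟨cubeDegen i, .degen i⟩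

/-- The coconnection `γ_i` as a morphism. -/
def conn {n : ℕ} (i : Fin n) : Cube.mk (n + 1) ⟶ Cube.mk n := ⟨cubeConn i, .conn i⟩

lemma bit_face {n : ℕ} (i : Fin (n + 1)) (ε : Bool) (x) (l : ℕ) (hl : l < n + 1) :
    bit ((face i ε).1 x) l =
      if l < i then bit x l else if l = i then ε else bit x (l - 1) := by
  obtain ⟨l, rfl⟩ : ∃ l' : Fin (n + 1), l = l' := ⟨⟨l, hl⟩, rfl⟩
  rw [bit_val]
  cases l using i.succAboveCases with
  | x => simp [face, cubeFace]
  | p j =>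
    simp only [face, cubeFace, Fin.insertNth_apply_succAbove]
    rw [← bit_val x j]
    by_cases h : j.castSucc < i
    · rw [Fin.succAbove_of_castSucc_lt _ _ h, if_pos (by simpa [Fin.lt_def] using h)]
      rfl
    · have h' : i ≤ j.castSucc := not_lt.1 h
      rw [Fin.succAbove_of_le_castSucc _ _ h']
      simp only [Fin.le_def, Fin.val_castSucc] at h'
      rw [if_neg (by simp; omega), if_neg (by simp; omega)]
      simp

lemma bit_succAbove {n : ℕ} (i : Fin (n + 1)) (x : Fin (n + 1) → Bool) (j : Fin n) :
    x (i.succAbove j) = bit x (if j.val < i then j else j + 1) := by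
  rw [← bit_val x]
  congr 1
  simp only [Fin.succAbove, Fin.lt_def, Fin.val_castSucc]
  split_ifs <;> rfl

lemma bit_degen {n : ℕ} (i : Fin (n + 1)) (x) (l : ℕ) (hl : l < n) :
    bit ((degen i).1 x) l = bit x (if l < i then l else l + 1) := by
  obtain ⟨l, rfl⟩ : ∃ l' : Fin n, l = l' := ⟨⟨l, hl⟩, rfl⟩
  rw [bit_val]
  exact bit_succAbove i x l

lemma bit_conn {n : ℕ} (i : Fin n) (x) (l : ℕ) (hl : l < n) :
    bit ((conn i).1 x) l = if l = i then bit x i || bit x (i + 1)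
      else bit x (if l < i then l else l + 1) := by
  obtain ⟨l, rfl⟩ : ∃ l' : Fin n, l = l' := ⟨⟨l, hl⟩, rfl⟩
  rw [bit_val]
  simp only [conn, cubeConn, ← Fin.ext_iff]
  split_ifs with h1 h2 h2
  · rw [← bit_val x, ← bit_val x]; rfl
  · rw [bit_succAbove i.castSucc x, if_pos (by simpa using h2)]
  · rw [bit_succAbove i.castSucc x, if_neg (by simpa using h2)]

/-- The coface with index a natural number, for arbitrary cubes. -/
def faceN (A : Cube) (i : ℕ) (ε : Bool) : Cube.mk (A.dim - 1) ⟶ A :=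
  if h : i < A.dim then (castHom rfl : _ ⟶ Cube.mk (A.dim - 1)) ≫
    face ⟨i, by omega⟩ ε ≫ castHom (B := A) (by simp; omega)
  else ⟨fun x b => bit x b, CubeNF.isCubical (R := fun a b => a.val = b.val) (c := fun _ => False)
    _ rfl ⟨fun h1 h2 h3 => by simp only [Fin.le_def] at *; omega, fun x b => by
      simp only [false_or]
      constructor
      · intro hx
        unfold bit at hx
        split_ifs at hx with hb
        exact ⟨_, rfl, hx⟩
      · rintro ⟨a, ha, hx⟩
        rwa [← ha, bit_val]⟩⟩

lemma bit_faceN (A : Cube) {i : ℕ} (hi : i < A.dim) (ε : Bool) (x) (l : ℕ) :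
    bit ((faceN A i ε).1 x) l = if l < A.dim then
      if l < i then bit x l else if l = i then ε else bit x (l - 1) else false := by
  by_cases hl : l < A.dim
  swap; · rw [if_neg hl]; exact bit_of_le _ (not_lt.1 hl)
  rw [faceN, dif_pos hi, if_pos hl]
  simp only [comp_val, bit_castHom]
  rw [bit_face _ _ _ _ (by omega)]
  simp only [bit_castHom]

/-- The codegeneracy with index a natural number, for arbitrary cubes. -/
def degenN (A : Cube) (i : ℕ) : Cube.mk (A.dim + 1) ⟶ A :=
  degen ⟨min i A.dim, by omega⟩

lemma bit_degenN (A : Cube) {i : ℕ} (hi : i ≤ A.dim) (x) (l : ℕ) :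
    bit ((degenN A i).1 x) l = if l < A.dim then bit x (if l < i then l else l + 1) else false := by
  by_cases hl : l < A.dim
  swap; · rw [if_neg hl]; exact bit_of_le _ (not_lt.1 hl)
  refine (bit_degen _ _ _ hl).trans ?_
  simp [min_eq_left hi, hl]

/-- The coconnection with index a natural number, for arbitrary cubes. -/
def connN (A : Cube) (i : ℕ) : Cube.mk (A.dim + 1) ⟶ A :=
  if h : i < A.dim then conn ⟨i, h⟩ else degenN A i

lemma bit_connN (A : Cube) {i : ℕ} (hi : i < A.dim) (x) (l : ℕ) :
    bit ((connN A i).1 x) l = if l < A.dim then if l = i then bit x i || bit x (i + 1)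
      else bit x (if l < i then l else l + 1) else false := by
  by_cases hl : l < A.dim
  swap; · rw [if_neg hl]; exact bit_of_le _ (not_lt.1 hl)
  rw [connN, dif_pos hi, if_pos hl]
  exact bit_conn _ _ _ hl

end Cube

open CubicalCobar.Cube

/-- The cells of a cubical set. -/
structure Cells (Y : Cubeᵒᵖ ⥤ Type u) : Type u where
  cube : Cube
  val : Y.obj (op cube)

namespace Cells

variable {Y : Cubeᵒᵖ ⥤ Type u}

/-- The dimension of a cell. -/
def dim (c : Cells Y) : ℕ := c.cube.dim

/-- A cell is degenerate if it is in the image of a degeneracy or of a connection. -/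
def IsDegenerate (c : Cells Y) : Prop :=
  ∃ n : ℕ, (∃ (i : Fin (n + 1)) (y : Y.obj (op (Cube.mk n))), c = ⟨_, Y.map (degen i).op y⟩) ∨
    ∃ (i : Fin n) (y : Y.obj (op (Cube.mk n))), c = ⟨_, Y.map (conn i).op y⟩

/-- Restriction of a cell along a map of cubes. -/
def pull (c : Cells Y) {A : Cube} (f : A ⟶ c.cube) : Cells Y := ⟨A, Y.map f.op c.val⟩

lemma pull_pull (c : Cells Y) {A B : Cube} (f : A ⟶ c.cube) (g : B ⟶ A) :
    (c.pull f).pull g = c.pull (g ≫ f) := by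
  simp [pull]
  rfl

lemma pull_id (c : Cells Y) : c.pull (𝟙 _) = c := by
  simp [pull]

lemma pull_ext (c : Cells Y) {A B : Cube} {f : A ⟶ c.cube} {g : B ⟶ c.cube} (h : A.dim = B.dim)
    (H : ∀ x y, (∀ i, bit x i = bit y i) → ∀ i < c.cube.dim, bit (f.1 x) i = bit (g.1 y) i) :
    c.pull f = c.pull g := by
  obtain ⟨m⟩ := A
  obtain ⟨n⟩ := B
  obtain rfl : m = n := h
  obtain rfl : f = g := hom_ext fun x i hi => H x x (fun _ => rfl) i hi
  rfl

lemma pull_eq_self (c : Cells Y) {A : Cube} {f : A ⟶ c.cube} (h : A.dim = c.cube.dim)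
    (H : ∀ x, ∀ i < c.cube.dim, bit (f.1 x) i = bit x i) : c.pull f = c := by
  conv_rhs => rw [← pull_id c]
  exact pull_ext c h fun x y hxy i hi => by rw [H x i hi, hxy, id_val]

/-- The face of a cell in direction `i`. -/
def dface (c : Cells Y) (i : ℕ) (ε : Bool) : Cells Y := c.pull (faceN c.cube i ε)

lemma isDegenerate_degen (c : Cells Y) {A : Cube} (f : A ⟶ c.cube) (hd : A.dim = c.cube.dim + 1) (j : ℕ)
    (hj : j ≤ c.cube.dim)
    (H : ∀ x, ∀ i < c.cube.dim, bit (f.1 x) i = bit x (if i < j then i else i + 1)) :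
    (c.pull f).IsDegenerate := by
  refine ⟨c.cube.dim, Or.inl ⟨⟨j, by omega⟩, c.val, ?_⟩⟩
  refine pull_ext c hd fun x y hxy i hi => ?_
  rw [H x i hi, bit_degen _ _ _ hi, hxy]

lemma isDegenerate_conn (c : Cells Y) {A : Cube} (f : A ⟶ c.cube) (hd : A.dim = c.cube.dim + 1) (j : ℕ)
    (hj : j < c.cube.dim)
    (H : ∀ x, ∀ i < c.cube.dim, bit (f.1 x) i = if i = j then bit x j || bit x (j + 1)
      else bit x (if i < j then i else i + 1)) :
    (c.pull f).IsDegenerate := by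
  refine ⟨c.cube.dim, Or.inr ⟨⟨j, by omega⟩, c.val, ?_⟩⟩
  refine pull_ext c hd fun x y hxy i hi => ?_
  rw [H x i hi, bit_conn _ _ _ hi, hxy, hxy, hxy]

lemma dface_dface (c : Cells Y) {i j : ℕ} (hij : i ≤ j) (hj : j + 1 < c.dim) (ε η : Bool) :
    (c.dface i ε).dface j η = (c.dface (j + 1) η).dface i ε := by
  have hd : j + 1 < c.cube.dim := hj
  refine (pull_pull c (faceN c.cube i ε) (faceN ⟨c.cube.dim - 1⟩ j η)).trans
    (.trans ?_ (pull_pull c (faceN c.cube (j + 1) η) (faceN ⟨c.cube.dim - 1⟩ i ε)).symm)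
  refine pull_ext c rfl fun x y hxy l hl => ?_
  simp only [comp_val]
  have h1 : i < c.cube.dim := by omega
  have h2 : j < c.cube.dim - 1 := by omega
  have h3 : i < c.cube.dim - 1 := by omega
  simp only [bit_faceN c.cube h1, bit_faceN c.cube hd, bit_faceN ⟨c.cube.dim - 1⟩ h2,
    bit_faceN ⟨c.cube.dim - 1⟩ h3, hxy]
  clear hj
  grind

lemma isDegenerate_iff (c : Cells Y) : c.IsDegenerate ↔ ∃ (c' : Cells Y) (i : ℕ),
    (i ≤ c'.cube.dim ∧ c = c'.pull (degenN c'.cube i)) ∨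
      (i < c'.cube.dim ∧ c = c'.pull (connN c'.cube i)) := by
  constructor
  · rintro ⟨n, ⟨i, y, rfl⟩ | ⟨i, y, rfl⟩⟩
    · refine ⟨⟨_, y⟩, i, Or.inl ⟨i.is_le, pull_ext ⟨_, y⟩ rfl fun x z hxz l hl => ?_⟩⟩
      have hi : i.val ≤ n := i.is_le
      change l < n at hl
      rw [bit_degen _ _ _ hl, bit_degenN ⟨n⟩ hi, hxz, if_pos hl]
    · refine ⟨⟨_, y⟩, i, Or.inr ⟨i.2, pull_ext ⟨_, y⟩ rfl fun x z hxz l hl => ?_⟩⟩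
      change l < n at hl
      rw [bit_conn _ _ _ hl, bit_connN ⟨n⟩ i.2, hxz, hxz, hxz, if_pos hl]
  · rintro ⟨c', i, ⟨hi, rfl⟩ | ⟨hi, rfl⟩⟩
    · refine isDegenerate_degen c' _ rfl i hi fun x l hl => ?_
      rw [bit_degenN _ hi, if_pos hl]
    · refine isDegenerate_conn c' _ rfl i hi fun x l hl => ?_
      rw [bit_connN _ hi, if_pos hl]

lemma dface_pull (c : Cells Y) {A : Cube} (f : A ⟶ c.cube) (j : ℕ) (ε : Bool) :
    (c.pull f).dface j ε = c.pull (faceN A j ε ≫ f) :=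
  pull_pull c f (faceN A j ε)

lemma isDegenerate_pull_degenN (c : Cells Y) {A : Cube} (f : A ⟶ c.cube) {i : ℕ}
    (hi : i ≤ A.dim) {B : Cube} (g : B ⟶ c.cube) (hB : B.dim = A.dim + 1)
    (H : ∀ x y, (∀ i, bit x i = bit y i) → ∀ l < c.cube.dim,
      bit (g.1 x) l = bit ((degenN A i ≫ f).1 y) l) : (c.pull g).IsDegenerate :=
  (isDegenerate_iff _).2 ⟨c.pull f, i, Or.inl ⟨hi, (pull_ext c hB H).trans
    (pull_pull c f (degenN A i)).symm⟩⟩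

lemma isDegenerate_pull_connN (c : Cells Y) {A : Cube} (f : A ⟶ c.cube) {i : ℕ}
    (hi : i < A.dim) {B : Cube} (g : B ⟶ c.cube) (hB : B.dim = A.dim + 1)
    (H : ∀ x y, (∀ i, bit x i = bit y i) → ∀ l < c.cube.dim,
      bit (g.1 x) l = bit ((connN A i ≫ f).1 y) l) : (c.pull g).IsDegenerate :=
  (isDegenerate_iff _).2 ⟨c.pull f, i, Or.inr ⟨hi, (pull_ext c hB H).trans
    (pull_pull c f (connN A i)).symm⟩⟩

/-- The faces of a degeneracy. -/
lemma dface_degen (c : Cells Y) {i : ℕ} (hi : i ≤ c.cube.dim) {j : ℕ} (hj : j ≤ c.cube.dim)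
    (ε : Bool) : (j = i ∧ (c.pull (degenN c.cube i)).dface j ε = c) ∨
      (j ≠ i ∧ ((c.pull (degenN c.cube i)).dface j ε).IsDegenerate) := by
  rw [dface_pull]
  have h1 : j < (Cube.mk (c.cube.dim + 1)).dim := Nat.lt_succ_of_le hj
  rcases lt_trichotomy j i with h | h | h
  · right
    have h2 : j < c.cube.dim := by omega
    have h3 : i - 1 ≤ (Cube.mk (c.cube.dim - 1)).dim := by simp only; omega
    refine ⟨h.ne, isDegenerate_pull_degenN c (faceN c.cube j ε) h3 _ (by simp only; omega) ?_⟩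
    intro x y hxy l hl
    simp only [comp_val, bit_degenN _ hi, bit_faceN _ h2, bit_degenN _ h3, bit_faceN _ h1, hxy]
    grind
  · left
    refine ⟨h, pull_eq_self c rfl fun x l hl => ?_⟩
    simp only [comp_val, bit_degenN c.cube hi, bit_faceN _ h1]
    grind
  · right
    have h2 : j - 1 < c.cube.dim := by omega
    have h3 : i ≤ (Cube.mk (c.cube.dim - 1)).dim := by simp only; omega
    refine ⟨h.ne', isDegenerate_pull_degenN c (faceN c.cube (j - 1) ε) h3 _ (by simp only; omega) ?_⟩
    intro x y hxy l hl
    simp only [comp_val, bit_degenN _ hi, bit_faceN _ h2, bit_degenN _ h3, bit_faceN _ h1, hxy]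
    grind

/-- The faces of a connection. -/
lemma dface_conn (c : Cells Y) {i : ℕ} (hi : i < c.cube.dim) {j : ℕ} (hj : j ≤ c.cube.dim)
    (ε : Bool) : ((j = i ∨ j = i + 1) ∧ ε = false ∧ (c.pull (connN c.cube i)).dface j ε = c) ∨
      (¬ ((j = i ∨ j = i + 1) ∧ ε = false) ∧
        ((c.pull (connN c.cube i)).dface j ε).IsDegenerate) := by
  rw [dface_pull]
  have h1 : j < (Cube.mk (c.cube.dim + 1)).dim := Nat.lt_succ_of_le hj
  by_cases h0 : j = i ∨ j = i + 1
  · cases ε with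
    | false =>
      left
      refine ⟨h0, rfl, pull_eq_self c rfl fun x l hl => ?_⟩
      simp only [comp_val, bit_connN _ hi, bit_faceN _ h1]
      rcases h0 with rfl | rfl
      · grind
      · grind
    | true =>
      right
      refine ⟨by simp, ?_⟩
      have h3 : i ≤ (Cube.mk (c.cube.dim - 1)).dim := by simp only; omega
      refine isDegenerate_pull_degenN c (faceN c.cube i true) h3 _ (by simp only; omega) ?_
      intro x y hxy l hl
      simp only [comp_val, bit_connN _ hi, bit_faceN _ hi, bit_degenN _ h3, bit_faceN _ h1, hxy]
      rcases h0 with rfl | rfl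
      · grind
      · grind
  right
  refine ⟨by tauto, ?_⟩
  rcases lt_or_ge j i with h | h
  · have h2 : j < c.cube.dim := by omega
    have h3 : i - 1 < (Cube.mk (c.cube.dim - 1)).dim := by simp only; omega
    refine isDegenerate_pull_connN c (faceN c.cube j ε) h3 _ (by simp only; omega) ?_
    intro x y hxy l hl
    simp only [comp_val, bit_connN _ hi, bit_faceN _ h2, bit_connN _ h3, bit_faceN _ h1, hxy]
    grind
  · have h2 : j - 1 < c.cube.dim := by omega
    have h3 : i < (Cube.mk (c.cube.dim - 1)).dim := by simp only; omega
    refine isDegenerate_pull_connN c (faceN c.cube (j - 1) ε) h3 _ (by simp only; omega) ?_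
    intro x y hxy l hl
    simp only [comp_val, bit_connN _ hi, bit_faceN _ h2, bit_connN _ h3, bit_faceN _ h1, hxy]
    grind

lemma sum_degenerate_eq_zero {A : Type*} [AddCommGroup A] (q : Cells Y → A)
    (hq : ∀ c : Cells Y, c.IsDegenerate → q c = 0) (c : Cells Y) (hc : c.IsDegenerate) :
    ∑ j ∈ Finset.range c.dim, ((-1 : ℤ) ^ (j + 1)) • (q (c.dface j true) - q (c.dface j false)) =
      0 := by
  obtain ⟨c', i, ⟨hi, rfl⟩ | ⟨hi, rfl⟩⟩ := (isDegenerate_iff c).1 hc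
  · refine Finset.sum_eq_zero fun j hj => ?_
    have hj : j ≤ c'.cube.dim := Nat.lt_succ_iff.1 (Finset.mem_range.1 hj)
    rcases dface_degen c' hi hj true with ⟨h1, h2⟩ | ⟨h1, h2⟩ <;>
    rcases dface_degen c' hi hj false with ⟨h3, h4⟩ | ⟨h3, h4⟩
    · rw [h2, h4, sub_self, smul_zero]
    · exact (h3 h1).elim
    · exact (h1 h3).elim
    · rw [hq _ h2, hq _ h4, sub_self, smul_zero]
  · have H (j : ℕ) (hj : j ≤ c'.cube.dim) : q ((c'.pull (connN c'.cube i)).dface j true) -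
        q ((c'.pull (connN c'.cube i)).dface j false) =
        if j = i ∨ j = i + 1 then - q c' else 0 := by
      have h1 : q ((c'.pull (connN c'.cube i)).dface j true) = 0 := by
        rcases dface_conn c' hi hj true with ⟨_, h, _⟩ | ⟨_, h⟩
        · simp at h
        · exact hq _ h
      rcases dface_conn c' hi hj false with ⟨h2, _, h3⟩ | ⟨h2, h3⟩
      · rw [h1, h3, zero_sub, if_pos h2]
      · rw [h1, hq _ h3, sub_zero, if_neg (by simpa using h2)]
    have hd : (c'.pull (connN c'.cube i)).dim = c'.cube.dim + 1 := rfl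
    rw [hd, Finset.sum_eq_add i (i + 1) (by omega)]
    · rw [H i (by omega), H (i + 1) (by omega)]
      simp [pow_succ]
    · intro j hj hj'
      rw [H j (Nat.lt_succ_iff.1 (Finset.mem_range.1 hj)), if_neg (by tauto), smul_zero]
    · intro h
      simp at h
      omega
    · intro h
      simp at h
      omega

end Cells

section Monoid

variable (Y : LaxMonoidalFunctor Cubeᵒᵖ (Type u))

instance : Monoid (Cells Y.toFunctor) where
  mul c c' := ⟨c.cube ⊗ c'.cube, lmul Y.toFunctor c.val c'.val⟩
  one := ⟨𝟙_ Cube, lone Y.toFunctor⟩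
  mul_assoc := by
    rintro ⟨A, a⟩ ⟨B, b⟩ ⟨C, c⟩
    refine .trans ?_ (congrArg (Cells.mk (A ⊗ B ⊗ C)) (lmul_assoc Y.toFunctor a b c))
    exact (Cells.pull_eq_self ⟨(A ⊗ B) ⊗ C, lmul Y.toFunctor (lmul Y.toFunctor a b) c⟩
      (f := (α_ A B C).inv) (Nat.add_assoc _ _ _).symm fun x i _ =>
        bit_castHom (Nat.add_assoc A.dim B.dim C.dim).symm x i).symm
  one_mul := by
    rintro ⟨A, a⟩
    refine .trans ?_ (congrArg (Cells.mk A) (lone_lmul Y.toFunctor a))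
    exact (Cells.pull_eq_self ⟨𝟙_ _ ⊗ A, lmul Y.toFunctor (lone Y.toFunctor) a⟩
      (f := (λ_ A).inv) (Nat.zero_add _).symm fun x i _ =>
        bit_castHom (Nat.zero_add A.dim).symm x i).symm
  mul_one := by
    rintro ⟨A, a⟩
    refine .trans ?_ (congrArg (Cells.mk A) (lmul_lone Y.toFunctor a))
    exact (Cells.pull_eq_self ⟨A ⊗ 𝟙_ _, lmul Y.toFunctor a (lone Y.toFunctor)⟩
      (f := (ρ_ A).inv) (Nat.add_zero _).symm fun x i _ =>
        bit_castHom (Nat.add_zero A.dim).symm x i).symm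

variable {Y}

lemma Cells.mul_def (c c' : Cells Y.toFunctor) :
    c * c' = ⟨c.cube ⊗ c'.cube, lmul Y.toFunctor c.val c'.val⟩ := rfl

lemma Cells.dim_mul (c c' : Cells Y.toFunctor) : (c * c').dim = c.dim + c'.dim := rfl

lemma Cells.pull_mul_pull (c c' : Cells Y.toFunctor) {A B : Cube} (f : A ⟶ c.cube)
    (g : B ⟶ c'.cube) : c.pull f * c'.pull g = (c * c').pull (f ⊗ₘ g) :=
  congrArg (Cells.mk (A ⊗ B)) (map_lmul Y.toFunctor f.op g.op c.val c'.val).symm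

end Monoid

end

section

open CubicalCobar.Cube

lemma Cube.tensorObj_dim (A B : Cube) : (A ⊗ B).dim = A.dim + B.dim := rfl

lemma Cube.exists_bit_tensorHom {A B A' B' : Cube} (f : A ⟶ B) (g : A' ⟶ B')
    (x : Fin (A ⊗ A').dim → Bool) : ∃ (x₁ : Fin A.dim → Bool) (x₂ : Fin A'.dim → Bool),
      (∀ j, bit x₁ j = if j < A.dim then bit x j else false) ∧
      (∀ j, bit x₂ j = bit x (A.dim + j)) ∧
      ∀ l, bit ((f ⊗ₘ g).1 x) l =
        if l < B.dim then bit (f.1 x₁) l else bit (g.1 x₂) (l - B.dim) :=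
  ⟨_, _, bit_castAdd (m := A.dim) (n := A'.dim) x, bit_natAdd (m := A.dim) (n := A'.dim) x,
    bit_append _ _⟩

namespace Cells

variable {Y : LaxMonoidalFunctor Cubeᵒᵖ (Type u)}

lemma pull_mul (c c' : Cells Y.toFunctor) {A : Cube} (f : A ⟶ c.cube) :
    c.pull f * c' = (c * c').pull (f ⊗ₘ 𝟙 c'.cube) := by
  rw [← pull_mul_pull, pull_id]

lemma mul_pull (c c' : Cells Y.toFunctor) {A : Cube} (f : A ⟶ c'.cube) :
    c * c'.pull f = (c * c').pull (𝟙 c.cube ⊗ₘ f) := by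
  rw [← pull_mul_pull, pull_id]

lemma dface_mul (c c' : Cells Y.toFunctor) {i : ℕ} (hi : i < c.dim) (ε : Bool) :
    (c * c').dface i ε = c.dface i ε * c' := by
  conv_rhs => rw [dface, pull_mul]
  have h1 : i < c.cube.dim := hi
  have h2 : i < (c.cube ⊗ c'.cube).dim := by rw [Cube.tensorObj_dim]; omega
  refine pull_ext (c * c') (by simp only [mul_def, Cube.tensorObj_dim]; omega)
    fun x y hxy l hl => ?_
  obtain ⟨x₁, x₂, hx₁, hx₂, h⟩ := Cube.exists_bit_tensorHom (faceN c.cube i ε) (𝟙 c'.cube) y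
  change l < c.cube.dim + c'.cube.dim at hl
  refine (bit_faceN _ h2 ε _ l).trans (.trans ?_ (h l).symm)
  simp only [bit_faceN _ h1, id_val, hx₁, hx₂, hxy, Cube.tensorObj_dim]
  grind

lemma mul_dface (c c' : Cells Y.toFunctor) {i : ℕ} (hi : i < c'.dim) (ε : Bool) :
    (c * c').dface (c.dim + i) ε = c * c'.dface i ε := by
  conv_rhs => rw [dface, mul_pull]
  have h1 : i < c'.cube.dim := hi
  have h2 : c.cube.dim + i < (c.cube ⊗ c'.cube).dim := by rw [Cube.tensorObj_dim]; omega
  refine pull_ext (c * c') (by simp only [mul_def, Cube.tensorObj_dim]; omega)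
    fun x y hxy l hl => ?_
  obtain ⟨x₁, x₂, hx₁, hx₂, h⟩ := Cube.exists_bit_tensorHom (𝟙 c.cube) (faceN c'.cube i ε) y
  change l < c.cube.dim + c'.cube.dim at hl
  refine (bit_faceN _ h2 ε _ l).trans (.trans ?_ (h l).symm)
  simp only [bit_faceN _ h1, id_val, hx₁, hx₂, hxy, Cube.tensorObj_dim]
  grind

lemma IsDegenerate.mul_right {c : Cells Y.toFunctor} (h : c.IsDegenerate) (c' : Cells Y.toFunctor) :
    (c * c').IsDegenerate := by
  obtain ⟨c, i, ⟨hi, rfl⟩ | ⟨hi, rfl⟩⟩ := (isDegenerate_iff c).1 h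
  · rw [pull_mul]
    have h0 : (c * c').cube.dim = c.cube.dim + c'.cube.dim := rfl
    refine isDegenerate_degen (c * c') _ (by rw [h0, Cube.tensorObj_dim]; ring) i (by omega)
      fun y l hl => ?_
    obtain ⟨x₁, x₂, hx₁, hx₂, h⟩ := Cube.exists_bit_tensorHom (degenN c.cube i) (𝟙 c'.cube) y
    refine (h l).trans ?_
    simp only [bit_degenN _ hi, id_val, hx₁, hx₂]
    grind
  · rw [pull_mul]
    have h0 : (c * c').cube.dim = c.cube.dim + c'.cube.dim := rfl
    refine isDegenerate_conn (c * c') _ (by rw [h0, Cube.tensorObj_dim]; ring) i (by omega)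
      fun y l hl => ?_
    obtain ⟨x₁, x₂, hx₁, hx₂, h⟩ := Cube.exists_bit_tensorHom (connN c.cube i) (𝟙 c'.cube) y
    refine (h l).trans ?_
    simp only [bit_connN _ hi, id_val, hx₁, hx₂]
    grind

lemma IsDegenerate.mul_left {c' : Cells Y.toFunctor} (h : c'.IsDegenerate)
    (c : Cells Y.toFunctor) : (c * c').IsDegenerate := by
  obtain ⟨c', i, ⟨hi, rfl⟩ | ⟨hi, rfl⟩⟩ := (isDegenerate_iff c').1 h
  · rw [mul_pull]
    have h0 : (c * c').cube.dim = c.cube.dim + c'.cube.dim := rfl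
    refine isDegenerate_degen (c * c') _ (by rw [h0, Cube.tensorObj_dim]; ring) (c.cube.dim + i)
      (by omega) fun y l hl => ?_
    obtain ⟨x₁, x₂, hx₁, hx₂, h⟩ := Cube.exists_bit_tensorHom (𝟙 c.cube) (degenN c'.cube i) y
    refine (h l).trans ?_
    simp only [bit_degenN _ hi, id_val, hx₁, hx₂]
    grind
  · rw [mul_pull]
    have h0 : (c * c').cube.dim = c.cube.dim + c'.cube.dim := rfl
    refine isDegenerate_conn (c * c') _ (by rw [h0, Cube.tensorObj_dim]; ring) (c.cube.dim + i)
      (by omega) fun y l hl => ?_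
    obtain ⟨x₁, x₂, hx₁, hx₂, h⟩ := Cube.exists_bit_tensorHom (𝟙 c.cube) (connN c'.cube i) y
    refine (h l).trans ?_
    simp only [bit_connN _ hi, id_val, hx₁, hx₂]
    grind

end Cells

section Chains

variable (k : Type v) [CommRing k] (Y : LaxMonoidalFunctor Cubeᵒᵖ (Type u))

/-- The span of the degenerate cells, in the algebra of all cells. -/
def degenerateSpan : Submodule k (MonoidAlgebra k (Cells Y.toFunctor)) :=
  Submodule.span k ((fun c => MonoidAlgebra.single c 1) '' {c : Cells Y.toFunctor | c.IsDegenerate})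

lemma mul_mem_degenerateSpan (a : MonoidAlgebra k (Cells Y.toFunctor)) {x}
    (hx : x ∈ degenerateSpan k Y) : a * x ∈ degenerateSpan k Y := by
  induction a using MonoidAlgebra.induction_linear with
  | zero => simp
  | add f g hf hg => rw [add_mul]; exact add_mem hf hg
  | single c r =>
    have : degenerateSpan k Y ≤ (degenerateSpan k Y).comap
        (LinearMap.mulLeft k (MonoidAlgebra.single c r)) := by
      conv_lhs => rw [degenerateSpan]
      rw [Submodule.span_le]
      rintro _ ⟨c', hc', rfl⟩
      simp only [SetLike.mem_coe, Submodule.mem_comap, LinearMap.mulLeft_apply,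
        MonoidAlgebra.single_mul_single]
      have := Submodule.smul_mem (degenerateSpan k Y) r
        (Submodule.subset_span ⟨_, hc'.mul_left c, rfl⟩)
      simpa [MonoidAlgebra.smul_single] using this
    exact this hx

lemma mul_mem_degenerateSpan' {x} (a : MonoidAlgebra k (Cells Y.toFunctor))
    (hx : x ∈ degenerateSpan k Y) : x * a ∈ degenerateSpan k Y := by
  induction a using MonoidAlgebra.induction_linear with
  | zero => simp
  | add f g hf hg => rw [mul_add]; exact add_mem hf hg
  | single c r =>
    have : degenerateSpan k Y ≤ (degenerateSpan k Y).comap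
        (LinearMap.mulRight k (MonoidAlgebra.single c r)) := by
      conv_lhs => rw [degenerateSpan]
      rw [Submodule.span_le]
      rintro _ ⟨c', hc', rfl⟩
      simp only [SetLike.mem_coe, Submodule.mem_comap, LinearMap.mulRight_apply,
        MonoidAlgebra.single_mul_single]
      have := Submodule.smul_mem (degenerateSpan k Y) r
        (Submodule.subset_span ⟨_, hc'.mul_right c, rfl⟩)
      simpa [MonoidAlgebra.smul_single] using this
    exact this hx

/-- The span of the degenerate cells is a two-sided ideal of the algebra of all cells. -/
def degenerateIdeal : Ideal (MonoidAlgebra k (Cells Y.toFunctor)) where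
  carrier := degenerateSpan k Y
  add_mem' := add_mem
  zero_mem' := (degenerateSpan k Y).zero_mem
  smul_mem' a _ hx := mul_mem_degenerateSpan k Y a hx

instance : (degenerateIdeal k Y).IsTwoSided where
  mul_mem_of_left b hx := mul_mem_degenerateSpan' k Y b hx

/-- The (normalized) chains of a cubical set: the free module on all cells modulo the degenerate
ones. The product of a monoid in cubical sets makes it into an algebra. -/
def CChains : Type (max u v) := MonoidAlgebra k (Cells Y.toFunctor) ⧸ degenerateIdeal k Y

instance : Ring (CChains k Y) := inferInstanceAs (Ring (_ ⧸ degenerateIdeal k Y))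

instance : Algebra k (CChains k Y) := inferInstanceAs (Algebra k (_ ⧸ degenerateIdeal k Y))

/-- The projection from the free module on all cells. -/
def toCChains : MonoidAlgebra k (Cells Y.toFunctor) →ₐ[k] CChains k Y :=
  Ideal.Quotient.mkₐ k (degenerateIdeal k Y)

lemma toCChains_surjective : Function.Surjective (toCChains k Y).toLinearMap :=
  Ideal.Quotient.mk_surjective

lemma ker_toCChains : LinearMap.ker (toCChains k Y).toLinearMap =
    degenerateSpan k Y := by
  ext x
  exact Ideal.Quotient.eq_zero_iff_mem

variable {Y}

/-- The class of a cell in the chains. -/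
def ccell (c : Cells Y.toFunctor) : CChains k Y := toCChains k Y (MonoidAlgebra.single c 1)

variable {k}

lemma ccell_degenerate {c : Cells Y.toFunctor} (h : c.IsDegenerate) : ccell k c = 0 :=
  Ideal.Quotient.eq_zero_iff_mem.2 (Submodule.subset_span ⟨c, h, rfl⟩)

lemma ccell_mul (c c' : Cells Y.toFunctor) : ccell k (c * c') = ccell k c * ccell k c' := by
  simp [ccell, ← map_mul, MonoidAlgebra.single_mul_single]

lemma ccell_one : ccell k (1 : Cells Y.toFunctor) = 1 := map_one _

/-- The linear map out of the chains with given values on cells. -/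
def cchainsLift {N : Type*} [AddCommGroup N] [Module k N] (f : Cells Y.toFunctor → N)
    (hf : ∀ c, c.IsDegenerate → f c = 0) : CChains k Y →ₗ[k] N :=
  descend (toCChains k Y).toLinearMap (toCChains_surjective k Y)
    ((MonoidAlgebra.basis (Cells Y.toFunctor) k).constr k f) (by
      rw [ker_toCChains, degenerateSpan, Submodule.span_le]
      rintro _ ⟨c, hc, rfl⟩
      have := (MonoidAlgebra.basis (Cells Y.toFunctor) k).constr_basis k f c
      rw [MonoidAlgebra.basis_apply] at this
      simpa [this] using hf c hc)

lemma cchainsLift_ccell {N : Type*} [AddCommGroup N] [Module k N] (f : Cells Y.toFunctor → N)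
    (hf : ∀ c, c.IsDegenerate → f c = 0) (c : Cells Y.toFunctor) :
    cchainsLift f hf (ccell k c) = f c := by
  have := (MonoidAlgebra.basis (Cells Y.toFunctor) k).constr_basis k f c
  rw [MonoidAlgebra.basis_apply] at this
  rw [← this]
  exact descend_apply _ _ _ _ _

lemma cchains_ext {N : Type*} [AddCommMonoid N] [Module k N] {f g : CChains k Y →ₗ[k] N}
    (h : ∀ c, f (ccell k c) = g (ccell k c)) : f = g := by
  have : f ∘ₗ (toCChains k Y).toLinearMap = g ∘ₗ (toCChains k Y).toLinearMap :=
    (MonoidAlgebra.basis (Cells Y.toFunctor) k).ext fun c => by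
      rw [MonoidAlgebra.basis_apply]
      exact h c
  refine LinearMap.ext fun x => ?_
  obtain ⟨x, rfl⟩ := toCChains_surjective k Y x
  exact LinearMap.congr_fun this x

variable (k Y)

/-- Chains of degree `n`. -/
def cchainsGrading (n : ℤ) : Submodule k (CChains k Y) :=
  Submodule.span k (ccell k '' {c : Cells Y.toFunctor | (c.dim : ℤ) = n})

lemma isInternal_cchainsGrading : DirectSum.IsInternal (cchainsGrading k Y) := by
  have h := isInternal_basis (MonoidAlgebra.basis (Cells Y.toFunctor) k) fun c => (c.dim : ℤ)
  have h' := isInternal_quotient h _ (toCChains_surjective k Y) _ (ker_toCChains k Y) (by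
    rintro _ ⟨c, -, rfl⟩
    exact ⟨c.dim, Submodule.subset_span ⟨c, rfl, MonoidAlgebra.basis_apply _ _⟩⟩)
  have e : (fun n : ℤ => (Submodule.span k ((MonoidAlgebra.basis (Cells Y.toFunctor) k) ''
      {c | (c.dim : ℤ) = n})).map (toCChains k Y).toLinearMap) = cchainsGrading k Y := by
    funext n
    rw [Submodule.map_span, ← Set.image_comp]
    refine congrArg (fun g => Submodule.span k (g '' _)) (funext fun c => ?_)
    rw [Function.comp_apply, MonoidAlgebra.basis_apply]
    rfl
  rwa [e] at h'

variable {k Y}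

lemma ccell_mem (c : Cells Y.toFunctor) : ccell k c ∈ cchainsGrading k Y c.dim :=
  Submodule.subset_span ⟨c, rfl, rfl⟩

lemma cchainsGrading_induction {n : ℤ} {N : Submodule k (CChains k Y)}
    (h : ∀ c : Cells Y.toFunctor, (c.dim : ℤ) = n → ccell k c ∈ N) : cchainsGrading k Y n ≤ N := by
  rw [cchainsGrading, Submodule.span_le]
  rintro _ ⟨c, hc, rfl⟩
  exact h c hc

/-- The boundary of a cell: `∂ = ∑ᵢ (-1)ⁱ (δᵢ¹ - δᵢ⁰)`, where `i` runs from `1` to the dimension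
(here the directions are numbered from `0` on). -/
def cboundary : Cells Y.toFunctor → CChains k Y
  | ⟨⟨0⟩, _⟩ => 0
  | ⟨⟨n + 1⟩, y⟩ => ∑ i : Fin (n + 1), ((-1 : ℤ) ^ (i.val + 1)) •
      (ccell k ⟨⟨n⟩, Y.map (face i true).op y⟩ - ccell k ⟨⟨n⟩, Y.map (face i false).op y⟩)

lemma cboundary_eq (c : Cells Y.toFunctor) : cboundary (k := k) c =
    ∑ i ∈ Finset.range c.dim, ((-1 : ℤ) ^ (i + 1)) •
      (ccell k (c.dface i true) - ccell k (c.dface i false)) := by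
  obtain ⟨⟨_ | n⟩, y⟩ := c
  · rfl
  · have hd : (⟨⟨n + 1⟩, y⟩ : Cells Y.toFunctor).dim = n + 1 := rfl
    rw [hd, Finset.sum_range]
    simp only [cboundary]
    refine Finset.sum_congr rfl fun i _ => ?_
    have (ε : Bool) : (⟨⟨n + 1⟩, y⟩ : Cells Y.toFunctor).dface i ε =
        ⟨⟨n⟩, Y.map (face i ε).op y⟩ := by
      refine Cells.pull_ext (⟨⟨n + 1⟩, y⟩ : Cells Y.toFunctor) (f := faceN _ i ε) (g := face i ε)
        rfl fun x z hxz l hl => ?_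
      rw [bit_face _ _ _ _ hl, bit_faceN ⟨n + 1⟩ i.2, if_pos hl, hxz, hxz]
    rw [this, this]

variable (k Y)

/-- The differential of the chains. -/
def cd : CChains k Y →ₗ[k] CChains k Y :=
  cchainsLift cboundary fun c hc => by
    rw [cboundary_eq]
    exact Cells.sum_degenerate_eq_zero (ccell k) (fun c => ccell_degenerate) c hc

variable {k Y}

lemma cd_ccell (c : Cells Y.toFunctor) : cd k Y (ccell k c) =
    ∑ i ∈ Finset.range c.dim, ((-1 : ℤ) ^ (i + 1)) •
      (ccell k (c.dface i true) - ccell k (c.dface i false)) := by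
  rw [cd, cchainsLift_ccell, cboundary_eq]

lemma cd_mem {n : ℤ} {x : CChains k Y} (hx : x ∈ cchainsGrading k Y n) :
    cd k Y x ∈ cchainsGrading k Y (n - 1) := by
  refine cchainsGrading_induction (N := (cchainsGrading k Y (n - 1)).comap (cd k Y)) ?_ hx
  rintro c rfl
  rw [Submodule.mem_comap, cd_ccell]
  refine Submodule.sum_mem _ fun i hi => zsmul_mem (sub_mem ?_ ?_) _ <;>
  · have hi := Finset.mem_range.1 hi
    refine Submodule.subset_span ⟨_, ?_, rfl⟩
    change ((c.cube.dim - 1 : ℕ) : ℤ) = (c.cube.dim : ℤ) - 1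
    change i < c.cube.dim at hi
    omega

lemma cd_cd (x : CChains k Y) : cd k Y (cd k Y x) = 0 := by
  suffices cd k Y ∘ₗ cd k Y = 0 from LinearMap.congr_fun this x
  refine cchains_ext fun c => ?_
  simp only [LinearMap.comp_apply, cd_ccell, map_sum, LinearMap.zero_apply, map_zsmul, map_sub]
  rcases hc : c.dim with _ | _ | n
  · simp
  · refine Finset.sum_eq_zero fun i hi => ?_
    have (ε : Bool) : (c.dface i ε).dim = 0 := by
      change c.cube.dim - 1 = 0
      change c.cube.dim = _ at hc
      omega
    simp [this]
  · let q (i j : ℕ) : CChains k Y :=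
      (ccell k ((c.dface i true).dface j true) - ccell k ((c.dface i true).dface j false)) -
      (ccell k ((c.dface i false).dface j true) - ccell k ((c.dface i false).dface j false))
    rw [← sum_alternating_eq_zero n q]
    · refine Finset.sum_congr rfl fun i _ => ?_
      have (ε : Bool) : (c.dface i ε).dim = n + 1 := by
        change c.cube.dim - 1 = n + 1
        change c.cube.dim = _ at hc
        omega
      rw [this, this, ← Finset.sum_sub_distrib, Finset.smul_sum]
      refine Finset.sum_congr rfl fun j _ => ?_
      rw [← smul_sub, smul_smul, ← pow_add, show i + 1 + (j + 1) = i + j + 2 by omega, pow_add]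
      simp [q]
    · intro i j hij hj
      simp only [q, Cells.dface_dface c hij (by omega)]
      abel

lemma cleibniz {n : ℤ} {x : CChains k Y} (y : CChains k Y) (hx : x ∈ cchainsGrading k Y n) :
    cd k Y (x * y) = cd k Y x * y + (n.negOnePow : ℤ) • (x * cd k Y y) := by
  have key (c c' : Cells Y.toFunctor) : cd k Y (ccell k c * ccell k c') =
      cd k Y (ccell k c) * ccell k c' +
        (((c.dim : ℤ).negOnePow : ℤˣ) : ℤ) • (ccell k c * cd k Y (ccell k c')) := by
    simp only [← ccell_mul, cd_ccell, Cells.dim_mul, Finset.sum_range_add, Finset.sum_mul,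
      Finset.mul_sum]
    congr 1
    · refine Finset.sum_congr rfl fun i hi => ?_
      have hi := Finset.mem_range.1 hi
      rw [Cells.dface_mul c c' hi, Cells.dface_mul c c' hi, smul_mul_assoc, sub_mul, ccell_mul,
        ccell_mul]
    · rw [Finset.smul_sum]
      refine Finset.sum_congr rfl fun i hi => ?_
      have hi := Finset.mem_range.1 hi
      rw [Cells.mul_dface c c' hi, Cells.mul_dface c c' hi, mul_smul_comm, mul_sub, ccell_mul,
        ccell_mul, smul_smul]
      congr 1
      simp [Int.negOnePow_def, pow_add]
  have h1 (c : Cells Y.toFunctor) (y : CChains k Y) : cd k Y (ccell k c * y) =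
      cd k Y (ccell k c) * y + (((c.dim : ℤ).negOnePow : ℤˣ) : ℤ) • (ccell k c * cd k Y y) := by
    have : cd k Y ∘ₗ LinearMap.mulLeft k (ccell k c) = LinearMap.mulLeft k (cd k Y (ccell k c)) +
      (((c.dim : ℤ).negOnePow : ℤˣ) : ℤ) • (LinearMap.mulLeft k (ccell k c) ∘ₗ cd k Y) :=
        cchains_ext fun c' => key c c'
    exact LinearMap.congr_fun this y
  have h2 : cchainsGrading k Y n ≤ LinearMap.ker (cd k Y ∘ₗ LinearMap.mulRight k y -
      LinearMap.mulRight k y ∘ₗ cd k Y -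
      (n.negOnePow : ℤ) • (LinearMap.mulRight k (cd k Y y))) := by
    refine cchainsGrading_induction fun c hc => ?_
    rw [LinearMap.mem_ker]
    simp only [LinearMap.sub_apply, LinearMap.comp_apply, LinearMap.mulRight_apply,
      LinearMap.smul_apply, h1, ← hc]
    abel
  have := h2 hx
  rw [LinearMap.mem_ker] at this
  simp only [LinearMap.sub_apply, LinearMap.comp_apply, LinearMap.mulRight_apply,
    LinearMap.smul_apply] at this
  rw [sub_sub, sub_eq_zero] at this
  exact this

/-- The map on chains induced by a map of monoids in cubical sets. -/
def Cells.map {Y Z : LaxMonoidalFunctor Cubeᵒᵖ (Type u)} (f : Y ⟶ Z) :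
    Cells Y.toFunctor →* Cells Z.toFunctor where
  toFun c := ⟨c.cube, f.hom.app _ c.val⟩
  map_one' := congrArg (Cells.mk (𝟙_ Cube)) (app_lone f.hom)
  map_mul' c c' := congrArg (Cells.mk (c.cube ⊗ c'.cube)) (app_lmul f.hom c.val c'.val)

lemma Cells.map_pull {Y Z : LaxMonoidalFunctor Cubeᵒᵖ (Type u)} (f : Y ⟶ Z)
    (c : Cells Y.toFunctor) {A : Cube} (g : A ⟶ c.cube) :
    Cells.map f (c.pull g) = (Cells.map f c).pull g :=
  congrArg (Cells.mk A) (types_congr (f.hom.naturality g.op) c.val)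

lemma Cells.IsDegenerate.map {Y Z : LaxMonoidalFunctor Cubeᵒᵖ (Type u)} (f : Y ⟶ Z)
    {c : Cells Y.toFunctor} (h : c.IsDegenerate) : (Cells.map f c).IsDegenerate := by
  obtain ⟨c, i, ⟨hi, rfl⟩ | ⟨hi, rfl⟩⟩ := (isDegenerate_iff c).1 h
  · exact (isDegenerate_iff _).2 ⟨Cells.map f c, i, Or.inl ⟨hi, map_pull f c _⟩⟩
  · exact (isDegenerate_iff _).2 ⟨Cells.map f c, i, Or.inr ⟨hi, map_pull f c _⟩⟩

variable (k) in
/-- The algebra map on chains induced by a map of monoids in cubical sets. -/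
def cchainsMap {Y Z : LaxMonoidalFunctor Cubeᵒᵖ (Type u)} (f : Y ⟶ Z) :
    CChains k Y →ₐ[k] CChains k Z :=
  Ideal.Quotient.liftₐ (degenerateIdeal k Y)
    ((toCChains k Z).comp (MonoidAlgebra.mapDomainAlgHom k k (Cells.map f))) (by
      intro x hx
      have : degenerateSpan k Y ≤ LinearMap.ker
          ((toCChains k Z).comp (MonoidAlgebra.mapDomainAlgHom k k (Cells.map f))).toLinearMap := by
        rw [degenerateSpan, Submodule.span_le]
        rintro _ ⟨c, hc, rfl⟩
        rw [SetLike.mem_coe, LinearMap.mem_ker]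
        refine .trans ?_ (ccell_degenerate (hc.map f))
        simp [ccell]
      exact this hx)

lemma cchainsMap_ccell {Y Z : LaxMonoidalFunctor Cubeᵒᵖ (Type u)} (f : Y ⟶ Z)
    (c : Cells Y.toFunctor) : cchainsMap k f (ccell k c) = ccell k (Cells.map f c) := by
  refine (Ideal.Quotient.liftₐ_apply _ _ _ _).trans ?_
  refine (Ideal.Quotient.lift_mk _ _ _).trans ?_
  simp [ccell]

/-- The functor of cubical chains, from monoids in cubical sets to differential graded algebras. -/
def cubicalChains (k : Type v) [CommRing k] :
    LaxMonoidalFunctor Cubeᵒᵖ (Type u) ⥤ DGAlg.{v, max u v} k where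
  obj Y :=
    { carrier := CChains k Y
      grading := cchainsGrading k Y
      isInternal := isInternal_cchainsGrading k Y
      one_mem := by
        rw [← ccell_one]
        exact ccell_mem 1
      mul_mem := by
        intro m n x y hx hy
        have h1 (c : Cells Y.toFunctor) (hc : (c.dim : ℤ) = m) :
            ccell k c * y ∈ cchainsGrading k Y (m + n) := by
          refine cchainsGrading_induction (N := (cchainsGrading k Y (m + n)).comap
            (LinearMap.mulLeft k (ccell k c))) (fun c' hc' => ?_) hy
          rw [Submodule.mem_comap, LinearMap.mulLeft_apply, ← ccell_mul]
          refine Submodule.subset_span ⟨_, ?_, rfl⟩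
          rw [← hc, ← hc']
          exact Nat.cast_add _ _
        exact cchainsGrading_induction (N := (cchainsGrading k Y (m + n)).comap
            (LinearMap.mulRight k y)) h1 hx
      d := cd k Y
      d_mem := cd_mem
      d_d := cd_cd
      leibniz := cleibniz }
  map {Y Z} f :=
    { toAlgHom := cchainsMap k f
      map_mem := by
        intro n x hx
        refine cchainsGrading_induction (N := (cchainsGrading k Z n).comap
          (cchainsMap k f).toLinearMap) (fun c hc => ?_) hx
        rw [Submodule.mem_comap, AlgHom.toLinearMap_apply, cchainsMap_ccell]
        exact Submodule.subset_span ⟨_, hc, rfl⟩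
      map_d := by
        have : (cchainsMap k f).toLinearMap ∘ₗ cd k Y = cd k Z ∘ₗ (cchainsMap k f).toLinearMap := by
          refine cchains_ext fun c => ?_
          simp only [LinearMap.comp_apply, AlgHom.toLinearMap_apply, cchainsMap_ccell, cd_ccell,
            map_sum, map_zsmul, map_sub, Cells.dface, Cells.map_pull]
          rfl
        exact LinearMap.congr_fun this }
  map_id Y := DGAlg.Hom.ext <| AlgHom.toLinearMap_injective <| cchains_ext fun c =>
    cchainsMap_ccell (𝟙 Y) c
  map_comp {X Y Z} f g := DGAlg.Hom.ext <| AlgHom.toLinearMap_injective <| cchains_ext fun c => by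
    refine (cchainsMap_ccell (k := k) (f ≫ g) c).trans ?_
    refine .trans ?_ (congrArg (cchainsMap k g) (cchainsMap_ccell (k := k) f c)).symm
    exact (cchainsMap_ccell (k := k) g (Cells.map f c)).symm

end Chains

end

section

/-! ### Necklaces -/

/-- A necklace `[n₁] ∨ ⋯ ∨ [n_k]`, with `nᵢ > 0` and `k ≥ 0`: its vertices are the numbers `0`, …,
`len = n₁ + ⋯ + n_k`, its joints (among which we count the two base points) are the partial sums
`0`, `n₁`, `n₁ + n₂`, …, `len`. -/
@[ext]
structure Necklace where
  len : ℕ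
  joints : Finset ℕ
  zero_mem : 0 ∈ joints
  len_mem : len ∈ joints
  le_len : ∀ {j}, j ∈ joints → j ≤ len

namespace Necklace

/-- Morphisms of necklaces. A map of double pointed simplicial sets
`Δ[n₁] ∨ ⋯ ∨ Δ[n_k] ⟶ Δ[n'₁] ∨ ⋯ ∨ Δ[n'_l]` amounts to a monotone map `{0, …, len} → {0, …, len'}`
that preserves the end points and maps each bead into some bead; under the first condition, the
second one means that every joint of the target is the image of a joint of the source.
The monotone map is recorded through its extension to `ℕ` by `len + v ↦ len' + v`. -/
@[ext]
structure Hom (S T : Necklace) where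
  toFun : ℕ → ℕ
  mono : Monotone toFun
  map_zero : toFun 0 = 0
  map_add : ∀ v, toFun (S.len + v) = T.len + v
  cover : ∀ j ∈ T.joints, ∃ i ∈ S.joints, toFun i = j

instance : Category Necklace where
  Hom := Hom
  id T := ⟨fun v => v, monotone_id, rfl, fun _ => rfl, fun j hj => ⟨j, hj, rfl⟩⟩
  comp f g := ⟨fun v => g.toFun (f.toFun v), g.mono.comp f.mono, by rw [f.map_zero, g.map_zero],
    fun v => by rw [f.map_add, g.map_add], fun j hj => by
      obtain ⟨i, hi, rfl⟩ := g.cover j hj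
      obtain ⟨l, hl, rfl⟩ := f.cover i hi
      exact ⟨l, hl, rfl⟩⟩

lemma hom_ext {S T : Necklace} {f g : S ⟶ T} (h : ∀ v, f.toFun v = g.toFun v) : f = g :=
  Hom.ext (funext h)

@[simp] lemma id_toFun (T : Necklace) (v : ℕ) : Hom.toFun (𝟙 T) v = v := rfl
@[simp] lemma comp_toFun {S T U : Necklace} (f : S ⟶ T) (g : T ⟶ U) (v : ℕ) :
    (f ≫ g).toFun v = g.toFun (f.toFun v) := rfl

lemma Hom.map_len {S T : Necklace} (f : S ⟶ T) : f.toFun S.len = T.len := f.map_add 0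

lemma Hom.map_of_le {S T : Necklace} (f : S ⟶ T) {v : ℕ} (h : S.len ≤ v) :
    f.toFun v = T.len + (v - S.len) := by
  obtain ⟨v, rfl⟩ := Nat.exists_eq_add_of_le h
  rw [f.map_add, Nat.add_sub_cancel_left]

lemma Hom.map_le {S T : Necklace} (f : S ⟶ T) {v : ℕ} (h : v ≤ S.len) : f.toFun v ≤ T.len :=
  (f.mono h).trans_eq f.map_len

/-- The concatenation of two necklaces. -/
def wedge (S T : Necklace) : Necklace where
  len := S.len + T.len
  joints := S.joints ∪ T.joints.image (S.len + ·)
  zero_mem := Finset.mem_union_left _ S.zero_mem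
  len_mem := Finset.mem_union_right _ (Finset.mem_image_of_mem _ T.len_mem)
  le_len := by
    intro j hj
    rcases Finset.mem_union.1 hj with h | h
    · exact (S.le_len h).trans (Nat.le_add_right _ _)
    · obtain ⟨i, hi, rfl⟩ := Finset.mem_image.1 h
      exact Nat.add_le_add_left (T.le_len hi) _

lemma mem_wedge_joints {S T : Necklace} {j : ℕ} : j ∈ (wedge S T).joints ↔
    j ∈ S.joints ∨ ∃ i ∈ T.joints, S.len + i = j := by
  simp [wedge]

/-- The concatenation of two morphisms: it is `f` on the vertices of `S`, and `g`, shifted, on the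
vertices of `S'`. -/
def wedgeMap {S T S' T' : Necklace} (f : S ⟶ T) (g : S' ⟶ T') : wedge S S' ⟶ wedge T T' where
  toFun v := f.toFun (min v S.len) + g.toFun (v - S.len)
  mono v w h := Nat.add_le_add (f.mono (by omega)) (g.mono (by omega))
  map_zero := by simp [f.map_zero, g.map_zero]
  map_add v := by
    change f.toFun (min (S.len + S'.len + v) S.len) + g.toFun (S.len + S'.len + v - S.len) =
      T.len + T'.len + v
    rw [min_eq_right (by omega), show S.len + S'.len + v - S.len = S'.len + v by omega, g.map_add,
      f.map_len, Nat.add_assoc]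
  cover j hj := by
    rcases mem_wedge_joints.1 hj with h | ⟨i, hi, rfl⟩
    · obtain ⟨i, hi, rfl⟩ := f.cover j h
      refine ⟨i, mem_wedge_joints.2 (Or.inl hi), ?_⟩
      have := S.le_len hi
      rw [min_eq_left this, Nat.sub_eq_zero_of_le this, g.map_zero, Nat.add_zero]
    · obtain ⟨l, hl, rfl⟩ := g.cover i hi
      refine ⟨S.len + l, mem_wedge_joints.2 (Or.inr ⟨l, hl, rfl⟩), ?_⟩
      rw [min_eq_right (by omega), Nat.add_sub_cancel_left, f.map_len]

/-- The isomorphism between two equal necklaces. -/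
def eqIso {S T : Necklace} (h : S = T) : S ≅ T where
  hom := ⟨fun v => v, monotone_id, rfl, fun _ => by rw [h], fun j hj => ⟨j, h ▸ hj, rfl⟩⟩
  inv := ⟨fun v => v, monotone_id, rfl, fun _ => by rw [h], fun j hj => ⟨j, h ▸ hj, rfl⟩⟩

lemma wedge_assoc (S T U : Necklace) : wedge (wedge S T) U = wedge S (wedge T U) := by
  ext j
  · exact Nat.add_assoc _ _ _
  · simp only [mem_wedge_joints]
    constructor
    · rintro ((h | ⟨i, hi, rfl⟩) | ⟨i, hi, rfl⟩)
      · exact Or.inl h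
      · exact Or.inr ⟨i, Or.inl hi, rfl⟩
      · exact Or.inr ⟨T.len + i, Or.inr ⟨i, hi, rfl⟩, (Nat.add_assoc _ _ _).symm⟩
    · rintro (h | ⟨_, h | ⟨i, hi, rfl⟩, rfl⟩)
      · exact Or.inl (Or.inl h)
      · exact Or.inl (Or.inr ⟨_, h, rfl⟩)
      · exact Or.inr ⟨i, hi, Nat.add_assoc _ _ _⟩

/-- The necklace `[0]`. -/
def point : Necklace where
  len := 0
  joints := {0}
  zero_mem := Finset.mem_singleton_self 0
  len_mem := Finset.mem_singleton_self 0
  le_len h := (Finset.mem_singleton.1 h).le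

lemma point_wedge (T : Necklace) : wedge point T = T := by
  ext j
  · exact Nat.zero_add _
  · simp only [mem_wedge_joints, point, Finset.mem_singleton, Nat.zero_add, exists_eq_right,
      or_iff_right_iff_imp]
    rintro rfl
    exact T.zero_mem

lemma wedge_point (T : Necklace) : wedge T point = T := by
  ext j
  · exact Nat.add_zero _
  · simp only [mem_wedge_joints, point, Finset.mem_singleton, exists_eq_left, Nat.add_zero,
      or_iff_left_iff_imp]
    rintro rfl
    exact T.len_mem

instance : MonoidalCategoryStruct Necklace where
  tensorObj := wedge
  tensorHom := wedgeMap
  whiskerLeft T _ _ f := wedgeMap (𝟙 T) f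
  whiskerRight f T := wedgeMap f (𝟙 T)
  tensorUnit := point
  associator S T U := eqIso (wedge_assoc S T U)
  leftUnitor T := eqIso (point_wedge T)
  rightUnitor T := eqIso (wedge_point T)

lemma tensorObj_len (S T : Necklace) : (S ⊗ T).len = S.len + T.len := rfl
lemma tensorUnit_len : (𝟙_ Necklace).len = 0 := rfl

lemma tensorHom_toFun {S T S' T' : Necklace} (f : S ⟶ T) (g : S' ⟶ T') (v : ℕ) :
    (f ⊗ₘ g).toFun v = f.toFun (min v S.len) + g.toFun (v - S.len) := rfl

lemma whiskerLeft_toFun (T : Necklace) {S S' : Necklace} (f : S ⟶ S') (v : ℕ) :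
    (T ◁ f).toFun v = min v T.len + f.toFun (v - T.len) := rfl

lemma whiskerRight_toFun (T : Necklace) {S S' : Necklace} (f : S ⟶ S') (v : ℕ) :
    (f ▷ T).toFun v = f.toFun (min v S.len) + (v - S.len) := rfl

lemma associator_toFun (S T U : Necklace) (v : ℕ) : (α_ S T U).hom.toFun v = v := rfl
lemma leftUnitor_toFun (T : Necklace) (v : ℕ) : (λ_ T).hom.toFun v = v := rfl
lemma rightUnitor_toFun (T : Necklace) (v : ℕ) : (ρ_ T).hom.toFun v = v := rfl

instance : MonoidalCategory Necklace where
  tensorHom_def {S T S' T'} f g := hom_ext fun v => by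
    simp only [comp_toFun, tensorHom_toFun, whiskerLeft_toFun, whiskerRight_toFun]
    rcases Nat.le_total v S.len with h | h
    · have := f.map_le h
      rw [min_eq_left h, Nat.sub_eq_zero_of_le h, Nat.add_zero, min_eq_left this,
        Nat.sub_eq_zero_of_le this]
    · rw [min_eq_right h, f.map_len, min_eq_right (by omega), Nat.add_sub_cancel_left]
  id_tensorHom_id S T := hom_ext fun v => by
    simp only [tensorHom_toFun, id_toFun]
    omega
  tensorHom_comp_tensorHom {S₁ T₁ U₁ S₂ T₂ U₂} f₁ f₂ g₁ g₂ := hom_ext fun v => by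
    simp only [comp_toFun, tensorHom_toFun]
    rcases Nat.le_total v S₁.len with h | h
    · have := f₁.map_le h
      rw [min_eq_left h, Nat.sub_eq_zero_of_le h, f₂.map_zero, Nat.add_zero, min_eq_left this,
        Nat.sub_eq_zero_of_le this]
    · rw [min_eq_right h, f₁.map_len, min_eq_right (by omega), Nat.add_sub_cancel_left]
  whiskerLeft_id S T := hom_ext fun v => by
    simp only [whiskerLeft_toFun, id_toFun]
    omega
  id_whiskerRight S T := hom_ext fun v => by
    simp only [whiskerRight_toFun, id_toFun]
    omega
  associator_naturality {S₁ S₂ S₃ T₁ T₂ T₃} f g h := hom_ext fun v => by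
    simp only [comp_toFun, tensorHom_toFun, associator_toFun, tensorObj_len]
    rw [Nat.add_assoc, show min (min v (S₁.len + S₂.len)) S₁.len = min v S₁.len by omega,
      show min v (S₁.len + S₂.len) - S₁.len = min (v - S₁.len) S₂.len by omega, Nat.sub_sub]
  leftUnitor_naturality f := hom_ext fun v => by
    simp [comp_toFun, whiskerLeft_toFun, leftUnitor_toFun, tensorUnit_len]
  rightUnitor_naturality {S T} f := hom_ext fun v => by
    simp only [comp_toFun, whiskerRight_toFun, rightUnitor_toFun]
    rcases Nat.le_total v S.len with h | h
    · rw [min_eq_left h, Nat.sub_eq_zero_of_le h, Nat.add_zero]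
    · rw [min_eq_right h, f.map_len, f.map_of_le h]
  pentagon S T U V := hom_ext fun v => by
    simp only [comp_toFun, whiskerRight_toFun, whiskerLeft_toFun, associator_toFun]
    omega
  triangle S T := hom_ext fun v => by
    simp only [comp_toFun, whiskerRight_toFun, whiskerLeft_toFun, associator_toFun,
      leftUnitor_toFun, rightUnitor_toFun]
    omega

/-- The vertices that are not joints. -/
def inner (T : Necklace) : Finset ℕ := Finset.range (T.len + 1) \ T.joints

lemma mem_inner {T : Necklace} {v : ℕ} : v ∈ T.inner ↔ v ≤ T.len ∧ v ∉ T.joints := by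
  simp [inner]

/-- The dimension `n₁ + ⋯ + n_k - k` of a necklace. -/
def dim (T : Necklace) : ℕ := T.inner.card

/-- The inner vertices in increasing order. -/
def vertex (T : Necklace) : Fin T.dim ↪o ℕ := T.inner.orderEmbOfFin rfl

lemma vertex_mem (T : Necklace) (a : Fin T.dim) : T.vertex a ∈ T.inner :=
  Finset.orderEmbOfFin_mem _ _ _

lemma exists_vertex {T : Necklace} {v : ℕ} (h : v ∈ T.inner) : ∃ a, T.vertex a = v := by
  have := Finset.range_orderEmbOfFin T.inner rfl
  have h' : v ∈ Set.range (T.inner.orderEmbOfFin rfl) := by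
    rw [this]
    exact h
  exact h'

/-- The set of vertices of a necklace that corresponds to a vertex of its cube: all joints, together
with those inner vertices whose coordinate is `1`. -/
def verts (T : Necklace) (x : Fin T.dim → Bool) : Set ℕ :=
  {v | v ∈ T.joints ∨ ∃ a, x a = true ∧ T.vertex a = v}

lemma vertex_mem_verts {T : Necklace} {x : Fin T.dim → Bool} {a : Fin T.dim} :
    T.vertex a ∈ T.verts x ↔ x a = true := by
  constructor
  · rintro (h | ⟨b, hb, h⟩)
    · exact ((mem_inner.1 (T.vertex_mem a)).2 h).elim
    · rwa [← T.vertex.injective h]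
  · exact fun h => Or.inr ⟨a, h, rfl⟩

lemma verts_injective {T : Necklace} {x y : Fin T.dim → Bool} (h : T.verts x = T.verts y) :
    x = y := by
  funext a
  rw [Bool.eq_iff_iff, ← vertex_mem_verts, ← vertex_mem_verts, h]

lemma verts_le {T : Necklace} {x : Fin T.dim → Bool} {v : ℕ} (h : v ∈ T.verts x) : v ≤ T.len := by
  rcases h with h | ⟨a, -, rfl⟩
  exacts [T.le_len h, (mem_inner.1 (T.vertex_mem a)).1]

open Classical in
/-- The map of cubes induced by a morphism of necklaces: an inner vertex of the target gets the
coordinate `1` if it is the image of a joint or of an inner vertex with coordinate `1`. -/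
def cubeMap {S T : Necklace} (f : S ⟶ T) (x : Fin S.dim → Bool) : Fin T.dim → Bool :=
  fun b => decide (T.vertex b ∈ f.toFun '' S.verts x)

lemma isCubical_cubeMap {S T : Necklace} (f : S ⟶ T) : IsCubical (cubeMap f) := by
  refine CubeNF.isCubical (R := fun a b => f.toFun (S.vertex a) = T.vertex b)
    (c := fun b => ∃ j ∈ S.joints, f.toFun j = T.vertex b) _ rfl ⟨?_, fun x b => ?_⟩
  · intro a a' b b' h1 h2 h
    rw [← T.vertex.le_iff_le, ← h1, ← h2]
    exact f.mono (S.vertex.monotone h)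
  · simp only [cubeMap, decide_eq_true_eq]
    constructor
    · rintro ⟨v, hv | ⟨a, ha, rfl⟩, h⟩
      exacts [Or.inl ⟨v, hv, h⟩, Or.inr ⟨a, h, ha⟩]
    · rintro (⟨v, hv, h⟩ | ⟨a, h, ha⟩)
      exacts [⟨v, Or.inl hv, h⟩, ⟨_, Or.inr ⟨a, ha, rfl⟩, h⟩]

lemma verts_cubeMap {S T : Necklace} (f : S ⟶ T) (x : Fin S.dim → Bool) :
    T.verts (cubeMap f x) = f.toFun '' S.verts x := by
  ext v
  constructor
  · rintro (h | ⟨b, hb, rfl⟩)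
    · obtain ⟨i, hi, rfl⟩ := f.cover v h
      exact ⟨i, Or.inl hi, rfl⟩
    · simpa [cubeMap] using hb
  · rintro ⟨i, hi, rfl⟩
    by_cases h : f.toFun i ∈ T.joints
    · exact Or.inl h
    · obtain ⟨b, hb⟩ := exists_vertex (mem_inner.2 ⟨f.map_le (verts_le hi), h⟩)
      rw [← hb, vertex_mem_verts]
      simp only [cubeMap, decide_eq_true_eq, hb]
      exact ⟨i, hi, rfl⟩

end Necklace

open Necklace

/-- The functor from necklaces to cubes. -/
def necklaceCube : Necklace ⥤ Cube where
  obj T := ⟨T.dim⟩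
  map f := ⟨cubeMap f, isCubical_cubeMap f⟩
  map_id T := Subtype.ext <| funext fun x => verts_injective <| by
    rw [verts_cubeMap]
    exact Set.image_id _
  map_comp {S T U} f g := Subtype.ext <| funext fun x => verts_injective <| by
    change _ = U.verts (cubeMap g (cubeMap f x))
    rw [verts_cubeMap, verts_cubeMap, verts_cubeMap, ← Set.image_comp]
    rfl

end

section

namespace Necklace

lemma mem_wedge_inner {S T : Necklace} {v : ℕ} : v ∈ (wedge S T).inner ↔
    v ∈ S.inner ∨ ∃ i ∈ T.inner, S.len + i = v := by
  simp only [mem_inner, mem_wedge_joints]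
  change v ≤ S.len + T.len ∧ _ ↔ _
  constructor
  · rintro ⟨h1, h2⟩
    push Not at h2
    rcases Nat.lt_or_ge S.len v with h | h
    · refine Or.inr ⟨v - S.len, ⟨by omega, fun h3 => h2.2 _ h3 (by omega)⟩, by omega⟩
    · exact Or.inl ⟨h, h2.1⟩
  · rintro (⟨h1, h2⟩ | ⟨i, ⟨h1, h2⟩, rfl⟩)
    · refine ⟨by omega, ?_⟩
      rintro (h | ⟨i, -, rfl⟩)
      · exact h2 h
      · obtain rfl : i = 0 := by omega
        exact h2 S.len_mem
    · refine ⟨by omega, ?_⟩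
      rintro (h | ⟨j, hj, h⟩)
      · have := S.le_len h
        obtain rfl : i = 0 := by omega
        exact h2 T.zero_mem
      · obtain rfl : j = i := by omega
        exact h2 hj

lemma lt_of_mem_inner {S : Necklace} {v : ℕ} (h : v ∈ S.inner) : 0 < v ∧ v < S.len := by
  obtain ⟨h1, h2⟩ := mem_inner.1 h
  refine ⟨Nat.pos_of_ne_zero ?_, lt_of_le_of_ne h1 ?_⟩
  · rintro rfl
    exact h2 S.zero_mem
  · rintro rfl
    exact h2 S.len_mem

lemma dim_point : point.dim = 0 := by
  refine Finset.card_eq_zero.2 (Finset.eq_empty_of_forall_notMem fun v hv => ?_)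
  have := lt_of_mem_inner hv
  change 0 < v ∧ v < 0 at this
  omega

lemma dim_wedge (S T : Necklace) : (wedge S T).dim = S.dim + T.dim := by
  have : (wedge S T).inner = S.inner.disjUnion (T.inner.map (addLeftEmbedding S.len)) (by
      rw [Finset.disjoint_left]
      intro v hv hv'
      obtain ⟨i, hi, rfl⟩ := Finset.mem_map.1 hv'
      have := (lt_of_mem_inner hv).2
      simp only [addLeftEmbedding_apply] at this
      omega) := by
    ext v
    simp [mem_wedge_inner]
  rw [dim, this, Finset.card_disjUnion, Finset.card_map]
  rfl

lemma vertex_wedge (S T : Necklace) (a : Fin (wedge S T).dim) (b : Fin (S.dim + T.dim))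
    (h : a.val = b.val) : (wedge S T).vertex a =
      Fin.addCases (motive := fun _ => ℕ) S.vertex (fun i => S.len + T.vertex i) b := by
  have := Finset.orderEmbOfFin_unique (s := (wedge S T).inner) (dim_wedge S T)
    (f := Fin.addCases (motive := fun _ => ℕ) S.vertex (fun i => S.len + T.vertex i)) ?_ ?_
  · rw [this]
    exact (Finset.orderEmbOfFin_eq_orderEmbOfFin_iff).2 h
  · intro i
    rw [mem_wedge_inner]
    cases i using Fin.addCases with
    | left i => exact Or.inl (by simpa using S.vertex_mem i)
    | right i => exact Or.inr ⟨_, T.vertex_mem i, by simp⟩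
  · intro i j hij
    cases i using Fin.addCases with
    | left i =>
      cases j using Fin.addCases with
      | left j =>
        simp only [Fin.addCases_left]
        simp only [Fin.lt_def, Fin.val_castAdd] at hij
        exact S.vertex.strictMono hij
      | right j =>
        simp only [Fin.addCases_left, Fin.addCases_right]
        have := (lt_of_mem_inner (S.vertex_mem i)).2
        omega
    | right i =>
      cases j using Fin.addCases with
      | left j =>
        simp only [Fin.lt_def, Fin.val_natAdd, Fin.val_castAdd] at hij
        omega
      | right j =>
        simp only [Fin.addCases_right]
        simp only [Fin.lt_def, Fin.val_natAdd, Nat.add_lt_add_iff_left] at hij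
        exact Nat.add_lt_add_left (T.vertex.strictMono hij) _

end Necklace

open Necklace

lemma necklaceCube_obj_unit_dim : (𝟙_ Cube).dim = (necklaceCube.obj (𝟙_ Necklace)).dim :=
  dim_point.symm

lemma necklaceCube_obj_tensor_dim (S T : Necklace) :
    (necklaceCube.obj S ⊗ necklaceCube.obj T).dim = (necklaceCube.obj (S ⊗ T)).dim :=
  (dim_wedge S T).symm

lemma verts_castHom (S T : Necklace) (x : Fin S.dim → Bool) (y : Fin T.dim → Bool) :
    (S ⊗ T).verts ((Cube.castHom (necklaceCube_obj_tensor_dim S T)).1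
      (Cube.tens (A := necklaceCube.obj S) (B := necklaceCube.obj T) x y)) =
        S.verts x ∪ (S.len + ·) '' T.verts y := by
  have hv (b : Fin (S.dim + T.dim)) := vertex_wedge S T (Fin.cast (dim_wedge S T).symm b) b rfl
  have ha (b : Fin (S.dim + T.dim)) :
    (Cube.castHom (necklaceCube_obj_tensor_dim S T)).1
      (Cube.tens (A := necklaceCube.obj S) (B := necklaceCube.obj T) x y)
        (Fin.cast (dim_wedge S T).symm b) = Fin.append x y b := rfl
  ext v
  constructor
  · rintro (h | ⟨a, ha', rfl⟩)
    · rcases mem_wedge_joints.1 h with h | ⟨i, hi, rfl⟩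
      · exact Or.inl (Or.inl h)
      · exact Or.inr ⟨i, Or.inl hi, rfl⟩
    · obtain ⟨b, rfl⟩ : ∃ b, Fin.cast (dim_wedge S T).symm b = a :=
        ⟨Fin.cast (dim_wedge S T) a, rfl⟩
      have := (ha b).symm.trans ha'
      change (wedge S T).vertex _ ∈ _
      rw [hv]
      cases b using Fin.addCases with
      | left b => exact Or.inl (Or.inr ⟨b, by simpa using this, by simp⟩)
      | right b => exact Or.inr ⟨_, Or.inr ⟨b, by simpa using this, rfl⟩, by simp⟩
  · rintro ((h | ⟨a, ha', rfl⟩) | ⟨_, h | ⟨a, ha', rfl⟩, rfl⟩)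
    · exact Or.inl (mem_wedge_joints.2 (Or.inl h))
    · refine Or.inr ⟨_, (ha (Fin.castAdd _ a)).trans (by simpa using ha'), ?_⟩
      exact (hv _).trans (by simp)
    · exact Or.inl (mem_wedge_joints.2 (Or.inr ⟨_, h, rfl⟩))
    · refine Or.inr ⟨_, (ha (Fin.natAdd _ a)).trans (by simpa using ha'), ?_⟩
      exact (hv _).trans (by simp)

lemma necklaceCube_map_tensorHom {S T S' T' : Necklace} (f : S ⟶ T) (g : S' ⟶ T') :
    (necklaceCube.map f ⊗ₘ necklaceCube.map g) ≫ Cube.castHom (necklaceCube_obj_tensor_dim T T') =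
      Cube.castHom (necklaceCube_obj_tensor_dim S S') ≫ necklaceCube.map (f ⊗ₘ g) := by
  refine Cube.tensor_ext fun x y => verts_injective (T := T ⊗ T') ?_
  refine (congrArg (fun z => (T ⊗ T').verts
    ((Cube.castHom (necklaceCube_obj_tensor_dim T T')).1 z)) (Cube.tensorHom_tens _ _ x y)).trans ?_
  refine (verts_castHom T T' _ _).trans ?_
  refine .trans ?_ ((verts_cubeMap (f ⊗ₘ g) _).trans
    (congrArg _ (verts_castHom S S' x y))).symm
  refine (congrArg₂ (· ∪ (T.len + ·) '' ·) (verts_cubeMap f x) (verts_cubeMap g y)).trans ?_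
  rw [Set.image_union]
  congr 1
  · refine Set.image_congr fun v hv => ?_
    have := verts_le hv
    rw [tensorHom_toFun, min_eq_left this, Nat.sub_eq_zero_of_le this, g.map_zero, Nat.add_zero]
  · rw [← Set.image_comp, ← Set.image_comp]
    refine Set.image_congr fun v hv => ?_
    simp only [Function.comp_apply, tensorHom_toFun]
    rw [min_eq_right (by omega), f.map_len, Nat.add_sub_cancel_left]

lemma necklaceCube_map_of_eq {S T : Necklace} (h : S = T) (f : S ⟶ T)
    (hf : ∀ v, f.toFun v = v) (h' : (necklaceCube.obj S).dim = (necklaceCube.obj T).dim) :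
    necklaceCube.map f = Cube.castHom h' := by
  subst h
  obtain rfl : f = 𝟙 S := hom_ext hf
  rw [necklaceCube.map_id]
  rfl

lemma Cube.castHom_comp {A B C : Cube} (h : A.dim = B.dim) (h' : B.dim = C.dim) :
    castHom h ≫ castHom h' = castHom (h.trans h') := rfl

lemma Cube.castHom_whiskerRight {A B C : Cube} (h : A.dim = B.dim) :
    castHom h ▷ C = castHom (A := A ⊗ C) (B := B ⊗ C) (by rw [tensorObj_dim, tensorObj_dim, h]) := by
  obtain ⟨m⟩ := A
  obtain ⟨n⟩ := B
  obtain rfl : m = n := h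
  exact MonoidalCategory.id_whiskerRight _ _

lemma Cube.castHom_whiskerLeft {A B C : Cube} (h : A.dim = B.dim) :
    C ◁ castHom h = castHom (A := C ⊗ A) (B := C ⊗ B) (by rw [tensorObj_dim, tensorObj_dim, h]) := by
  obtain ⟨m⟩ := A
  obtain ⟨n⟩ := B
  obtain rfl : m = n := h
  exact MonoidalCategory.whiskerLeft_id _ _

/-- The functor from necklaces to cubes is monoidal. -/
def necklaceCubeCoreMonoidal : necklaceCube.CoreMonoidal where
  εIso := Cube.castIso necklaceCube_obj_unit_dim
  μIso S T := Cube.castIso (necklaceCube_obj_tensor_dim S T)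
  μIso_hom_natural_left {S T} f U := by
    have := necklaceCube_map_tensorHom f (𝟙 U)
    rw [necklaceCube.map_id, tensorHom_id, tensorHom_id] at this
    exact this
  μIso_hom_natural_right U f := by
    have := necklaceCube_map_tensorHom (𝟙 U) f
    rw [necklaceCube.map_id, id_tensorHom, id_tensorHom] at this
    exact this
  associativity S T U := by
    rw [necklaceCube_map_of_eq (wedge_assoc S T U) (α_ S T U).hom (fun _ => rfl)
      (congrArg dim (wedge_assoc S T U))]
    simp only [Cube.castIso, Cube.castHom_whiskerLeft, Cube.castHom_whiskerRight]
    rfl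
  left_unitality T := by
    rw [necklaceCube_map_of_eq (point_wedge T) (λ_ T).hom (fun _ => rfl)
      (congrArg dim (point_wedge T))]
    have h := Cube.castHom_whiskerRight (C := necklaceCube.obj T) necklaceCube_obj_unit_dim
    refine .trans ?_ (eq_whisker h _).symm
    rfl
  right_unitality T := by
    rw [necklaceCube_map_of_eq (wedge_point T) (ρ_ T).hom (fun _ => rfl)
      (congrArg dim (wedge_point T))]
    have h := Cube.castHom_whiskerLeft (C := necklaceCube.obj T) necklaceCube_obj_unit_dim
    refine .trans ?_ (eq_whisker h _).symm
    rfl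

instance : necklaceCube.Monoidal := necklaceCubeCoreMonoidal.toMonoidal

end

section

/-! ### Left Kan extension of presheaves -/

section LeftKan

variable {C D : Type} [SmallCategory C] [SmallCategory D] (F : C ⥤ D)

/-- The relation `(g^* y, f) ∼ (y, F(g) ∘ f)` on pairs of an element of `K(T)` and a morphism
`A ⟶ F(T)`. -/
inductive LanRel (K : Cᵒᵖ ⥤ Type u) (A : D) :
    (Σ T : C, K.obj (op T) × (A ⟶ F.obj T)) → (Σ T : C, K.obj (op T) × (A ⟶ F.obj T)) → Prop
  | mk {S T : C} (g : S ⟶ T) (y : K.obj (op T)) (f : A ⟶ F.obj S) :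
      LanRel K A ⟨S, K.map g.op y, f⟩ ⟨T, y, f ≫ F.map g⟩

/-- The value at `A` of the left Kan extension of a presheaf `K` along `F`, i.e. of the colimit of
the representable presheaves of the objects `F(T)` over all elements `y ∈ K(T)`. -/
def LanObj (K : Cᵒᵖ ⥤ Type u) (A : D) : Type u := Quot (LanRel F K A)

variable {F}

/-- The class of a pair. -/
def LanObj.mk {K : Cᵒᵖ ⥤ Type u} {A : D} {T : C} (y : K.obj (op T)) (f : A ⟶ F.obj T) :
    LanObj F K A :=
  Quot.mk _ ⟨T, y, f⟩

lemma LanObj.sound {K : Cᵒᵖ ⥤ Type u} {A : D} {S T : C} (g : S ⟶ T) (y : K.obj (op T))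
    (f : A ⟶ F.obj S) : LanObj.mk (F := F) (K.map g.op y) f = LanObj.mk y (f ≫ F.map g) :=
  Quot.sound (.mk g y f)

lemma LanObj.ind {K : Cᵒᵖ ⥤ Type u} {A : D} {P : LanObj F K A → Prop}
    (h : ∀ (T : C) (y : K.obj (op T)) (f : A ⟶ F.obj T), P (LanObj.mk y f)) (x : LanObj F K A) :
    P x :=
  Quot.ind (fun p => h p.1 p.2.1 p.2.2) x

/-- Functions out of the left Kan extension. -/
def LanObj.lift {K : Cᵒᵖ ⥤ Type u} {A : D} {Z : Type w}
    (h : ∀ (T : C), K.obj (op T) → (A ⟶ F.obj T) → Z)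
    (H : ∀ {S T : C} (g : S ⟶ T) (y : K.obj (op T)) (f : A ⟶ F.obj S),
      h S (K.map g.op y) f = h T y (f ≫ F.map g)) : LanObj F K A → Z :=
  Quot.lift (fun p => h p.1 p.2.1 p.2.2) (by rintro _ _ ⟨g, y, f⟩; exact H g y f)

variable (F)

/-- The left Kan extension of a presheaf. -/
def lan (K : Cᵒᵖ ⥤ Type u) : Dᵒᵖ ⥤ Type u where
  obj A := LanObj F K A.unop
  map g := ↾LanObj.lift (fun _ y f => LanObj.mk y (g.unop ≫ f)) (by
    intro S T h y f
    rw [LanObj.sound, Category.assoc])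
  map_id A := by
    ext x
    induction x using LanObj.ind with | h T y f => ?_
    exact congrArg (LanObj.mk y) (Category.id_comp f)
  map_comp g h := by
    ext x
    induction x using LanObj.ind with | h T y f => ?_
    exact congrArg (LanObj.mk y) (Category.assoc _ _ _)

lemma lan_map_mk (K : Cᵒᵖ ⥤ Type u) {A B : Dᵒᵖ} (g : A ⟶ B) {T : C} (y : K.obj (op T))
    (f : A.unop ⟶ F.obj T) :
    (lan F K).map g (LanObj.mk (F := F) y f) = LanObj.mk (F := F) (A := B.unop) y (g.unop ≫ f) := rfl

variable [MonoidalCategory C] [MonoidalCategory D] [F.LaxMonoidal]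

open Functor.LaxMonoidal

lemma LanObj.sound_lmul (K : Cᵒᵖ ⥤ Type u) [K.LaxMonoidal] {A B : D} {S S' T T' : C}
    (a : S ⟶ S') (b : T ⟶ T') (x : K.obj (op S')) (y : K.obj (op T')) (f : A ⟶ F.obj S)
    (g : B ⟶ F.obj T) :
    LanObj.mk (F := F) (T := S ⊗ T) (lmul K (K.map a.op x) (K.map b.op y))
        ((f ⊗ₘ g) ≫ μ F S T) =
      LanObj.mk (T := S' ⊗ T') (lmul K x y) (((f ≫ F.map a) ⊗ₘ (g ≫ F.map b)) ≫ μ F S' T') := by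
  rw [← map_lmul]
  refine (LanObj.sound (a ⊗ₘ b) (lmul K x y) _).trans (congrArg _ ?_)
  rw [Category.assoc, ← μ_natural, ← Category.assoc, tensorHom_comp_tensorHom]

/-- The product on the left Kan extension. -/
def LanObj.mul (K : Cᵒᵖ ⥤ Type u) [K.LaxMonoidal] {A B : D} :
    LanObj F K A → LanObj F K B → LanObj F K (A ⊗ B) :=
  LanObj.lift (fun S x f => LanObj.lift (fun T y g =>
      LanObj.mk (T := S ⊗ T) (lmul K x y) ((f ⊗ₘ g) ≫ μ F S T)) (by
    intro T T' b y g
    have := LanObj.sound_lmul F K (𝟙 S) b x y f g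
    simpa using this)) (by
    intro S S' a x f
    funext y
    induction y using LanObj.ind with | h T y g => ?_
    have := LanObj.sound_lmul F K a (𝟙 T) x y f g
    rw [op_id, K.map_id, F.map_id, Category.comp_id] at this
    exact this)

lemma LanObj.mul_mk (K : Cᵒᵖ ⥤ Type u) [K.LaxMonoidal] {A B : D} {S T : C} (x : K.obj (op S))
    (y : K.obj (op T)) (f : A ⟶ F.obj S) (g : B ⟶ F.obj T) :
    LanObj.mul F K (LanObj.mk x f) (LanObj.mk y g) =
      LanObj.mk (T := S ⊗ T) (lmul K x y) ((f ⊗ₘ g) ≫ μ F S T) := rfl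

lemma lan_assoc_aux {A B E : D} {S T U : C} (f : A ⟶ F.obj S) (g : B ⟶ F.obj T)
    (h : E ⟶ F.obj U) :
    (α_ A B E).inv ≫ ((((f ⊗ₘ g) ≫ μ F S T) ⊗ₘ h) ≫ μ F (S ⊗ T) U) =
      ((f ⊗ₘ ((g ⊗ₘ h) ≫ μ F T U)) ≫ μ F S (T ⊗ U)) ≫ F.map (α_ S T U).inv := by
  have e1 : (f ⊗ₘ ((g ⊗ₘ h) ≫ μ F T U)) = (f ⊗ₘ (g ⊗ₘ h)) ≫ F.obj S ◁ μ F T U := by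
    rw [← id_tensorHom, tensorHom_comp_tensorHom, Category.comp_id]
  have e2 : (((f ⊗ₘ g) ≫ μ F S T) ⊗ₘ h) = ((f ⊗ₘ g) ⊗ₘ h) ≫ μ F S T ▷ F.obj U := by
    rw [← tensorHom_id, tensorHom_comp_tensorHom, Category.comp_id]
  rw [e1, e2, Category.assoc, Category.assoc, Category.assoc, associativity_inv,
    ← associator_inv_naturality_assoc]

lemma lan_left_aux {A : D} {S : C} (f : A ⟶ F.obj S) :
    (λ_ A).inv ≫ ((ε F ⊗ₘ f) ≫ μ F (𝟙_ C) S) = f ≫ F.map (λ_ S).inv := by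
  rw [← left_unitality_inv, tensorHom_def', Category.assoc, ← leftUnitor_inv_naturality_assoc]

lemma lan_right_aux {A : D} {S : C} (f : A ⟶ F.obj S) :
    (ρ_ A).inv ≫ ((f ⊗ₘ ε F) ≫ μ F S (𝟙_ C)) = f ≫ F.map (ρ_ S).inv := by
  rw [← right_unitality_inv, MonoidalCategory.tensorHom_def, Category.assoc,
    ← rightUnitor_inv_naturality_assoc]

instance (K : Cᵒᵖ ⥤ Type u) [K.LaxMonoidal] : (lan F K).LaxMonoidal :=
  laxMonoidalOfMul (lan F K) (LanObj.mul F K) (LanObj.mk (T := 𝟙_ C) (lone K) (ε F))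
    (by
      intro A B A' B' f g x y
      induction x using LanObj.ind with | h S x f' => ?_
      induction y using LanObj.ind with | h T y g' => ?_
      simp only [lan_map_mk, LanObj.mul_mk]
      refine (lan_map_mk F K (f ⊗ₘ g) _ _).trans ?_
      refine congrArg (LanObj.mk _) ?_
      change (f.unop ⊗ₘ g.unop) ≫ _ ≫ _ = _
      rw [← Category.assoc, tensorHom_comp_tensorHom])
    (by
      intro A B E x y z
      induction x using LanObj.ind with | h S x f => ?_
      induction y using LanObj.ind with | h T y g => ?_
      induction z using LanObj.ind with | h U z h => ?_
      rw [LanObj.mul_mk, LanObj.mul_mk, LanObj.mul_mk, LanObj.mul_mk, ← lmul_assoc]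
      refine (lan_map_mk F K (α_ A B E).hom _ _).trans ?_
      refine .trans ?_ (LanObj.sound (α_ S T U).inv _ _).symm
      refine congrArg (LanObj.mk _) ?_
      exact lan_assoc_aux F f g h)
    (by
      intro A x
      induction x using LanObj.ind with | h S x f => ?_
      rw [LanObj.mul_mk]
      refine (lan_map_mk F K (λ_ A).hom _ _).trans ?_
      refine .trans ?_ (congrArg (fun z => LanObj.mk z f) (lone_lmul K x))
      refine .trans ?_ (LanObj.sound (λ_ S).inv _ _).symm
      refine congrArg (LanObj.mk _) ?_
      exact lan_left_aux F f)
    (by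
      intro A x
      induction x using LanObj.ind with | h S x f => ?_
      rw [LanObj.mul_mk]
      refine (lan_map_mk F K (ρ_ A).hom _ _).trans ?_
      refine .trans ?_ (congrArg (fun z => LanObj.mk z f) (lmul_lone K x))
      refine .trans ?_ (LanObj.sound (ρ_ S).inv _ _).symm
      refine congrArg (LanObj.mk _) ?_
      exact lan_right_aux F f)

/-- The functor between categories of monoids in presheaves that is induced by left Kan extension
along a monoidal functor. -/
def lanMon : LaxMonoidalFunctor Cᵒᵖ (Type u) ⥤ LaxMonoidalFunctor Dᵒᵖ (Type u) where
  obj K := LaxMonoidalFunctor.of (lan F K.toFunctor)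
  map {K L} α :=
    { hom :=
        { app := fun A => ↾LanObj.lift (fun T y f => LanObj.mk (F := F) (α.hom.app (op T) y) f) (by
            intro S T g y f
            rw [← LanObj.sound]
            exact congrArg (fun z => LanObj.mk z f) (types_congr (α.hom.naturality g.op) y))
          naturality := fun A B g => by
            ext x
            induction x using LanObj.ind with | h T y f => ?_
            rfl }
      isMonoidal :=
        { unit := by
            ext x
            exact congrArg (fun z => LanObj.mk z (ε F)) (app_lone α.hom)
          tensor := fun A B => by
            ext p
            obtain ⟨x, y⟩ := p
            induction x using LanObj.ind with | h S x f => ?_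
            induction y using LanObj.ind with | h T y g => ?_
            exact congrArg (fun z => LanObj.mk (T := S ⊗ T) z ((f ⊗ₘ g) ≫ μ F S T))
              (app_lmul α.hom x y) } }
  map_id K := by
    ext A x
    induction x using LanObj.ind with | h T y f => ?_
    rfl
  map_comp α β := by
    ext A x
    induction x using LanObj.ind with | h T y f => ?_
    rfl

end LeftKan

end

section

/-! ### The cubical cobar construction -/

namespace Necklace

/-- The `n`-simplices of `Δ[n₁] ∨ ⋯ ∨ Δ[n_k]`: the monotone sequences of `n + 1` vertices that stay in
one bead, i.e. do not jump over a joint. -/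
def Simplex (T : Necklace) (n : ℕ) : Type :=
  {s : Fin (n + 1) →o ℕ // (∀ i, s i ≤ T.len) ∧ ∀ j ∈ T.joints, (∀ i, s i ≤ j) ∨ ∀ i, j ≤ s i}

lemma Simplex.ext {T : Necklace} {n : ℕ} {s t : T.Simplex n} (h : ∀ i, s.1 i = t.1 i) : s = t :=
  Subtype.ext (OrderHom.ext _ _ (funext h))

/-- Restriction of a simplex. -/
def Simplex.comp {T : Necklace} {m n : ℕ} (s : T.Simplex n) (φ : Fin (m + 1) →o Fin (n + 1)) :
    T.Simplex m :=
  ⟨s.1.comp φ, fun i => s.2.1 (φ i), fun j hj => (s.2.2 j hj).imp (fun h i => h (φ i))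
    fun h i => h (φ i)⟩

/-- The image of a simplex. -/
def Simplex.map {S T : Necklace} (f : S ⟶ T) {n : ℕ} (s : S.Simplex n) : T.Simplex n :=
  ⟨⟨fun i => f.toFun (s.1 i), f.mono.comp s.1.monotone⟩, fun i => f.map_le (s.2.1 i), fun j hj => by
    obtain ⟨i, hi, rfl⟩ := f.cover j hj
    exact (s.2.2 i hi).imp (fun h l => f.mono (h l)) fun h l => f.mono (h l)⟩

/-- The simplicial set `S(T) = Δ[n₁] ∨ ⋯ ∨ Δ[n_k]` of a necklace `T`. -/
def toSSet (T : Necklace) : SSet.{u} where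
  obj n := ULift.{u} (T.Simplex n.unop.len)
  map φ := ↾fun s => ⟨s.down.comp φ.unop.toOrderHom⟩

/-- The functoriality of `S`. -/
def toSSetMap {S T : Necklace} (f : S ⟶ T) : S.toSSet ⟶ T.toSSet where
  app n := ↾fun s : ULift.{u} (S.Simplex n.unop.len) => (⟨s.down.map f⟩ : ULift (T.Simplex _))

/-- The part of a simplex in the first of two necklaces. -/
def Simplex.left {S T : Necklace} {n : ℕ} (s : (S ⊗ T).Simplex n) : S.Simplex n :=
  ⟨⟨fun i => min (s.1 i) S.len, fun _ _ h => min_le_min_right _ (s.1.monotone h)⟩,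
    fun i => min_le_right _ _, fun j hj => by
      have := S.le_len hj
      rcases s.2.2 j (mem_wedge_joints.2 (Or.inl hj)) with h | h
      · exact Or.inl fun i => (min_le_left _ _).trans (h i)
      · exact Or.inr fun i => le_min (h i) this⟩

/-- The part of a simplex in the second of two necklaces. -/
def Simplex.right {S T : Necklace} {n : ℕ} (s : (S ⊗ T).Simplex n) : T.Simplex n :=
  ⟨⟨fun i => s.1 i - S.len, fun _ _ h => Nat.sub_le_sub_right (s.1.monotone h) _⟩,
    fun i => by
      have : s.1 i ≤ S.len + T.len := s.2.1 i
      change s.1 i - S.len ≤ T.len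
      omega, fun j hj => by
      rcases s.2.2 (S.len + j) (mem_wedge_joints.2 (Or.inr ⟨j, hj, rfl⟩)) with h | h
      · exact Or.inl fun i => by
          have := h i
          change s.1 i - S.len ≤ j
          omega
      · exact Or.inr fun i => by
          have := h i
          change j ≤ s.1 i - S.len
          omega⟩

end Necklace

open Necklace

section Glue

variable {X : ReducedSSet.{u}}

/-- Application of a map out of the simplicial set of a necklace. -/
def napp {T : Necklace} (σ : T.toSSet ⟶ X.obj) {n : SimplexCategory} (s : T.Simplex n.len) :
    X.obj.obj (op n) :=
  σ.app (op n) ⟨s⟩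

lemma napp_comp {T : Necklace} (σ : T.toSSet ⟶ X.obj) {m n : SimplexCategory}
    (s : T.Simplex n.len) (φ : m ⟶ n) :
    napp σ (s.comp φ.toOrderHom) = X.obj.map φ.op (napp σ s) :=
  types_congr (σ.naturality φ.op) ⟨s⟩

lemma nhom_ext {T : Necklace} {σ τ : T.toSSet ⟶ X.obj}
    (h : ∀ (n : SimplexCategory) (s : T.Simplex n.len), napp σ s = napp τ s) : σ = τ := by
  ext n s
  exact h n.unop s.down

/-- All constant simplices have the same image in a reduced simplicial set. -/
lemma napp_const {S T : Necklace} (σ : S.toSSet ⟶ X.obj) (τ : T.toSSet ⟶ X.obj)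
    {n : SimplexCategory} (s : S.Simplex n.len) (t : T.Simplex n.len) (hs : ∀ i, s.1 i = s.1 0)
    (ht : ∀ i, t.1 i = t.1 0) : napp σ s = napp τ t := by
  let z : SimplexCategory.mk 0 ⟶ n := SimplexCategory.const _ _ 0
  let p : n ⟶ SimplexCategory.mk 0 := SimplexCategory.const _ _ 0
  have h1 : s = (s.comp z.toOrderHom).comp p.toOrderHom := Simplex.ext fun i => hs i
  have h2 : t = (t.comp z.toOrderHom).comp p.toOrderHom := Simplex.ext fun i => ht i
  rw [h1, h2, napp_comp σ _ p, napp_comp τ _ p]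
  congr 1
  exact Subsingleton.elim _ _

lemma le_or_ge_len {S T : Necklace} {n : ℕ} (s : (S ⊗ T).Simplex n) :
    (∀ i, s.1 i ≤ S.len) ∨ ∀ i, S.len ≤ s.1 i :=
  s.2.2 S.len (mem_wedge_joints.2 (Or.inl S.len_mem))

open Classical in
/-- The concatenation of two maps from necklaces to a reduced simplicial set, on simplices. -/
def glueApp {S T : Necklace} (σ : S.toSSet ⟶ X.obj) (τ : T.toSSet ⟶ X.obj) {n : SimplexCategory}
    (s : (S ⊗ T).Simplex n.len) : X.obj.obj (op n) :=
  if ∀ i, s.1 i ≤ S.len then napp σ s.left else napp τ s.right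

lemma glueApp_left {S T : Necklace} (σ : S.toSSet ⟶ X.obj) (τ : T.toSSet ⟶ X.obj)
    {n : SimplexCategory} (s : (S ⊗ T).Simplex n.len) (h : ∀ i, s.1 i ≤ S.len) :
    glueApp σ τ s = napp σ s.left :=
  if_pos h

lemma glueApp_right {S T : Necklace} (σ : S.toSSet ⟶ X.obj) (τ : T.toSSet ⟶ X.obj)
    {n : SimplexCategory} (s : (S ⊗ T).Simplex n.len) (h : ∀ i, S.len ≤ s.1 i) :
    glueApp σ τ s = napp τ s.right := by
  by_cases h' : ∀ i, s.1 i ≤ S.len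
  · rw [glueApp_left σ τ s h']
    have this : ∀ i, s.1 i = S.len := fun i => le_antisymm (h' i) (h i)
    refine napp_const σ τ _ _ (fun i => ?_) fun i => ?_
    · change min _ _ = min _ _
      rw [this i, this 0]
    · change s.1 i - _ = s.1 0 - _
      rw [this i, this 0]
  · exact if_neg h'

lemma glueApp_comp {S T : Necklace} (σ : S.toSSet ⟶ X.obj) (τ : T.toSSet ⟶ X.obj)
    {m n : SimplexCategory} (s : (S ⊗ T).Simplex n.len) (φ : m ⟶ n) :
    glueApp σ τ (s.comp φ.toOrderHom) = X.obj.map φ.op (glueApp σ τ s) := by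
  rcases le_or_ge_len s with h | h
  · rw [glueApp_left σ τ s h, glueApp_left σ τ (s.comp _) fun i => h _]
    exact napp_comp σ s.left φ
  · rw [glueApp_right σ τ s h, glueApp_right σ τ (s.comp _) fun i => h _]
    exact napp_comp τ s.right φ

/-- The concatenation of two maps from necklaces to a reduced simplicial set. -/
def glue {S T : Necklace} (σ : S.toSSet ⟶ X.obj) (τ : T.toSSet ⟶ X.obj) :
    (S ⊗ T).toSSet ⟶ X.obj where
  app n := ↾fun s : ULift.{u} ((S ⊗ T).Simplex n.unop.len) => glueApp σ τ s.down
  naturality n m φ := by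
    ext s
    exact glueApp_comp σ τ s.down φ.unop

lemma glue_left {S T : Necklace} (σ : S.toSSet ⟶ X.obj) (τ : T.toSSet ⟶ X.obj)
    {n : SimplexCategory} (s : (S ⊗ T).Simplex n.len) (h : ∀ i, s.1 i ≤ S.len) :
    napp (glue σ τ) s = napp σ s.left :=
  glueApp_left σ τ s h

lemma glue_right {S T : Necklace} (σ : S.toSSet ⟶ X.obj) (τ : T.toSSet ⟶ X.obj)
    {n : SimplexCategory} (s : (S ⊗ T).Simplex n.len) (h : ∀ i, S.len ≤ s.1 i) :
    napp (glue σ τ) s = napp τ s.right :=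
  glueApp_right σ τ s h

lemma napp_map {S T : Necklace} (f : S ⟶ T) (σ : T.toSSet ⟶ X.obj) {n : SimplexCategory}
    (s : S.Simplex n.len) : napp (toSSetMap f ≫ σ) s = napp σ (s.map f) := rfl

/-- The unique map from the necklace `[0]` to a reduced simplicial set. -/
def pointMap (X : ReducedSSet.{u}) : point.toSSet ⟶ X.obj where
  app n := ↾fun _ => X.obj.map (SimplexCategory.const n.unop (SimplexCategory.mk 0) 0).op default
  naturality n m φ := by
    ext s
    exact types_congr (X.obj.map_comp
      (SimplexCategory.const n.unop (SimplexCategory.mk 0) 0).op φ) default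

lemma pointMap_unique (σ τ : point.toSSet ⟶ X.obj) : σ = τ :=
  nhom_ext fun n s => napp_const σ τ s s (fun i => by
    have h1 : s.1 i ≤ 0 := s.2.1 i
    have h2 : s.1 0 ≤ 0 := s.2.1 0
    omega) fun i => by
    have h1 : s.1 i ≤ 0 := s.2.1 i
    have h2 : s.1 0 ≤ 0 := s.2.1 0
    omega

lemma glue_map {S T S' T' : Necklace} (f : S ⟶ S') (g : T ⟶ T') (σ : S'.toSSet ⟶ X.obj)
    (τ : T'.toSSet ⟶ X.obj) :
    toSSetMap (f ⊗ₘ g) ≫ glue σ τ =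
      glue (toSSetMap f ≫ σ) (toSSetMap g ≫ τ) := by
  refine nhom_ext fun n s => ?_
  rw [napp_map]
  rcases le_or_ge_len s with h | h
  · have e : ∀ i, (s.map (f ⊗ₘ g)).1 i = f.toFun (s.1 i) := fun i => by
      change f.toFun (min (s.1 i) S.len) + g.toFun (s.1 i - S.len) = _
      rw [min_eq_left (h i), Nat.sub_eq_zero_of_le (h i), g.map_zero, Nat.add_zero]
    have e' : ∀ i, (s.map (f ⊗ₘ g)).1 i ≤ S'.len := fun i => (e i).trans_le (f.map_le (h i))
    rw [glue_left _ _ _ h, glue_left _ _ _ e', napp_map]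
    refine congrArg _ (Simplex.ext fun i => ?_)
    change min _ _ = f.toFun (min _ _)
    rw [min_eq_left (e' i), min_eq_left (h i), e i]
  · have e : ∀ i, (s.map (f ⊗ₘ g)).1 i = S'.len + g.toFun (s.1 i - S.len) := fun i => by
      change f.toFun (min (s.1 i) S.len) + g.toFun (s.1 i - S.len) = _
      rw [min_eq_right (h i), f.map_len]
    rw [glue_right _ _ _ h, glue_right _ _ _ fun i => (Nat.le_add_right _ _).trans_eq (e i).symm,
      napp_map]
    refine congrArg _ (Simplex.ext fun i => ?_)
    change _ - _ = g.toFun (_ - _)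
    rw [e i, Nat.add_sub_cancel_left]

lemma glue_assoc {S T U : Necklace} (σ : S.toSSet ⟶ X.obj) (τ : T.toSSet ⟶ X.obj)
    (ρ : U.toSSet ⟶ X.obj) :
    toSSetMap (α_ S T U).inv ≫ glue (glue σ τ) ρ = glue σ (glue τ ρ) := by
  refine nhom_ext fun n s => ?_
  rw [napp_map]
  have e : ∀ i, (s.map (α_ S T U).inv).1 i = s.1 i := fun i => rfl
  have hl : (S ⊗ T).len = S.len + T.len := rfl
  rcases le_or_ge_len s with h | h
  · have h1 : ∀ i, (s.map (α_ S T U).inv).1 i ≤ (S ⊗ T).len := fun i => by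
      have := h i
      rw [e, hl]
      omega
    have e1 : ∀ i, (s.map (α_ S T U).inv).left.1 i = s.1 i := fun i => min_eq_left (h1 i)
    rw [glue_left _ _ _ h, glue_left _ _ _ h1, glue_left _ _ _ fun i => (e1 i).trans_le (h i)]
    refine congrArg _ (Simplex.ext fun i => ?_)
    exact congrArg (min · _) (e1 i)
  · rw [glue_right _ _ _ h]
    have e2 : ∀ i, s.right.1 i = s.1 i - S.len := fun i => rfl
    rcases le_or_ge_len s.right with h' | h'
    · have h1 : ∀ i, (s.map (α_ S T U).inv).1 i ≤ (S ⊗ T).len := fun i => by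
        have := h' i
        rw [e2] at this
        rw [e, hl]
        omega
      have e1 : ∀ i, (s.map (α_ S T U).inv).left.1 i = s.1 i := fun i => min_eq_left (h1 i)
      rw [glue_left _ _ _ h', glue_left _ _ _ h1,
        glue_right _ _ _ fun i => (h i).trans_eq (e1 i).symm]
      refine congrArg _ (Simplex.ext fun i => ?_)
      change (s.map (α_ S T U).inv).left.1 i - S.len = min (s.right.1 i) T.len
      rw [min_eq_left (h' i), e1, e2]
    · have h1 : ∀ i, (S ⊗ T).len ≤ (s.map (α_ S T U).inv).1 i := fun i => by
        have := h' i
        have := h i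
        rw [e2] at *
        rw [e, hl]
        omega
      rw [glue_right _ _ _ h', glue_right _ _ _ h1]
      refine congrArg _ (Simplex.ext fun i => ?_)
      change s.1 i - (S.len + T.len) = s.1 i - S.len - T.len
      omega

lemma point_glue {T : Necklace} (σ : point.toSSet ⟶ X.obj) (τ : T.toSSet ⟶ X.obj) :
    toSSetMap (λ_ T).inv ≫ glue σ τ = τ := by
  refine nhom_ext fun n s => ?_
  rw [napp_map, glue_right _ _ _ fun i => Nat.zero_le _]
  exact congrArg _ (Simplex.ext fun i => rfl)

lemma glue_point {T : Necklace} (σ : T.toSSet ⟶ X.obj) (τ : point.toSSet ⟶ X.obj) :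
    toSSetMap (ρ_ T).inv ≫ glue σ τ = σ := by
  refine nhom_ext fun n s => ?_
  rw [napp_map, glue_left _ _ _ fun i => s.2.1 i]
  exact congrArg _ (Simplex.ext fun i => min_eq_left (s.2.1 i))

lemma glue_comp {Y : ReducedSSet.{u}} (f : X ⟶ Y) {S T : Necklace} (σ : S.toSSet ⟶ X.obj)
    (τ : T.toSSet ⟶ X.obj) : glue σ τ ≫ f.hom = glue (σ ≫ f.hom) (τ ≫ f.hom) := by
  refine nhom_ext fun n s => ?_
  change f.hom.app _ (glueApp σ τ s) = glueApp (σ ≫ f.hom) (τ ≫ f.hom) s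
  rcases le_or_ge_len s with h | h
  · rw [glueApp_left σ τ s h, glueApp_left _ _ s h]
    rfl
  · rw [glueApp_right σ τ s h, glueApp_right _ _ s h]
    rfl

end Glue

/-- The presheaf `T ↦ Hom(S(T), X)` on necklaces. -/
def ncobarFunctor (X : ReducedSSet.{u}) : Necklaceᵒᵖ ⥤ Type u where
  obj T := T.unop.toSSet ⟶ X.obj
  map f := ↾fun σ => toSSetMap f.unop ≫ σ
  map_id T := by
    ext
    rfl
  map_comp f g := by
    ext
    rfl

instance (X : ReducedSSet.{u}) : (ncobarFunctor X).LaxMonoidal :=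
  laxMonoidalOfMul (ncobarFunctor X) (fun σ τ => glue σ τ) (pointMap X)
    (fun f g σ τ => glue_map f.unop g.unop σ τ)
    (fun σ τ ρ => glue_assoc σ τ ρ)
    (fun τ => point_glue (pointMap X) τ)
    (fun σ => glue_point σ (pointMap X))

/-- The necklical cobar construction `Ω_nec`: the presheaf `T ↦ Hom(S(T), X)` on necklaces, with
the product given by concatenation. -/
def ncobar : ReducedSSet.{u} ⥤ LaxMonoidalFunctor Necklaceᵒᵖ (Type u) where
  obj X := LaxMonoidalFunctor.of (ncobarFunctor X)
  map {X Y} f :=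
    { hom :=
        { app := fun T => ↾fun σ : T.unop.toSSet ⟶ X.obj => σ ≫ f.hom
          naturality := fun _ _ _ => rfl }
      isMonoidal :=
        { unit := by
            ext x
            exact pointMap_unique _ _
          tensor := fun S T => by
            ext p
            exact glue_comp f p.1 p.2 } }
  map_id X := by
    ext T
    exact Category.comp_id _
  map_comp f g := by
    ext T
    exact (Category.assoc _ _ _).symm

/-- The cubical cobar construction: the left Kan extension of the necklical cobar construction along
the functor from necklaces to cubes. -/
def ccobar : ReducedSSet.{u} ⥤ LaxMonoidalFunctor Cubeᵒᵖ (Type u) :=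
  ncobar ⋙ lanMon necklaceCube

end

end CubicalCobar

end

/-! A cell of `Ω_□ X` is a class of triples `(T, σ, f)` with `σ : S(T) → X` and `f : 2^m → P(T)` a
map of cubes. Call the number of non-constant output coordinates of `f` its rank. If the rank is
less than `m`, then `f` factors through a codegeneracy or a coconnection and the cell is degenerate
(`IsCubical.exists_factor`). If it is `m`, then `f` is the inclusion of a face, determined by its
least and greatest vertices. A vertex of `P(T)` is a set of vertices of `T` containing all joints,
so a face is a pair `V ⊆ W` of such sets, and it is the image of the cube of a necklace with
vertices `W` and joints `V` (`exists_subnecklace`). Since `X` is reduced, a map from a necklace is a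
word of simplices of `X`. Hence the chains are generated, as an algebra, by the cells `bcell c` of
single simplices.

The comparison map sends `s⁻¹c` to `bcell c` if `c` has dimension at least `2`, to `bcell c - 1` for
an edge, and to `0` for the point. The shift by `1` is forced: `P` sends `[1] → [0]` to an identity,
so a degenerate edge gives the unit and not a degenerate cell, while it is zero in the normalized
chains. The face `δ⁰` of `bcell c` omits an inner vertex and `δ¹` splits the simplex in two
(`bcell_dface_false`, `bcell_dface_true`), which gives the inner faces and the quadratic terms of
the cobar differential. The outer faces, which have no cubical counterpart, cancel against the units
subtracted from edges (`comparison_d_gen`).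

Surjectivity is the analysis of cells above. For injectivity a linear left inverse is built: a cell
of full rank goes to the product, over consecutive elements of `V`, of the weights of the simplices
into which `V` cuts `W`, and all other cells go to `0`. The point is that this respects the relation
of the Kan extension (`spanWeight_map_ite`): a map of necklaces that keeps the rank can only
collapse beads to degenerate edges, of weight `1`, and one that lowers the rank makes some simplex
of dimension at least `2` degenerate, of weight `0`. The assignment is multiplicative and correct on
generators. -/

noncomputable section

namespace CubicalCobar

section

/-! ### Maps of cubes and their moving coordinates -/

section Moving

variable {m n : ℕ} {f : (Fin m → Bool) → (Fin n → Bool)}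

/-- The output coordinates of a map of cubes that are not constant. -/
def moving (f : (Fin m → Bool) → (Fin n → Bool)) : Finset (Fin n) :=
  Finset.univ.filter fun b => f (fun _ => false) b = false ∧ f (fun _ => true) b = true

/-- In an arbitrary normal form an output that is constantly `1` may still be related to inputs.
Dropping these pairs does not change the map, and afterwards the outputs hit by `R` are exactly the
non-constant ones. -/
lemma IsCubical.exists_disjoint_nf (hf : IsCubical f) :
    ∃ R c, CubeNF f R c ∧ ∀ a b, R a b → ¬ c b := by
  obtain ⟨R, c, h⟩ := hf.exists_nf
  refine ⟨fun a b => R a b ∧ ¬ c b, c, ⟨fun h1 h2 => h.mono h1.1 h2.1, fun x b => ?_⟩, fun a b h => h.2⟩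
  rw [h.eq_true_iff]
  by_cases hc : c b <;> simp [hc]

/-- Maps of cubes are monotone, so the two extreme vertices suffice to detect that a coordinate is
not constant. -/
lemma CubeNF.mem_moving {R : Fin m → Fin n → Prop} {c : Fin n → Prop} (h : CubeNF f R c)
    (hd : ∀ a b, R a b → ¬ c b) {b : Fin n} : b ∈ moving f ↔ ∃ a, R a b := by
  have h0 := h.eq_true_iff (fun _ => false) b
  have h1 := h.eq_true_iff (fun _ => true) b
  simp only [Bool.false_eq_true, and_false, exists_false, or_false, and_true] at h0 h1
  simp only [moving, Finset.mem_filter, Finset.mem_univ, true_and, h1, ← Bool.not_eq_true, h0]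
  constructor
  · rintro ⟨h2, h3 | h3⟩
    exacts [(h2 h3).elim, h3]
  · rintro ⟨a, ha⟩
    exact ⟨hd a b ha, Or.inr ⟨a, ha⟩⟩

/-- Each moving output coordinate depends on some input coordinate, monotonically. -/
lemma CubeNF.exists_strictMono {R : Fin m → Fin n → Prop} {c : Fin n → Prop} (h : CubeNF f R c)
    (hd : ∀ a b, R a b → ¬ c b) :
    ∃ r : moving f → Fin m, StrictMono r ∧ ∀ b, R (r b) b := by
  choose r hr using fun b : moving f => (h.mem_moving hd).1 b.2
  refine ⟨r, fun b b' hb => ?_, hr⟩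
  by_contra hlt
  exact absurd (h.mono (hr b') (hr b) (not_lt.1 hlt)) (not_le.2 hb)

/-- The rank is at most the dimension of the source: the chosen inputs of different moving outputs
are different. -/
lemma IsCubical.card_moving_le (hf : IsCubical f) : (moving f).card ≤ m := by
  obtain ⟨R, c, h, hd⟩ := hf.exists_disjoint_nf
  obtain ⟨r, hr, -⟩ := h.exists_strictMono hd
  simpa using Fintype.card_le_of_injective r hr.injective

/-- A map of cubes of full rank is described by an enumeration of its moving coordinates. -/
lemma IsCubical.apply_of_card_moving (hf : IsCubical f) (hm : (moving f).card = m)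
    (x : Fin m → Bool) (b : Fin n) :
    (∀ a, f x ((moving f).orderEmbOfFin hm a) = x a) ∧
      (b ∉ moving f → f x b = f (fun _ => false) b) := by
  obtain ⟨R, c, h, hd⟩ := hf.exists_disjoint_nf
  obtain ⟨r, hr, hR⟩ := h.exists_strictMono hd
  constructor
  · intro a
    let e : Fin m → moving f := fun a =>
      ⟨(moving f).orderEmbOfFin hm a, Finset.orderEmbOfFin_mem _ _ _⟩
    have he : StrictMono e := fun a a' ha => ((moving f).orderEmbOfFin hm).strictMono ha
    -- A strictly monotone self-map of `Fin m` is the identity, so the input chosen for the `a`-th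
    -- moving output is the `a`-th one.
    have hre (a) : r (e a) = a := congrFun (hr.comp he).eq_id a
    have hRa : R a ((moving f).orderEmbOfFin hm a) := by
      have := hR (e a)
      rwa [hre] at this
    rw [Bool.eq_iff_iff, h.eq_true_iff]
    constructor
    · rintro (h1 | ⟨a', h1, h2⟩)
      · exact (hd _ _ hRa h1).elim
      · have h3 := hR (e a')
        rw [hre] at h3
        have h4 := h.functional h1 h3
        rwa [((moving f).orderEmbOfFin hm).injective h4]
    · exact fun h1 => Or.inr ⟨a, hRa, h1⟩
  · intro hb
    rw [h.mem_moving hd] at hb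
    push Not at hb
    rw [Bool.eq_iff_iff, h.eq_true_iff, h.eq_true_iff]
    simp [hb]

/-- A map of full rank is the inclusion of a face, and a face is known from its least and greatest
vertices: together they give the moving coordinates and the values of the others. -/
lemma IsCubical.eq_of_card_moving {f' : (Fin m → Bool) → (Fin n → Bool)} (hf : IsCubical f)
    (hf' : IsCubical f') (hm : (moving f).card = m)
    (h0 : f (fun _ => false) = f' fun _ => false) (h1 : f (fun _ => true) = f' fun _ => true) :
    f = f' := by
  have hmov : moving f' = moving f := by simp only [moving, h0, h1]
  have hm' : (moving f').card = m := by rw [hmov, hm]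
  funext x b
  by_cases hb : b ∈ moving f
  · obtain ⟨a, rfl⟩ : b ∈ Set.range ((moving f).orderEmbOfFin hm) := by simpa using hb
    rw [(hf.apply_of_card_moving hm x (Finset.orderEmbOfFin _ hm a)).1]
    have := (hf'.apply_of_card_moving hm' x (Finset.orderEmbOfFin _ hm' a)).1 a
    simp only [hmov] at this
    rw [this]
  · rw [(hf.apply_of_card_moving hm x b).2 hb, (hf'.apply_of_card_moving hm' x b).2 (hmov ▸ hb), h0]

/-- A map of cubes that is not of full rank factors through a codegeneracy or a coconnection. -/
lemma IsCubical.exists_factor (hf : IsCubical f) (hm : (moving f).card < m) :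
    ∃ (l : ℕ) (f' : (Fin l → Bool) → (Fin n → Bool)) (hl : m = l + 1), IsCubical f' ∧
      ((∃ i, f = fun x => f' (cubeDegen i fun j => x (Fin.cast hl.symm j))) ∨
        ∃ i, f = fun x => f' (cubeConn i fun j => x (Fin.cast hl.symm j))) := by
  classical
  obtain ⟨R, c, h, hd⟩ := hf.exists_disjoint_nf
  obtain _ | m := m
  · omega
  -- An input on which no output depends can be omitted: this is the factor `σ_a`.
  by_cases h1 : ∃ a, ∀ b, ¬ R a b
  · obtain ⟨a, ha⟩ := h1
    let f' : (Fin m → Bool) → (Fin n → Bool) := fun y => f (a.insertNth false y)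
    have hf' : CubeNF f' (fun i b => R (a.succAbove i) b) c := by
      refine ⟨fun h1 h2 h3 => h.mono h1 h2 (a.strictMono_succAbove.monotone h3), fun x b => ?_⟩
      simp [f', h.eq_true_iff, Fin.exists_iff_succAbove a]
    refine ⟨m, f', rfl, hf'.isCubical _ rfl, Or.inl ⟨a, ?_⟩⟩
    funext x b
    rw [Bool.eq_iff_iff, h.eq_true_iff, hf'.eq_true_iff, Fin.exists_iff_succAbove a]
    simp only [cubeDegen]
    have := ha b
    simp [this]
  -- Two adjacent inputs that feed the same output matter only through their maximum: this is the
  -- factor `γ_i`.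
  by_cases h2 : ∃ (i : Fin m) (b : Fin n), R i.castSucc b ∧ R i.succ b
  · obtain ⟨i, b, h3, h4⟩ := h2
    let f' : (Fin m → Bool) → (Fin n → Bool) := fun y b =>
      decide (c b ∨ ∃ a, R (i.castSucc.succAbove a) b ∧ y a = true)
    have hf' : CubeNF f' (fun a b => R (i.castSucc.succAbove a) b) c :=
      ⟨fun h1 h2 h3 => h.mono h1 h2 (i.castSucc.strictMono_succAbove.monotone h3), fun x b => by
        simp [f']⟩
    refine ⟨m, f', rfl, hf'.isCubical _ rfl, Or.inr ⟨i, ?_⟩⟩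
    funext x b'
    rw [Bool.eq_iff_iff, h.eq_true_iff, hf'.eq_true_iff, Fin.exists_iff_succAbove i.castSucc]
    refine or_congr Iff.rfl ?_
    simp only [cubeConn, Fin.cast_eq_self]
    constructor
    · rintro (⟨h5, h6⟩ | ⟨a, ha, hx⟩)
      · refine ⟨i, ?_, by simp [h6]⟩
        obtain rfl := h.functional h3 h5
        simpa using h4
      · refine ⟨a, ha, ?_⟩
        split_ifs with hai
        · subst hai
          simp at hx
          simp [hx]
        · exact hx
    · rintro ⟨a, ha, hx⟩
      split_ifs at hx with hai
      · subst hai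
        simp only [Bool.or_eq_true] at hx
        simp only [Fin.succAbove_castSucc_self] at ha
        obtain rfl := h.functional h4 ha
        rcases hx with hx | hx
        · exact Or.inl ⟨h3, hx⟩
        · exact Or.inr ⟨a, by simpa using ha, by simpa using hx⟩
      · exact Or.inr ⟨a, ha, hx⟩
  -- Otherwise every input feeds an output and adjacent inputs feed different ones. By monotonicity
  -- there is then a separate moving output for each input, against the bound on the rank.
  · exfalso
    push Not at h1 h2
    choose b hb using h1
    have hlt : StrictMono b := Fin.strictMono_iff_lt_succ.2 fun i =>
      lt_of_le_of_ne (h.mono (hb _) (hb _) i.castSucc_lt_succ.le) fun he =>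
        h2 i (b i.castSucc) (hb _) (he ▸ hb _)
    have := Finset.card_le_card (s := Finset.univ.image b) (t := moving f) fun y hy => by
      obtain ⟨a, -, rfl⟩ := Finset.mem_image.1 hy
      exact (h.mem_moving hd).2 ⟨a, hb a⟩
    rw [Finset.card_image_of_injective _ hlt.injective, Finset.card_fin] at this
    omega

end Moving

namespace Cells

variable {Y : Cubeᵒᵖ ⥤ Type u}

/-- Restrictions of less than full rank vanish in the normalized chains. This disposes of the cells
of degenerate simplices and, for surjectivity, of all cells that are not faces of necklaces. -/
lemma isDegenerate_pull (c : Cells Y) {A : Cube} (f : A ⟶ c.cube)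
    (h : (moving f.1).card < A.dim) : (c.pull f).IsDegenerate := by
  obtain ⟨_ | m⟩ := A
  · simp at h
  obtain ⟨l, f', hl, hf', ⟨i, hi⟩ | ⟨i, hi⟩⟩ := f.2.exists_factor h
  all_goals obtain rfl : m = l := by simpa using hl
  · refine ⟨m, Or.inl ⟨i, Y.map (Quiver.Hom.op ⟨f', hf'⟩) c.val, ?_⟩⟩
    rw [show f = Cube.degen i ≫ (⟨f', hf'⟩ : Cube.mk m ⟶ c.cube) from Subtype.ext hi,
      ← pull_pull]
    rfl
  · refine ⟨m, Or.inr ⟨i, Y.map (Quiver.Hom.op ⟨f', hf'⟩) c.val, ?_⟩⟩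
    rw [show f = Cube.conn i ≫ (⟨f', hf'⟩ : Cube.mk m ⟶ c.cube) from Subtype.ext hi,
      ← pull_pull]
    rfl

/-- The restriction of a cell along a face is determined by two opposite vertices of the face. -/
lemma pull_eq_pull (c : Cells Y) {A B : Cube} (f : A ⟶ c.cube) (g : B ⟶ c.cube)
    (h : A.dim = B.dim) (hm : (moving f.1).card = A.dim)
    (h0 : f.1 (fun _ => false) = g.1 fun _ => false)
    (h1 : f.1 (fun _ => true) = g.1 fun _ => true) : c.pull f = c.pull g := by
  obtain ⟨m⟩ := A
  obtain ⟨n⟩ := B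
  obtain rfl : m = n := h
  rw [show f = g from Subtype.ext (f.2.eq_of_card_moving g.2 hm h0 h1)]

end Cells

end

section

/-! ### The cells of the cubical cobar construction -/

namespace Necklace

/-- The finite set underlying `verts`. -/
def vset (T : Necklace) (x : Fin T.dim → Bool) : Finset ℕ :=
  T.joints ∪ (Finset.univ.filter fun a => x a = true).map T.vertex.toEmbedding

lemma coe_vset (T : Necklace) (x : Fin T.dim → Bool) : (T.vset x : Set ℕ) = T.verts x := by
  ext v
  simp [vset, verts]

lemma mem_vset {T : Necklace} {x : Fin T.dim → Bool} {v : ℕ} : v ∈ T.vset x ↔ v ∈ T.verts x := by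
  rw [← coe_vset, Finset.mem_coe]

/-- In terms of vertex sets, the functor from necklaces to cubes acts by direct images; the later
computations with it are made in this form. -/
lemma vset_cubeMap {S T : Necklace} (f : S ⟶ T) (x : Fin S.dim → Bool) :
    T.vset (cubeMap f x) = (S.vset x).image f.toFun := by
  apply Finset.coe_injective
  rw [coe_vset, verts_cubeMap, Finset.coe_image, coe_vset]

lemma vset_false (T : Necklace) : T.vset (fun _ => false) = T.joints := by
  simp [vset]

lemma mem_vset_true {T : Necklace} {v : ℕ} : v ∈ T.vset (fun _ => true) ↔ v ≤ T.len := by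
  rw [mem_vset]
  refine ⟨verts_le, fun h => ?_⟩
  by_cases hv : v ∈ T.joints
  · exact Or.inl hv
  · obtain ⟨a, ha⟩ := exists_vertex (mem_inner.2 ⟨h, hv⟩)
    exact Or.inr ⟨a, rfl, ha⟩

lemma joints_subset_vset (T : Necklace) (x : Fin T.dim → Bool) : T.joints ⊆ T.vset x :=
  Finset.subset_union_left

lemma vset_injective {T : Necklace} {x y : Fin T.dim → Bool} (h : T.vset x = T.vset y) : x = y :=
  verts_injective (by rw [← coe_vset, ← coe_vset, h])

/-- The moving coordinates correspond to the vertices that are added. -/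
lemma card_moving {T : Necklace} {m : ℕ} (f : (Fin m → Bool) → (Fin T.dim → Bool)) :
    (moving f).card = (T.vset (f fun _ => true) \ T.vset (f fun _ => false)).card := by
  rw [← Finset.card_map T.vertex.toEmbedding]
  congr 1
  ext v
  simp only [Finset.mem_map, moving, Finset.mem_filter, Finset.mem_univ, true_and,
    Finset.mem_sdiff, mem_vset]
  constructor
  · rintro ⟨b, ⟨h0, h1⟩, rfl⟩
    change T.vertex b ∈ _ ∧ T.vertex b ∉ _
    rw [vertex_mem_verts, vertex_mem_verts, h0, h1]
    simp
  · rintro ⟨h | ⟨b, hb, rfl⟩, h0⟩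
    · exact (h0 (Or.inl h)).elim
    · rw [vertex_mem_verts, Bool.not_eq_true] at h0
      exact ⟨b, ⟨h0, hb⟩, rfl⟩

/-- The necklace `[n]`. -/
def bead (n : ℕ) : Necklace where
  len := n
  joints := {0, n}
  zero_mem := by simp
  len_mem := by simp
  le_len := by simp

lemma mem_bead_joints {n v : ℕ} : v ∈ (bead n).joints ↔ v = 0 ∨ v = n := by
  simp [bead]

lemma bead_inner (n : ℕ) : (bead n).inner = Finset.Ioo 0 n := by
  ext v
  rw [mem_inner, mem_bead_joints, Finset.mem_Ioo]
  change v ≤ n ∧ _ ↔ _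
  omega

lemma bead_dim (n : ℕ) : (bead n).dim = n - 1 := by
  rw [dim, bead_inner, Nat.card_Ioo, Nat.sub_zero]

/-- Coordinates are numbered from `0`, but the first inner vertex of `[n]` is `1`. Hence the index
`i + 1` in the formulas for the faces of `bcell`. -/
lemma bead_vertex {n : ℕ} (a : Fin (bead n).dim) : (bead n).vertex a = a + 1 := by
  have := Finset.orderEmbOfFin_unique (s := (bead n).inner) rfl
    (f := fun a : Fin (bead n).dim => (a : ℕ) + 1) (fun a => by
      have : (a : ℕ) < (bead n).dim := a.2
      rw [bead_dim] at this
      rw [bead_inner, Finset.mem_Ioo]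
      omega) fun a b h => Nat.add_lt_add_right h 1
  exact (congrFun this a).symm

lemma bead_simplex {n : ℕ} {p : ℕ} (s : (bead n).Simplex p) (i : Fin (p + 1)) : s.1 i ≤ n :=
  s.2.1 i

end Necklace

open Necklace

variable {X : ReducedSSet.{u}}

/-- The cell of the cubical cobar construction given by a map from a necklace. -/
def ncell {T : Necklace} (σ : T.toSSet ⟶ X.obj) : Cells (ccobar.obj X).toFunctor :=
  ⟨necklaceCube.obj T, LanObj.mk (F := necklaceCube) (K := ncobarFunctor X) σ (𝟙 _)⟩

lemma ncell_pull {T : Necklace} (σ : T.toSSet ⟶ X.obj) {A : Cube} (f : A ⟶ necklaceCube.obj T) :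
    (ncell σ).pull f = ⟨A, LanObj.mk (F := necklaceCube) (K := ncobarFunctor X) σ f⟩ :=
  congrArg (fun g : A ⟶ necklaceCube.obj T => (⟨A, LanObj.mk (F := necklaceCube)
    (K := ncobarFunctor X) σ g⟩ : Cells (ccobar.obj X).toFunctor)) (Category.comp_id f)

/-- Every class in the Kan extension has a representative, and it is the restriction of the
tautological cell of `σ`. This reduces statements on cells to necklaces and maps of cubes. -/
lemma exists_eq_pull_ncell (c : Cells (ccobar.obj X).toFunctor) :
    ∃ (T : Necklace) (σ : T.toSSet ⟶ X.obj) (f : c.cube ⟶ necklaceCube.obj T),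
      c = (ncell σ).pull f := by
  obtain ⟨A, x⟩ := c
  induction x using LanObj.ind with | h T σ f => ?_
  exact ⟨T, σ, f, (ncell_pull σ f).symm⟩

/-- The defining relation of the Kan extension, read on cells. -/
lemma ncell_map {S T : Necklace} (g : S ⟶ T) (σ : T.toSSet ⟶ X.obj) :
    ncell (toSSetMap g ≫ σ) = (ncell σ).pull (necklaceCube.map g) := by
  rw [ncell_pull]
  refine congrArg (Cells.mk _) ?_
  refine (LanObj.sound (F := necklaceCube) (K := ncobarFunctor X) g σ (𝟙 _)).trans ?_
  rw [Category.id_comp]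

/-- The cubes of the two sides have equal dimension without being equal by definition. Restriction
along the canonical isomorphism leaves a cell unchanged, and it turns the left side into the class
that defines the product. -/
lemma ncell_glue {S T : Necklace} (σ : S.toSSet ⟶ X.obj) (τ : T.toSSet ⟶ X.obj) :
    ncell (glue σ τ) = ncell σ * ncell τ := by
  refine (Cells.pull_eq_self (ncell (glue σ τ)) (A := necklaceCube.obj S ⊗ necklaceCube.obj T)
    (f := Cube.castHom (necklaceCube_obj_tensor_dim S T)) (necklaceCube_obj_tensor_dim S T)
      fun x i _ => Cube.bit_castHom _ x i).symm.trans ?_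
  refine (ncell_pull (glue σ τ) _).trans ?_
  refine congrArg (Cells.mk _) (congrArg (LanObj.mk (F := necklaceCube) (K := ncobarFunctor X)
    (glue σ τ)) (?_ : _ = (𝟙 _ ⊗ₘ 𝟙 _) ≫ _))
  rw [id_tensorHom_id]
  exact (Category.id_comp (Functor.LaxMonoidal.μ necklaceCube S T)).symm

lemma ncell_pointMap : ncell (pointMap X) = 1 := by
  refine (Cells.pull_eq_self (ncell (pointMap X)) (A := 𝟙_ Cube)
    (f := Cube.castHom necklaceCube_obj_unit_dim) necklaceCube_obj_unit_dim
      fun x i _ => Cube.bit_castHom _ x i).symm.trans ?_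
  exact ncell_pull (pointMap X) _

lemma ncell_comp {Y : ReducedSSet.{u}} (h : X ⟶ Y) {T : Necklace} (σ : T.toSSet ⟶ X.obj) :
    Cells.map (ccobar.map h) (ncell σ) = ncell (σ ≫ h.hom) := rfl

/-- The restriction of a cell along a face is given by a map of necklaces with the corresponding
image. -/
lemma pull_ncell_eq {S T : Necklace} (g : S ⟶ T) (σ : T.toSSet ⟶ X.obj) {A : Cube}
    (f : A ⟶ necklaceCube.obj T) (hd : A.dim = S.dim) (hm : (moving f.1).card = A.dim)
    (h0 : T.vset (f.1 fun _ => false) = S.joints.image g.toFun)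
    (h1 : T.vset (f.1 fun _ => true) = (Finset.range (S.len + 1)).image g.toFun) :
    (ncell σ).pull f = ncell (toSSetMap g ≫ σ) := by
  rw [ncell_map]
  -- As `f` has full rank, only the extreme vertices have to be compared. Those of the cube of `S`
  -- are its joints and the set of all its vertices.
  refine Cells.pull_eq_pull _ _ _ hd hm (vset_injective (T := T) ?_) (vset_injective (T := T) ?_)
  · rw [h0]
    exact .trans (congrArg _ S.vset_false.symm) (vset_cubeMap g _).symm
  · rw [h1]
    refine .trans ?_ (vset_cubeMap g _).symm
    refine congrArg _ (Finset.ext fun v => ?_)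
    exact Finset.mem_range_succ_iff.trans mem_vset_true.symm

/-! ### The cells given by single simplices -/

/-- The operator on simplices given by a simplex of `Δ[n]`. -/
def beadHom {n p : ℕ} (s : (bead n).Simplex p) : SimplexCategory.mk p ⟶ SimplexCategory.mk n :=
  SimplexCategory.mkHom ⟨fun i => ⟨s.1 i, Nat.lt_succ_of_le (bead_simplex s i)⟩,
    fun _ _ h => s.1.monotone h⟩

lemma beadHom_apply {n p : ℕ} (s : (bead n).Simplex p) (i : Fin (p + 1)) :
    ((beadHom s).toOrderHom i : ℕ) = s.1 i := rfl

/-- The map `Δ[n] → X` given by a simplex. -/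
def beadMap (c : Simplices X.obj) : (bead c.1).toSSet ⟶ X.obj where
  app m := ↾fun s : ULift.{u} ((bead c.1).Simplex m.unop.len) => X.obj.map (beadHom s.down).op c.2
  naturality m m' φ := by
    ext s
    exact types_congr (X.obj.map_comp (beadHom s.down).op φ) c.2

lemma napp_beadMap (c : Simplices X.obj) {m : SimplexCategory} (s : (bead c.1).Simplex m.len) :
    napp (beadMap c) s = X.obj.map (beadHom s).op c.2 := rfl

/-- The cell of the cubical cobar construction given by a simplex. -/
def bcell (c : Simplices X.obj) : Cells (ccobar.obj X).toFunctor := ncell (beadMap c)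

lemma dim_bcell (c : Simplices X.obj) : (bcell c).dim = c.1 - 1 := bead_dim c.1

lemma beadMap_comp {Y : ReducedSSet.{u}} (h : X ⟶ Y) (c : Simplices X.obj) :
    beadMap c ≫ h.hom = beadMap (c.map h.hom) := by
  refine nhom_ext fun n s => ?_
  exact types_congr (h.hom.naturality (beadHom s).op) c.2

lemma bcell_map {Y : ReducedSSet.{u}} (h : X ⟶ Y) (c : Simplices X.obj) :
    Cells.map (ccobar.map h) (bcell c) = bcell (c.map h.hom) := by
  rw [bcell, ncell_comp, beadMap_comp]
  rfl

/-- Turns an identity between simplices obtained from `c` into an identity between vertex numbers,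
which arithmetic can settle. -/
lemma map_map_eq {c : Simplices X.obj} {m p : ℕ} {φ : ℕ →o ℕ}
    (f : SimplexCategory.mk p ⟶ SimplexCategory.mk m) (g : SimplexCategory.mk p ⟶ SimplexCategory.mk c.1)
    (h : ∀ i, min (φ (f.toOrderHom i)) c.1 = g.toOrderHom i) :
    X.obj.map f.op (c.pull m φ).2 = X.obj.map g.op c.2 := by
  have : f ≫ Simplices.vertexMap m c.1 φ = g := Simplices.map_toOrderHom_ext h
  rw [← this]
  exact (types_congr (X.obj.map_comp (Simplices.vertexMap m c.1 φ).op f.op) c.2).symm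

/-- The Yoneda correspondence is natural in the bead. The lemma serves both inner cofaces and
codegeneracies; outer cofaces are excluded, since they do not preserve the end points. -/
lemma beadMap_pull (c : Simplices X.obj) {m : ℕ} {φ : ℕ →o ℕ} (g : bead m ⟶ bead c.1)
    (h : ∀ t ≤ m, g.toFun t = φ t) : beadMap (c.pull m φ) = toSSetMap g ≫ beadMap c := by
  refine nhom_ext fun n s => ?_
  refine (map_map_eq (beadHom s) (beadHom (s.map g)) fun i => ?_).trans
    (napp_map g (beadMap c) s).symm
  have h1 : g.toFun (s.1 i) = φ (s.1 i) := h _ (bead_simplex s i)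
  have h2 : (s.map g).1 i = g.toFun (s.1 i) := rfl
  have h3 := bead_simplex (s.map g) i
  rw [beadHom_apply, beadHom_apply, ← h1, ← h2]
  exact min_eq_left h3

/-! ### Cofaces, splittings and codegeneracies of a bead -/

/-- The map of necklaces given by an inner coface. -/
def beadFace (n : ℕ) {i : ℕ} (h0 : 0 < i) (h1 : i < n) : bead (n - 1) ⟶ bead n where
  toFun := Simplices.skip i
  mono := (Simplices.skip i).monotone
  map_zero := by simp [Simplices.skip_apply, h0]
  map_add v := by
    change (if n - 1 + v < i then n - 1 + v else n - 1 + v + 1) = n + v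
    rw [if_neg] <;> omega
  cover j hj := by
    rcases mem_bead_joints.1 hj with rfl | rfl
    · exact ⟨0, Necklace.zero_mem _, by simp [Simplices.skip_apply, h0]⟩
    · refine ⟨j - 1, Necklace.len_mem _, ?_⟩
      change (if j - 1 < i then j - 1 else j - 1 + 1) = j
      rw [if_neg] <;> omega

/-- The map of necklaces `[i] ∨ [n - i] ⟶ [n]`. -/
def beadSplit (n : ℕ) {i : ℕ} (h : i ≤ n) : bead i ⊗ bead (n - i) ⟶ bead n where
  toFun v := v
  mono := monotone_id
  map_zero := rfl
  map_add v := by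
    change i + (n - i) + v = n + v
    omega
  cover j hj := by
    refine ⟨j, ?_, rfl⟩
    rcases mem_bead_joints.1 hj with rfl | rfl
    · exact Necklace.zero_mem _
    · have := Necklace.len_mem (bead i ⊗ bead (j - i))
      change i + (j - i) ∈ _ at this
      rwa [show i + (j - i) = j by omega] at this

lemma beadMap_dface (c : Simplices X.obj) {i : ℕ} (h0 : 0 < i) (h1 : i < c.1) :
    beadMap (c.dface i) = toSSetMap (beadFace c.1 h0 h1) ≫ beadMap c :=
  beadMap_pull c (beadFace c.1 h0 h1) fun _ _ => rfl

/-- `beadSplit` is the identity on vertices. A simplex of the wedge lies in one of the two beads,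
where the claim is just how the front or back face sits in `c`. -/
lemma glue_beadMap_seg (c : Simplices X.obj) {i : ℕ} (h : i ≤ c.1) :
    glue (beadMap (c.seg 0 i)) (beadMap (c.seg i c.1)) =
      toSSetMap (beadSplit c.1 h) ≫ beadMap c := by
  refine nhom_ext fun n s => .trans ?_ (napp_map (beadSplit c.1 h) (beadMap c) s).symm
  rcases le_or_ge_len s with h' | h'
  · refine (glue_left _ _ s h').trans (map_map_eq (beadHom s.left) _ fun j => ?_)
    change min (0 + min (s.1 j) i) c.1 = s.1 j
    have : s.1 j ≤ i := h' j
    omega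
  · refine (glue_right _ _ s h').trans (map_map_eq (beadHom s.right) _ fun j => ?_)
    change min (i + (s.1 j - i)) c.1 = s.1 j
    have h1 : i ≤ s.1 j := h' j
    have h2 : s.1 j ≤ i + (c.1 - i) := s.2.1 j
    omega

/-- `[0]` is the unit necklace, and its map to a reduced simplicial set is unique. -/
lemma bcell_of_zero (c : Simplices X.obj) (h : c.1 = 0) : bcell c = 1 := by
  obtain rfl := ReducedSSet.eq_pt c h
  rw [← ncell_pointMap, bcell]
  have e : bead 0 = point := by
    ext v
    · rfl
    · simp [bead, point]
  -- The necklace is generalized so that its equality with `point` can be substituted in the type of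
  -- `σ`.
  have aux (T : Necklace) (e : T = point) (σ : T.toSSet ⟶ X.obj) : ncell σ = ncell (pointMap X) := by
    subst e
    rw [pointMap_unique σ]
  exact aux _ e _

/-- The map `σ^i` on vertices. -/
def merge (i : ℕ) : ℕ →o ℕ where
  toFun t := if t ≤ i then t else t - 1
  monotone' s t h := by dsimp only; split_ifs <;> omega

lemma merge_apply (i t : ℕ) : merge i t = if t ≤ i then t else t - 1 := rfl

/-- The map of necklaces given by a codegeneracy. -/
def beadDegen {n i : ℕ} (h : i ≤ n) : bead (n + 1) ⟶ bead n where
  toFun := merge i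
  mono := (merge i).monotone
  map_zero := by simp [merge_apply]
  map_add v := by
    change (if n + 1 + v ≤ i then n + 1 + v else n + 1 + v - 1) = n + v
    rw [if_neg] <;> omega
  cover j hj := by
    rcases mem_bead_joints.1 hj with rfl | rfl
    · exact ⟨0, Necklace.zero_mem _, by simp [merge_apply]⟩
    · refine ⟨j + 1, Necklace.len_mem _, ?_⟩
      change (if j + 1 ≤ i then j + 1 else j + 1 - 1) = j
      rw [if_neg] <;> omega

/-- All codegeneracies, the first and the last included, preserve the end points and so are
morphisms of beads. Whether the cell is degenerate then depends only on the dimensions of the two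
cubes. -/
lemma exists_bcell_degenerate {c : Simplices X.obj} (h : c.IsDegenerate) :
    ∃ (y : Simplices X.obj) (g : bead c.1 ⟶ bead y.1), c.1 = y.1 + 1 ∧
      bcell c = (bcell y).pull (necklaceCube.map g) := by
  obtain ⟨n, i, y, rfl⟩ := Simplices.isDegenerate_cases h
  refine ⟨⟨n, y⟩, beadDegen i.is_le, rfl, ?_⟩
  have : SimplexCategory.σ i = Simplices.vertexMap (n + 1) n (merge i) := by
    refine Simplices.map_toOrderHom_ext fun t => ?_
    change (Fin.predAbove i t : ℕ) = min (if (t : ℕ) ≤ i then (t : ℕ) else t - 1) n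
    simp only [Fin.predAbove, Fin.lt_def, Fin.val_castSucc]
    split_ifs <;> simp <;> omega
  rw [this]
  exact (congrArg ncell (beadMap_pull ⟨n, y⟩ (beadDegen i.is_le) fun _ _ => rfl)).trans
    (ncell_map _ _)

/-- The beads `[1]` and `[0]` both have the point as their cube, so the codegeneracy between them
does nothing to cells. This is why edges need the correction by `1` in the comparison map. -/
lemma bcell_degenerate_one {c : Simplices X.obj} (h : c.IsDegenerate) (h1 : c.1 = 1) :
    bcell c = 1 := by
  obtain ⟨y, g, hy, e⟩ := exists_bcell_degenerate h
  rw [e, ← bcell_of_zero y (by omega)]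
  have hd : (bead y.1).dim = 0 := by rw [bead_dim]; omega
  refine Cells.pull_eq_self _ ?_ fun x i hi => ?_
  · change (bead c.1).dim = (bead y.1).dim
    rw [bead_dim, bead_dim]
    omega
  · change i < (bead y.1).dim at hi
    omega

/-- From dimension `2` on a codegeneracy lowers the dimension of the cube, so it cannot have full
rank. -/
lemma bcell_degenerate {c : Simplices X.obj} (h : c.IsDegenerate) (h1 : 2 ≤ c.1) :
    (bcell c).IsDegenerate := by
  obtain ⟨y, g, hy, e⟩ := exists_bcell_degenerate h
  rw [e]
  refine Cells.isDegenerate_pull _ _ ?_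
  refine (Finset.card_le_univ _).trans_lt ?_
  rw [Fintype.card_fin]
  change (bead y.1).dim < (bead c.1).dim
  rw [bead_dim, bead_dim]
  omega

/-! ### The faces of the cube of a bead -/

lemma mem_vset_bead {n v : ℕ} {x : Fin (bead n).dim → Bool} :
    v ∈ (bead n).vset x ↔ v = 0 ∨ v = n ∨ 0 < v ∧ v < n ∧ bit x (v - 1) = true := by
  rw [mem_vset, verts, Set.mem_ofPred_eq, mem_bead_joints, or_assoc]
  simp only [bead_vertex]
  refine or_congr Iff.rfl (or_congr Iff.rfl ⟨?_, ?_⟩)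
  · rintro ⟨a, ha, rfl⟩
    have := a.2.trans_eq (bead_dim n)
    refine ⟨by omega, by omega, ?_⟩
    rw [Nat.add_sub_cancel, bit_val, ha]
  · rintro ⟨h0, h1, h⟩
    have hv : v - 1 < (bead n).dim := by rw [bead_dim]; omega
    refine ⟨⟨v - 1, hv⟩, ?_, by simp; omega⟩
    exact (bit_val x ⟨v - 1, hv⟩).symm.trans h

/-- This lemma and the next find the extreme vertices of a face. The value `ε = 1` makes the inner
vertex `i + 1` a joint, and `ε = 0` removes it. -/
lemma mem_vset_faceN_false {n i v : ℕ} (hi : i + 1 < n) (ε : Bool) :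
    v ∈ (bead n).vset ((Cube.faceN (necklaceCube.obj (bead n)) i ε).1 fun _ => false) ↔
      v = 0 ∨ v = n ∨ v = i + 1 ∧ ε = true := by
  have hi' : i < (necklaceCube.obj (bead n)).dim := by
    change i < (bead n).dim
    rw [bead_dim]
    omega
  have hd : (necklaceCube.obj (bead n)).dim = n - 1 := bead_dim n
  refine (mem_vset_bead (n := n)).trans ?_
  have h := Cube.bit_faceN _ hi' ε (fun _ => false) (v - 1)
  have hb (l : ℕ) : bit (fun _ : Fin (Cube.mk ((necklaceCube.obj (bead n)).dim - 1)).dim => false) l =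
      false := by
    simp [bit, hd]
  rw [hb, hb] at h
  refine (or_congr Iff.rfl (or_congr Iff.rfl (and_congr Iff.rfl (and_congr Iff.rfl
    (Eq.congr_left h))))).trans ?_
  rw [hd]
  grind

lemma mem_vset_faceN_true {n i v : ℕ} (hi : i + 1 < n) (ε : Bool) :
    v ∈ (bead n).vset ((Cube.faceN (necklaceCube.obj (bead n)) i ε).1 fun _ => true) ↔
      v ≤ n ∧ (v = i + 1 → ε = true) := by
  have hi' : i < (necklaceCube.obj (bead n)).dim := by
    change i < (bead n).dim
    rw [bead_dim]
    omega
  have hd : (necklaceCube.obj (bead n)).dim = n - 1 := bead_dim n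
  refine (mem_vset_bead (n := n)).trans ?_
  have h := Cube.bit_faceN _ hi' ε (fun _ => true) (v - 1)
  have hb (l : ℕ) : bit (fun _ : Fin (Cube.mk ((necklaceCube.obj (bead n)).dim - 1)).dim => true) l =
      decide (l < n - 1 - 1) := by
    simp [bit, hd]
  rw [hb, hb] at h
  refine (or_congr Iff.rfl (or_congr Iff.rfl (and_congr Iff.rfl (and_congr Iff.rfl
    (Eq.congr_left h))))).trans ?_
  rw [hd]
  grind

/-- A face moves all inner vertices but `i + 1`, so it has full rank and `pull_ncell_eq` applies. -/
lemma card_moving_faceN {n i : ℕ} (hi : i + 1 < n) (ε : Bool) :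
    (moving (Cube.faceN (necklaceCube.obj (bead n)) i ε).1).card = (bead n).dim - 1 := by
  have : (bead n).vset ((Cube.faceN (necklaceCube.obj (bead n)) i ε).1 fun _ => true) \
      (bead n).vset ((Cube.faceN (necklaceCube.obj (bead n)) i ε).1 fun _ => false) =
        (Finset.Ioo 0 n).erase (i + 1) := by
    ext v
    rw [Finset.mem_sdiff, mem_vset_faceN_true hi, mem_vset_faceN_false hi, Finset.mem_erase,
      Finset.mem_Ioo]
    grind
  refine (card_moving (T := bead n) _).trans ?_
  rw [this, Finset.card_erase_of_mem (Finset.mem_Ioo.2 ⟨by omega, hi⟩), bead_dim, Nat.card_Ioo,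
    Nat.sub_zero]

/-- The vertices left over are the image of the inner coface, and no joint is added. These faces
give the inner part of the simplicial boundary. -/
lemma bcell_dface_false (c : Simplices X.obj) {i : ℕ} (h : i + 1 < c.1) :
    (bcell c).dface i false = bcell (c.dface (i + 1)) := by
  refine .trans ?_ (congrArg ncell (beadMap_dface c (Nat.succ_pos i) h)).symm
  refine pull_ncell_eq (beadFace c.1 (Nat.succ_pos i) h) (beadMap c) _ ?_ (card_moving_faceN h _)
    (Finset.ext fun v => ?_) (Finset.ext fun v => ?_)
  · change (bead c.1).dim - 1 = (bead (c.1 - 1)).dim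
    rw [bead_dim, bead_dim]
  · refine (mem_vset_faceN_false h false).trans ?_
    simp only [Finset.mem_image, mem_bead_joints]
    simp only [beadFace, Simplices.skip_apply]
    grind
  · refine (mem_vset_faceN_true h false).trans ?_
    rw [Finset.mem_image]
    simp only [Finset.mem_range]
    simp only [beadFace, Simplices.skip_apply, bead]
    constructor
    · rintro ⟨h1, h2⟩
      have h2 : v ≠ i + 1 := fun h => by simpa using h2 h
      by_cases h3 : v < i + 1
      · exact ⟨v, by omega, if_pos h3⟩
      · exact ⟨v - 1, by omega, by rw [if_neg] <;> omega⟩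
    · rintro ⟨a, ha, rfl⟩
      split_ifs <;> omega

/-- The vertex `i + 1` has become a joint, so the face is the cube of `[i + 1] ∨ [n - i - 1]`. These
faces give the Alexander–Whitney part of the cobar differential. -/
lemma bcell_dface_true (c : Simplices X.obj) {i : ℕ} (h : i + 1 < c.1) :
    (bcell c).dface i true = bcell (c.seg 0 (i + 1)) * bcell (c.seg (i + 1) c.1) := by
  refine .trans ?_ (ncell_glue (beadMap (c.seg 0 (i + 1))) (beadMap (c.seg (i + 1) c.1)))
  refine .trans ?_ (congrArg ncell (glue_beadMap_seg c h.le)).symm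
  refine pull_ncell_eq (beadSplit c.1 h.le) (beadMap c) _ ?_ (card_moving_faceN h _)
    (Finset.ext fun v => ?_) (Finset.ext fun v => ?_)
  · change (bead c.1).dim - 1 = (wedge (bead (i + 1)) (bead (c.1 - (i + 1)))).dim
    rw [dim_wedge, bead_dim, bead_dim, bead_dim]
    omega
  · refine (mem_vset_faceN_false h true).trans ?_
    change _ ↔ v ∈ ((wedge _ _).joints.image fun v => v)
    rw [Finset.image_id', mem_wedge_joints]
    simp only [mem_bead_joints]
    simp only [bead, and_true]
    constructor
    · rintro (rfl | rfl | rfl)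
      · exact Or.inl (Or.inl rfl)
      · exact Or.inr ⟨c.1 - (i + 1), Or.inr rfl, by omega⟩
      · exact Or.inl (Or.inr rfl)
    · rintro ((rfl | rfl) | ⟨a, rfl | rfl, rfl⟩) <;> omega
  · refine (mem_vset_faceN_true h true).trans ?_
    change _ ↔ v ∈ ((Finset.range (i + 1 + (c.1 - (i + 1)) + 1)).image fun v => v)
    rw [Finset.image_id', Finset.mem_range]
    simp only [implies_true, and_true]
    omega

end

section

/-! ### The comparison map -/

open Necklace CoaugDGCoalg

variable {k : Type v} [CommRing k] {X : ReducedSSet.{u}}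

variable (k) in
/-- The image of the generator `s⁻¹c` under the comparison map. -/
def genImage (c : Simplices X.obj) : CChains k (ccobar.obj X) :=
  -- Subtracting the unit in dimensions `0` and `1` makes the value vanish on the point, as the
  -- cokernel of the coaugmentation requires, and on the degenerate edge, as normalization requires.
  ccell k (bcell c) - if c.1 ≤ 1 then 1 else 0

lemma genImage_zero {c : Simplices X.obj} (h : c.1 = 0) : genImage k c = 0 := by
  rw [genImage, bcell_of_zero c h, ccell_one, if_pos (by omega), sub_self]

/-- Degenerate simplices vanish for two reasons: an edge because its cell is the unit that is
subtracted, a higher simplex because its cell is degenerate. -/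
lemma genImage_degenerate (c : Simplices X.obj) (h : c.IsDegenerate) : genImage k c = 0 := by
  rcases Nat.lt_trichotomy c.1 1 with h1 | h1 | h1
  · exact genImage_zero (by omega)
  · rw [genImage, bcell_degenerate_one h h1, ccell_one, if_pos (by omega), sub_self]
  · rw [genImage, ccell_degenerate (bcell_degenerate h h1), if_neg (by omega), sub_self]

lemma genImage_mem (c : Simplices X.obj) :
    genImage k c ∈ cchainsGrading k (ccobar.obj X) ((c.1 : ℤ) - 1) := by
  -- The dimension of `bcell c` is the truncated difference `c.1 - 1`, which is the expected degree
  -- only for `c.1 > 0`. For the point the element is zero, so its degree does not matter.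
  by_cases h0 : c.1 = 0
  · rw [genImage_zero h0]
    exact zero_mem _
  · have hd : ((bcell c).dim : ℤ) = (c.1 : ℤ) - 1 := by
      rw [dim_bcell]
      omega
    refine sub_mem (hd ▸ ccell_mem (bcell c)) ?_
    split_ifs with h
    · have h1 : c.1 = 1 := by omega
      rw [h1]
      exact ((cubicalChains k).obj (ccobar.obj X)).one_mem
    · exact zero_mem _

variable (k X) in
/-- The comparison map on chains. -/
def chainsImage : SChains k X.obj →ₗ[k] CChains k (ccobar.obj X) :=
  schainsLift (genImage k) genImage_degenerate

lemma chainsImage_scell (c : Simplices X.obj) : chainsImage k X (scell k c) = genImage k c :=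
  schainsLift_scell _ _ _

variable (k X) in
/-- The comparison map from the cobar construction of the chains to the chains of the cubical cobar
construction. -/
def comparison : TensorAlgebra k (X.awObj k).Bar →ₐ[k] CChains k (ccobar.obj X) :=
  TensorAlgebra.lift k (Submodule.liftQ _ (chainsImage k X) (by
    rintro _ ⟨a, rfl⟩
    change chainsImage k X (a • scell k X.pt) = 0
    rw [map_smul, chainsImage_scell, genImage_zero rfl, smul_zero]))

lemma comparison_desusp (x : SChains k X.obj) :
    comparison k X ((X.awObj k).desusp x) = chainsImage k X x :=
  TensorAlgebra.lift_ι_apply _ _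

lemma comparison_desusp_scell (c : Simplices X.obj) :
    comparison k X ((X.awObj k).desusp (scell k c)) = genImage k c :=
  (comparison_desusp _).trans (chainsImage_scell c)

lemma comparison_mem {n : ℤ} {x : TensorAlgebra k (X.awObj k).Bar}
    (hx : x ∈ wordGrading (X.awObj k).barGrading n) :
    comparison k X x ∈ cchainsGrading k (ccobar.obj X) n := by
  induction hx using Submodule.span_induction with
  | mem x hx =>
    induction hx with
    | one =>
      rw [map_one]
      exact ((cubicalChains k).obj (ccobar.obj X)).one_mem
    | @cons p q v x hv hx ih =>
      obtain ⟨c, hc, rfl⟩ := hv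
      rw [map_mul]
      refine ((cubicalChains k).obj (ccobar.obj X)).mul_mem ?_ ih
      have h := schainsGrading_induction
        (N := (cchainsGrading k (ccobar.obj X) (p - 1)).comap (chainsImage k X)) (by
          rintro c rfl
          rw [Submodule.mem_comap, chainsImage_scell]
          exact genImage_mem c) hc
      exact (comparison_desusp c).symm ▸ h
  | zero => rw [map_zero]; exact zero_mem _
  | add x y _ _ h1 h2 => rw [map_add]; exact add_mem h1 h2
  | smul a x _ h1 => rw [map_smul]; exact Submodule.smul_mem _ _ h1

lemma CoaugDGCoalg.desusp_sign (C : CoaugDGCoalg k) {n : ℤ} {x : C.carrier}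
    (hx : x ∈ C.grading n) : C.desusp (C.sign x) = (n.negOnePow : ℤ) • C.desusp x := by
  rw [signInv_of_mem C.isInternal hx, map_zsmul]

/-- The Koszul sign is that of the degree of the front face, which is `i`. -/
lemma quadPart_scell (c : Simplices X.obj) : (X.awObj k).quadPart (scell k c) =
    ∑ i ∈ Finset.range (c.1 + 1), ((-1 : ℤ) ^ i) •
      ((X.awObj k).desusp (scell k (c.seg 0 i)) * (X.awObj k).desusp (scell k (c.seg i c.1))) := by
  have h : Coalgebra.comul (R := k) (A := (X.awObj k).carrier) (scell k c) = _ := comul_scell c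
  let F := LinearMap.mul' k _ ∘ₗ TensorProduct.map ((X.awObj k).desusp ∘ₗ (X.awObj k).sign)
    (X.awObj k).desusp
  refine (congrArg F h).trans ((map_sum F _ _).trans (Finset.sum_congr rfl fun i _ => ?_))
  refine (congrArg (· * (X.awObj k).desusp (scell k (c.seg i c.1)))
    ((X.awObj k).desusp_sign (scell_mem k (c.seg 0 i)))).trans ?_
  have hi : (((c.seg 0 i).1 : ℤ).negOnePow : ℤ) = (-1) ^ i := by
    simp [Simplices.seg, Simplices.pull, Int.negOnePow_def]
  simp only [hi, smul_mul_assoc]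

/-- With `n` the dimension of `c`, the cubical faces in direction `i` match, signs included, the
simplicial face `i + 1` and the splitting at `i + 1`. There remain the faces `0` and `n` of the
simplicial boundary. They are cancelled by the units in `(x - 1) y` and `x (y - 1)`, the terms in
which the front or the back part is an edge, because face `0` is the back part of the splitting at
`1` and face `n` is the front part of the splitting at `n - 1`. -/
lemma comparison_d_gen (c : Simplices X.obj) : cd k (ccobar.obj X) (genImage k c) =
    comparison k X (-(X.awObj k).desusp (sd k X.obj (scell k c)) +
      (X.awObj k).quadPart (scell k c)) := by
  have h1 : cd k (ccobar.obj X) 1 = 0 := by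
    rw [← ccell_one, cd_ccell]
    rfl
  have hl : cd k (ccobar.obj X) (genImage k c) = ∑ i ∈ Finset.range (c.1 - 1),
      ((-1 : ℤ) ^ (i + 1)) • (ccell k (bcell (c.seg 0 (i + 1))) *
        ccell k (bcell (c.seg (i + 1) c.1)) - ccell k (bcell (c.dface (i + 1)))) := by
    rw [genImage, map_sub, cd_ccell, dim_bcell]
    have : cd k (ccobar.obj X) (if c.1 ≤ 1 then 1 else 0) = 0 := by
      split_ifs
      exacts [h1, map_zero _]
    rw [this, sub_zero]
    refine Finset.sum_congr rfl fun i hi => ?_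
    have hi := Finset.mem_range.1 hi
    rw [bcell_dface_true c (by omega), bcell_dface_false c (by omega), ccell_mul]
  have hr : comparison k X (-(X.awObj k).desusp (sd k X.obj (scell k c)) +
      (X.awObj k).quadPart (scell k c)) = -(if c.1 = 0 then 0 else
        ∑ i ∈ Finset.range (c.1 + 1), ((-1 : ℤ) ^ i) • genImage k (c.dface i)) +
        ∑ i ∈ Finset.range (c.1 + 1), ((-1 : ℤ) ^ i) •
          (genImage k (c.seg 0 i) * genImage k (c.seg i c.1)) := by
    rw [map_add, map_neg, comparison_desusp, sd_scell, quadPart_scell, map_sum]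
    congr 2
    · split_ifs
      · exact map_zero _
      · simp only [map_sum, map_zsmul, chainsImage_scell]
    · funext i
      rw [map_zsmul, map_mul, comparison_desusp_scell, comparison_desusp_scell]
  rw [hl, hr]
  have hs0 (i : ℕ) : (c.seg 0 i).1 = i := Nat.sub_zero i
  have hs1 (i : ℕ) : (c.seg i c.1).1 = c.1 - i := rfl
  have hd (i : ℕ) : (c.dface i).1 = c.1 - 1 := rfl
  -- Below dimension `2` there are no inner vertices, and each term on the cobar side contains the
  -- image of a point, which is `0`.
  obtain hn | hn | ⟨m, hn⟩ : c.1 = 0 ∨ c.1 = 1 ∨ ∃ m, c.1 = m + 2 := by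
    rcases hn : c.1 with _ | _ | m
    exacts [Or.inl rfl, Or.inr (Or.inl rfl), Or.inr (Or.inr ⟨m, rfl⟩)]
  · simp [hn, genImage_zero (hs0 0)]
  · have h2 : genImage k (c.dface 0) = 0 := genImage_zero (by rw [hd, hn])
    have h3 : genImage k (c.dface 1) = 0 := genImage_zero (by rw [hd, hn])
    have h4 : genImage k (c.seg 1 1) = 0 := by
      have := genImage_zero (k := k) (c := c.seg 1 c.1) (by rw [hs1, hn])
      rwa [hn] at this
    simp [hn, Finset.sum_range_succ, genImage_zero (hs0 0), h2, h3, h4]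
  · have hf : c.dface 0 = c.seg 1 c.1 := by
      have := c.dface_seg_first (j := 0) (by omega)
      rwa [Simplices.seg_self] at this
    have hb : c.dface c.1 = c.seg 0 (m + 1) := by
      have := c.dface_seg_last (j := m + 1) (by omega)
      rwa [show m + 1 + 1 = c.1 by omega, Simplices.seg_self] at this
    have e0 : genImage k (c.seg 0 0) = 0 := genImage_zero (hs0 0)
    have en : genImage k (c.seg c.1 c.1) = 0 := genImage_zero (by rw [hs1, Nat.sub_self])
    rw [if_neg (by omega)]
    -- Separates the two outer indices. They give the outer faces in the boundary, and in the
    -- coproduct the terms with a point as a factor, which vanish.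
    have split (F : ℕ → CChains k (ccobar.obj X)) : ∑ i ∈ Finset.range (c.1 + 1), F i =
        F 0 + ∑ i ∈ Finset.range (m + 1), F (i + 1) + F c.1 := by
      rw [Finset.sum_range_succ, hn, Finset.sum_range_succ']
      abel
    rw [split, split, e0, en, zero_mul, mul_zero, smul_zero, smul_zero, zero_add, add_zero,
      hf, hb, show c.1 - 1 = m + 1 by omega]
    -- Dimension `2` is special: the only inner splitting consists of two edges, so both corrections
    -- occur in one product `(x - 1)(y - 1)`, and all three faces are edges and carry a unit too.
    obtain _ | m := m
    · have h2 : c.1 - 1 = 1 := by omega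
      simp only [Finset.sum_range_one, Nat.zero_add, genImage, hs0, hs1, hd, h2, le_refl, if_true]
      rw [hn]
      simp only [mul_sub, sub_mul, mul_one, one_mul, smul_sub, pow_zero, pow_one, neg_smul, one_smul,
        zero_add, sq, neg_mul, neg_neg]
      abel
    -- Now `c` has dimension `m + 3`, its faces have dimension at least `2`, and the front edge (`i
    -- = 0`) and the back edge (`i = m + 1`) occur at different indices. Each of these indices
    -- leaves one extra term, which is an outer face with its sign.
    · have hg (i : ℕ) (hi : i ∈ Finset.range (m + 1 + 1)) :
          ((-1 : ℤ) ^ (i + 1)) • (genImage k (c.seg 0 (i + 1)) * genImage k (c.seg (i + 1) c.1)) =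
          ((-1 : ℤ) ^ (i + 1)) • (ccell k (bcell (c.seg 0 (i + 1))) *
            ccell k (bcell (c.seg (i + 1) c.1)) - ccell k (bcell (c.dface (i + 1)))) +
          ((-1 : ℤ) ^ (i + 1)) • genImage k (c.dface (i + 1)) +
          ((if i = 0 then genImage k (c.seg 1 c.1) else 0) +
            if i = m + 1 then ((-1 : ℤ) ^ c.1) • genImage k (c.seg 0 (m + 1 + 1)) else 0) := by
        have hi := Finset.mem_range.1 hi
        have h1 : ¬ c.1 - 1 ≤ 1 := by omega
        simp only [genImage, hs0, hs1, hd, h1, if_false, sub_zero, smul_sub]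
        rcases Nat.eq_zero_or_pos i with rfl | h0
        · simp [h1]
          simp only [sub_mul, one_mul]
          abel
        · have h2 : ¬ i + 1 ≤ 1 := by omega
          have h3 : i ≠ 0 := by omega
          rcases Nat.lt_or_ge i (m + 1) with h5 | h5
          · have h6 : ¬ c.1 - (i + 1) ≤ 1 := by omega
            simp only [h2, h3, h5.ne, h6, if_false, sub_zero, add_zero]
            abel
          · obtain rfl : i = m + 1 := by omega
            have h6 : c.1 - (m + 1 + 1) ≤ 1 := by omega
            have h7 : (-1 : ℤ) ^ c.1 = -(-1) ^ (m + 1 + 1) := by rw [hn, pow_succ]; ring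
            simp only [h2, h3, h6, h7, if_false, if_true, sub_zero, mul_sub, mul_one, smul_sub,
              neg_smul]
            abel_nf
      rw [Finset.sum_congr rfl hg, Finset.sum_add_distrib, Finset.sum_add_distrib,
        Finset.sum_add_distrib, Finset.sum_ite_eq', Finset.sum_ite_eq', if_pos (by simp),
        if_pos (by simp), pow_zero, one_smul]
      abel

/-- Both differentials satisfy the graded Leibniz rule, so induction on words reduces the claim to
generators. The signs agree because the comparison map preserves degrees. -/
lemma comparison_d (x : TensorAlgebra k (X.awObj k).Bar) :
    comparison k X ((X.awObj k).cobarD x) = cd k (ccobar.obj X) (comparison k X x) := by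
  have hgen (c : (X.awObj k).carrier) : comparison k X ((X.awObj k).cobarD ((X.awObj k).desusp c)) =
      cd k (ccobar.obj X) (comparison k X ((X.awObj k).desusp c)) := by
    suffices (comparison k X).toLinearMap ∘ₗ (X.awObj k).cobarD ∘ₗ (X.awObj k).desusp =
        cd k (ccobar.obj X) ∘ₗ (comparison k X).toLinearMap ∘ₗ (X.awObj k).desusp from
      LinearMap.congr_fun this c
    refine schains_ext fun c => ?_
    refine (congrArg (comparison k X) ((X.awObj k).cobarD_desusp (scell k c))).trans ?_
    refine (comparison_d_gen c).symm.trans ?_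
    exact congrArg (cd k (ccobar.obj X)) (comparison_desusp_scell c).symm
  suffices (comparison k X).toLinearMap ∘ₗ (X.awObj k).cobarD =
      cd k (ccobar.obj X) ∘ₗ (comparison k X).toLinearMap from LinearMap.congr_fun this x
  refine graded_ext (isInternal_wordGrading (X.awObj k).isInternal_barGrading) fun n x hx => ?_
  simp only [LinearMap.comp_apply, AlgHom.toLinearMap_apply]
  induction hx using Submodule.span_induction with
  | mem x hx =>
    induction hx with
    | one =>
      rw [map_one (comparison k X), ← ccell_one, cd_ccell, cobarD, derivExt_one, map_zero]
      rfl
    | @cons p q v x hv hx ih =>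
      obtain ⟨c, hc, rfl⟩ := hv
      have hw := (X.awObj k).desusp_mem hc
      change comparison k X ((X.awObj k).cobarD ((X.awObj k).desusp c * x)) =
        cd k (ccobar.obj X) (comparison k X ((X.awObj k).desusp c * x))
      rw [cobarD_mul, wordSign_of_mem _ hw, map_add, map_mul, map_mul, map_mul, ih, hgen, map_zsmul,
        cleibniz _ (comparison_mem hw), smul_mul_assoc]
  | zero => simp
  | add x y _ _ h1 h2 => simp only [map_add, h1, h2]
  | smul a x _ h1 => simp only [map_smul, h1]

variable (k X) in
/-- The comparison map as a morphism of differential graded algebras. -/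
def comparisonHom : (X.awObj k).cobarObj ⟶ (cubicalChains k).obj (ccobar.obj X) :=
  DGAlg.Hom.mk (A := (X.awObj k).cobarObj) (B := (cubicalChains k).obj (ccobar.obj X))
    (comparison k X) comparison_mem comparison_d

/-- It suffices to look at generators, where the correction depends only on the dimension, which
simplicial maps preserve. -/
lemma comparison_naturality {Y : ReducedSSet.{u}} (f : X ⟶ Y)
    (x : TensorAlgebra k (X.awObj k).Bar) :
    comparison k Y (cobarMap ((awChains k).map f) x) =
      cchainsMap k (ccobar.map f) (comparison k X x) := by
  suffices (comparison k Y).comp (cobarMap ((awChains k).map f)) =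
    (cchainsMap k (ccobar.map f)).comp (comparison k X) from DFunLike.congr_fun this x
  apply TensorAlgebra.hom_ext
  apply Submodule.linearMap_qext
  refine schains_ext fun c => ?_
  refine (congrArg (comparison k Y) (cobarMap_desusp ((awChains k).map f) (scell k c))).trans ?_
  refine .trans ?_ (congrArg (cchainsMap k (ccobar.map f)) (comparison_desusp_scell c)).symm
  refine (congrArg (fun z => comparison k Y ((Y.awObj k).desusp z))
    (schainsMap_scell k f.hom c)).trans ?_
  refine (comparison_desusp_scell _).trans ?_
  rw [genImage, genImage, map_sub, cchainsMap_ccell, bcell_map, apply_ite (cchainsMap k _), map_one,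
    map_zero]
  rfl

end

section

/-! ### Surjectivity of the comparison map -/

namespace Necklace

/-- A necklace is the concatenation of the two parts into which a joint cuts it. -/
lemma exists_eq_wedge {T : Necklace} {j : ℕ} (hj : j ∈ T.joints) :
    ∃ S S' : Necklace, T = wedge S S' ∧ S.len = j := by
  have hl := T.le_len hj
  refine ⟨⟨j, T.joints.filter (· ≤ j), by simp [T.zero_mem], by simp [hj], by simp⟩,
    ⟨T.len - j, (T.joints.filter (j ≤ ·)).image (· - j), ?_, ?_, ?_⟩, ?_, rfl⟩
  · exact Finset.mem_image.2 ⟨j, by simp [hj], Nat.sub_self j⟩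
  · exact Finset.mem_image.2 ⟨T.len, by simp [T.len_mem, hl], rfl⟩
  · intro i hi
    obtain ⟨l, hl, rfl⟩ := Finset.mem_image.1 hi
    exact Nat.sub_le_sub_right (T.le_len (Finset.mem_filter.1 hl).1) _
  · ext i
    · change T.len = j + (T.len - j)
      omega
    · rw [mem_wedge_joints]
      simp only [Finset.mem_filter, Finset.mem_image]
      constructor
      · intro hi
        rcases Nat.le_total i j with h | h
        · exact Or.inl ⟨hi, h⟩
        · exact Or.inr ⟨_, ⟨i, ⟨hi, h⟩, rfl⟩, by omega⟩
      · rintro (⟨hi, -⟩ | ⟨_, ⟨l, ⟨hl, h⟩, rfl⟩, rfl⟩)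
        · exact hi
        · rwa [Nat.add_sub_cancel' h]

/-- A face of the cube of a necklace is the cube of another necklace. -/
lemma exists_subnecklace {T : Necklace} {V W : Finset ℕ} (hV : T.joints ⊆ V) (hW : V ⊆ W)
    (hT : ∀ v ∈ W, v ≤ T.len) : ∃ (S : Necklace) (g : S ⟶ T), S.dim = (W \ V).card ∧
      V = S.joints.image g.toFun ∧ W = (Finset.range (S.len + 1)).image g.toFun := by
  have h0 : 0 ∈ W := hW (hV T.zero_mem)
  have hl : T.len ∈ W := hW (hV T.len_mem)
  obtain ⟨n, hn⟩ : ∃ n, W.card = n + 1 := ⟨W.card - 1, by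
    have := Finset.card_pos.2 ⟨0, h0⟩
    omega⟩
  let e := W.orderEmbOfFin hn
  have he (a) : e a ∈ W := Finset.orderEmbOfFin_mem _ _ _
  have hex {v} (hv : v ∈ W) : ∃ a, e a = v := by
    have : v ∈ Set.range e := by simpa [e] using hv
    exact this
  -- `φ` enumerates `W` in increasing order; past `n` it goes on by translation, as the encoding of
  -- morphisms of necklaces demands.
  let φ (v : ℕ) : ℕ := if h : v < n + 1 then e ⟨v, h⟩ else T.len + (v - n)
  have hφ (a : Fin (n + 1)) : φ a = e a := dif_pos a.2
  have e0 : e 0 = 0 := by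
    obtain ⟨a, ha⟩ := hex h0
    exact Nat.le_zero.1 ((e.monotone (Fin.zero_le a)).trans_eq ha)
  have el : e (Fin.last n) = T.len := by
    obtain ⟨a, ha⟩ := hex hl
    exact le_antisymm (hT _ (he _)) (ha.symm.trans_le (e.monotone (Fin.le_last a)))
  have hmono : Monotone φ := by
    intro a b hab
    by_cases hb : b < n + 1
    · have ha : a < n + 1 := by omega
      rw [hφ ⟨a, ha⟩, hφ ⟨b, hb⟩]
      exact e.monotone hab
    · have h1 : φ b = T.len + (b - n) := dif_neg hb
      by_cases ha : a < n + 1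
      · rw [hφ ⟨a, ha⟩, h1]
        exact (hT _ (he _)).trans (Nat.le_add_right _ _)
      · have h2 : φ a = T.len + (a - n) := dif_neg ha
        rw [h1, h2]
        omega
  have hinj : Set.InjOn φ (Finset.range (n + 1)) := by
    intro a ha b hb hab
    simp only [Finset.coe_range, Set.mem_Iio] at ha hb
    rw [hφ ⟨a, ha⟩, hφ ⟨b, hb⟩] at hab
    simpa using e.injective hab
  have hφn : φ n = T.len := (hφ (Fin.last n)).trans el
  have hφ0 : φ 0 = 0 := (hφ 0).trans e0
  have hWim : W = (Finset.range (n + 1)).image φ := by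
    ext v
    rw [Finset.mem_image]
    constructor
    · intro hv
      obtain ⟨a, rfl⟩ := hex hv
      exact ⟨a, Finset.mem_range.2 a.2, hφ a⟩
    · rintro ⟨a, ha, rfl⟩
      rw [hφ ⟨a, Finset.mem_range.1 ha⟩]
      exact he _
  have hVim : V = ((Finset.range (n + 1)).filter fun v => φ v ∈ V).image φ := by
    ext v
    simp only [Finset.mem_image, Finset.mem_filter]
    constructor
    · intro hv
      obtain ⟨a, ha, rfl⟩ := Finset.mem_image.1 (hWim ▸ hW hv)
      exact ⟨a, ⟨ha, hv⟩, rfl⟩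
    · rintro ⟨a, ⟨-, ha⟩, rfl⟩
      exact ha
  -- The joints of `S` are the vertices that land in `V`. Since `V` contains the joints of `T`, each
  -- of these is hit by a joint of `S`, so `φ` is a morphism.
  let S : Necklace :=
    { len := n
      joints := (Finset.range (n + 1)).filter fun v => φ v ∈ V
      zero_mem := by simp [hφ0, hV T.zero_mem]
      len_mem := by simp [hφn, hV T.len_mem]
      le_len := fun h => by
        have := Finset.mem_range.1 (Finset.mem_filter.1 h).1
        omega }
  refine ⟨S, ⟨φ, hmono, hφ0, fun v => ?_, fun j hj => ?_⟩, ?_, hVim, hWim⟩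
  · change φ (n + v) = T.len + v
    obtain _ | v := v
    · exact hφn
    · have : φ (n + (v + 1)) = T.len + (n + (v + 1) - n) := dif_neg (by omega)
      rw [this]
      omega
  · have := hV hj
    rw [hVim] at this
    exact Finset.mem_image.1 this
  -- Inner vertices of `S` correspond to `W \ V`, injectively, which gives the dimension.
  · have h1 : S.inner.image φ = W \ V := by
      ext v
      rw [Finset.mem_image, Finset.mem_sdiff]
      constructor
      · rintro ⟨a, ha, rfl⟩
        obtain ⟨h1, h2⟩ := Finset.mem_sdiff.1 ha
        refine ⟨?_, fun h => h2 (Finset.mem_filter.2 ⟨h1, h⟩)⟩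
        rw [hWim]
        exact Finset.mem_image_of_mem _ h1
      · rintro ⟨h1, h2⟩
        rw [hWim] at h1
        obtain ⟨a, ha, rfl⟩ := Finset.mem_image.1 h1
        exact ⟨a, Finset.mem_sdiff.2 ⟨ha, fun h => h2 (Finset.mem_filter.1 h).2⟩, rfl⟩
    rw [dim, ← h1, Finset.card_image_of_injOn]
    exact hinj.mono (Finset.coe_subset.2 Finset.sdiff_subset)

end Necklace

open Necklace

/-- The joints of the face of a necklace that is spanned by a map of cubes. -/
def loSet {A : Cube} {T : Necklace} (f : A ⟶ necklaceCube.obj T) : Finset ℕ :=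
  T.vset (f.1 fun _ => false)

/-- The vertices of the face of a necklace that is spanned by a map of cubes. -/
def hiSet {A : Cube} {T : Necklace} (f : A ⟶ necklaceCube.obj T) : Finset ℕ :=
  T.vset (f.1 fun _ => true)

section

variable {A : Cube} {T : Necklace} (f : A ⟶ necklaceCube.obj T)

lemma joints_subset_loSet : T.joints ⊆ loSet f := joints_subset_vset T _

/-- Monotonicity of the map of cubes, taken from its normal form. -/
lemma loSet_subset_hiSet : loSet f ⊆ hiSet f := by
  intro v hv
  rcases mem_vset.1 hv with hv | ⟨b, hb, rfl⟩
  · exact mem_vset.2 (Or.inl hv)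
  · refine mem_vset.2 (Or.inr ⟨b, ?_, rfl⟩)
    obtain ⟨R, d, hR⟩ := f.2.exists_nf
    exact (hR.eq_true_iff _ b).2 (((hR.eq_true_iff _ b).1 hb).imp id fun ⟨a, ha, _⟩ => ⟨a, ha, rfl⟩)

lemma le_len_of_mem_hiSet {v : ℕ} (hv : v ∈ hiSet f) : v ≤ T.len := verts_le (mem_vset.1 hv)

lemma card_moving_eq : (moving f.1).card = (hiSet f \ loSet f).card := card_moving (T := T) f.1

lemma loSet_comp {T' : Necklace} (g : T ⟶ T') :
    loSet (f ≫ necklaceCube.map g) = (loSet f).image g.toFun := vset_cubeMap g _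

lemma hiSet_comp {T' : Necklace} (g : T ⟶ T') :
    hiSet (f ≫ necklaceCube.map g) = (hiSet f).image g.toFun := vset_cubeMap g _

end

variable {k : Type v} [CommRing k] {X : ReducedSSet.{u}}

/-- A simplex in the first of two necklaces, as a simplex of the concatenation. -/
def Necklace.Simplex.inl {S T : Necklace} {n : ℕ} (s : S.Simplex n) : (S ⊗ T).Simplex n :=
  ⟨s.1, fun i => (s.2.1 i).trans (Nat.le_add_right _ _), fun j hj => by
    rcases mem_wedge_joints.1 hj with h | ⟨l, -, rfl⟩
    · exact s.2.2 j h
    · exact Or.inl fun i => (s.2.1 i).trans (Nat.le_add_right _ _)⟩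

/-- A simplex in the second of two necklaces, as a simplex of the concatenation. -/
def Necklace.Simplex.inr {S T : Necklace} {n : ℕ} (s : T.Simplex n) : (S ⊗ T).Simplex n :=
  ⟨⟨fun i => S.len + s.1 i, fun _ _ h => Nat.add_le_add_left (s.1.monotone h) _⟩,
    fun i => Nat.add_le_add_left (s.2.1 i) _, fun j hj => by
    rcases mem_wedge_joints.1 hj with h | ⟨l, hl, rfl⟩
    · exact Or.inr fun i => (S.le_len h).trans (Nat.le_add_right _ _)
    · exact (s.2.2 l hl).imp (fun h i => Nat.add_le_add_left (h i) _)
        fun h i => Nat.add_le_add_left (h i) _⟩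

/-- Restrict to the two parts; a simplex of the concatenation lies in one of them, so nothing is
lost. -/
lemma exists_eq_glue {S T : Necklace} (σ : (S ⊗ T).toSSet ⟶ X.obj) :
    ∃ (σl : S.toSSet ⟶ X.obj) (σr : T.toSSet ⟶ X.obj), σ = glue σl σr := by
  refine ⟨⟨fun n => ↾fun s : ULift.{u} (S.Simplex n.unop.len) => napp σ s.down.inl,
      fun n m φ => by ext s; exact napp_comp σ s.down.inl φ.unop⟩,
    ⟨fun n => ↾fun s : ULift.{u} (T.Simplex n.unop.len) => napp σ s.down.inr,
      fun n m φ => by ext s; exact napp_comp σ s.down.inr φ.unop⟩, nhom_ext fun n s => ?_⟩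
  rcases le_or_ge_len s with h | h
  · rw [glue_left _ _ _ h]
    refine congrArg (napp σ) (Simplex.ext fun i => ?_)
    exact (min_eq_left (h i)).symm
  · rw [glue_right _ _ _ h]
    refine congrArg (napp σ) (Simplex.ext fun i => ?_)
    exact (Nat.add_sub_cancel' (h i)).symm

/-- Yoneda: the simplex is the value of `σ` at the tautological simplex of `Δ[n]`. -/
lemma exists_eq_beadMap {n : ℕ} (σ : (bead n).toSSet ⟶ X.obj) :
    ∃ x : X.obj.obj (op (SimplexCategory.mk n)), σ = beadMap ⟨n, x⟩ := by
  let ι : (bead n).Simplex n := ⟨⟨fun i => i, fun _ _ h => h⟩, fun i => i.is_le, fun j hj => by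
    rcases mem_bead_joints.1 hj with rfl | rfl
    exacts [Or.inr fun i => Nat.zero_le _, Or.inl fun i => i.is_le]⟩
  refine ⟨napp (n := SimplexCategory.mk n) σ ι, nhom_ext fun m s => ?_⟩
  exact (congrArg (napp σ) (Simplex.ext fun i => rfl)).trans
    (napp_comp (n := SimplexCategory.mk n) σ ι (beadHom s))

lemma ccell_bcell (c : Simplices X.obj) : ccell k (bcell c) =
    comparison k X ((X.awObj k).desusp (scell k c) + if c.1 ≤ 1 then 1 else 0) := by
  rw [map_add, comparison_desusp_scell, genImage, apply_ite (comparison k X), map_one, map_zero]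
  exact (sub_add_cancel _ _).symm

/-- Induction on the length. An inner joint splits the necklace into two shorter ones and the cell
into a product; without inner joints the necklace is a bead, and its cell is the image of a
generator up to the unit. -/
lemma ccell_ncell_mem_range : ∀ (n : ℕ) {T : Necklace} (_ : T.len = n) (σ : T.toSSet ⟶ X.obj),
    ccell k (ncell σ) ∈ (comparison k X).range := by
  intro n
  induction n using Nat.strong_induction_on with
  | h n ih =>
    intro T hT σ
    by_cases h : ∃ j ∈ T.joints, 0 < j ∧ j < T.len
    · obtain ⟨j, hj, h0, h1⟩ := h
      obtain ⟨S, S', rfl, rfl⟩ := exists_eq_wedge hj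
      obtain ⟨σl, σr, rfl⟩ := exists_eq_glue σ
      have hlen : (wedge S S').len = S.len + S'.len := rfl
      have : ccell k (ncell (glue σl σr)) = ccell k (ncell σl) * ccell k (ncell σr) := by
        rw [ncell_glue, ccell_mul]
      exact this ▸ mul_mem (ih _ (by omega) rfl σl) (ih _ (by omega) rfl σr)
    · have e : T = bead T.len := by
        ext j
        · rfl
        · rw [mem_bead_joints]
          constructor
          · intro hj
            by_contra! hc
            exact h ⟨j, hj, by omega, lt_of_le_of_ne (T.le_len hj) hc.2⟩
          · rintro (rfl | rfl)
            exacts [T.zero_mem, T.len_mem]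
      generalize T.len = l at e
      subst e
      obtain ⟨x, rfl⟩ := exists_eq_beadMap σ
      exact ⟨_, (ccell_bcell ⟨l, x⟩).symm⟩

/-- A cell of less than full rank is zero in the chains. A cell of full rank is a face of the cube
of a necklace, hence itself the cell of a map from a necklace. -/
lemma comparison_surjective : Function.Surjective (comparison k X) := by
  have key (c : Cells (ccobar.obj X).toFunctor) : ccell k c ∈ (comparison k X).range := by
    obtain ⟨T, σ, f, hc⟩ := exists_eq_pull_ncell c
    have hle : (moving f.1).card ≤ c.cube.dim := f.2.card_moving_le
    rcases hle.lt_or_eq with h | h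
    · have hdeg := Cells.isDegenerate_pull (ncell σ) f h
      rw [hc, ccell_degenerate hdeg]
      exact zero_mem _
    · obtain ⟨S, g, hS, h0, h1⟩ := exists_subnecklace (joints_subset_loSet f)
        (loSet_subset_hiSet f) fun v => le_len_of_mem_hiSet f
      rw [hc, pull_ncell_eq g σ f (by rw [hS, ← h, card_moving_eq]) h h0 h1]
      exact ccell_ncell_mem_range _ rfl _
  suffices (⊤ : Submodule k (CChains k (ccobar.obj X))) ≤
      LinearMap.range (comparison k X).toLinearMap from fun x => this (Submodule.mem_top (x := x))
  rw [← (isInternal_cchainsGrading k (ccobar.obj X)).submodule_iSup_eq_top]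
  exact iSup_le fun n => cchainsGrading_induction fun c _ => key c

end

section

/-! ### Products along paths -/

section PathProd

variable {A : Type*} [Monoid A]

/-- The product of the elements `F u v` over all pairs `u < v` of consecutive elements of `J` up to a
given element. -/
def pathProd (J : Finset ℕ) (F : ℕ → ℕ → A) (v : ℕ) : A :=
  if h : (J.filter (· < v)).Nonempty then
    pathProd J F ((J.filter (· < v)).max' h) * F ((J.filter (· < v)).max' h) v
  else 1
termination_by v
decreasing_by exact (Finset.mem_filter.1 (Finset.max'_mem _ h)).2

/-- `u < v` are consecutive elements of `J`. -/
structure Consec (J : Finset ℕ) (u v : ℕ) : Prop where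
  left : u ∈ J
  right : v ∈ J
  lt : u < v
  le : ∀ w ∈ J, w < v → w ≤ u

variable {J J' : Finset ℕ} {F F' : ℕ → ℕ → A} {u v : ℕ}

lemma pathProd_of_forall_le (h : ∀ w ∈ J, v ≤ w) : pathProd J F v = 1 := by
  rw [pathProd, dif_neg]
  rintro ⟨w, hw⟩
  obtain ⟨h1, h2⟩ := Finset.mem_filter.1 hw
  exact absurd (h w h1) (not_le.2 h2)

lemma pathProd_consec (h : Consec J u v) : pathProd J F v = pathProd J F u * F u v := by
  have hu : u ∈ J.filter (· < v) := Finset.mem_filter.2 ⟨h.left, h.lt⟩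
  have hm : (J.filter (· < v)).max' ⟨u, hu⟩ = u := by
    refine le_antisymm ?_ (Finset.le_max' _ _ hu)
    obtain ⟨h1, h2⟩ := Finset.mem_filter.1 (Finset.max'_mem _ ⟨u, hu⟩)
    exact h.le _ h1 h2
  rw [pathProd, dif_pos ⟨u, hu⟩, hm]

lemma exists_consec (hv : v ∈ J) (h : ∃ w ∈ J, w < v) : ∃ u, Consec J u v := by
  obtain ⟨w, hw, hwv⟩ := h
  have hne : (J.filter (· < v)).Nonempty := ⟨w, Finset.mem_filter.2 ⟨hw, hwv⟩⟩
  obtain ⟨h1, h2⟩ := Finset.mem_filter.1 (Finset.max'_mem _ hne)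
  exact ⟨_, h1, hv, h2, fun w hw hwv => Finset.le_max' _ _ (Finset.mem_filter.2 ⟨hw, hwv⟩)⟩

/-- Elements between two elements of `J` lie between consecutive elements. -/
lemma exists_consec_between {x : ℕ} (hx : x ∉ J) (h0 : ∃ w ∈ J, w ≤ x) (h1 : ∃ w ∈ J, x ≤ w) :
    ∃ u v, Consec J u v ∧ u < x ∧ x < v := by
  obtain ⟨w, hw, hwx⟩ := h0
  have hne (y) (hy : y ∈ J) : y ≠ x := fun h => hx (h ▸ hy)
  have h1' : (J.filter (x ≤ ·)).Nonempty := by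
    obtain ⟨y, hy, hxy⟩ := h1
    exact ⟨y, Finset.mem_filter.2 ⟨hy, hxy⟩⟩
  obtain ⟨hv, hxv⟩ := Finset.mem_filter.1 (Finset.min'_mem _ h1')
  obtain ⟨u, hu⟩ := exists_consec hv ⟨w, hw, (lt_of_le_of_ne hwx (hne w hw)).trans_le hxv⟩
  refine ⟨u, _, hu, ?_, lt_of_le_of_ne hxv (hne _ hv).symm⟩
  by_contra! hxu
  exact absurd (Finset.min'_le _ _ (Finset.mem_filter.2 ⟨hu.left, hxu⟩)) (not_le.2 hu.lt)

/-- Induction along a finite set of numbers. -/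
lemma consec_induction {P : ℕ → Prop} (h0 : ∀ v ∈ J, (∀ w ∈ J, v ≤ w) → P v)
    (h1 : ∀ u v, Consec J u v → P u → P v) : ∀ v ∈ J, P v := by
  intro v
  induction v using Nat.strong_induction_on with
  | h v ih =>
    intro hv
    by_cases h : ∃ w ∈ J, w < v
    · obtain ⟨u, hu⟩ := exists_consec hv h
      exact h1 u v hu (ih u hu.lt hu.left)
    · exact h0 v hv fun w hw => not_lt.1 fun hlt => h ⟨w, hw, hlt⟩

lemma Consec.image {q : ℕ → ℕ} (hq : Monotone q) (h : Consec J u v) (hne : q u ≠ q v) :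
    Consec (J.image q) (q u) (q v) where
  left := Finset.mem_image_of_mem q h.left
  right := Finset.mem_image_of_mem q h.right
  lt := lt_of_le_of_ne (hq h.lt.le) hne
  le := by
    intro w hw hlt
    obtain ⟨w, hwJ, rfl⟩ := Finset.mem_image.1 hw
    exact hq (h.le w hwJ (not_le.1 fun hle => absurd (hq hle) (not_le.2 hlt)))

/-- Steps that `q` collapses contribute `1`, and the other steps go to steps between consecutive
elements of the image. This is how collapsed beads drop out of the products of weights. -/
lemma pathProd_image {q : ℕ → ℕ} (hq : Monotone q)
    (h : ∀ u v, Consec J u v → F u v = if q u = q v then 1 else F' (q u) (q v)) :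
    ∀ v ∈ J, pathProd J F v = pathProd (J.image q) F' (q v) := by
  refine consec_induction (fun v _ hmin => ?_) fun u v huv ih => ?_
  · rw [pathProd_of_forall_le hmin, pathProd_of_forall_le]
    intro w hw
    obtain ⟨w, hwJ, rfl⟩ := Finset.mem_image.1 hw
    exact hq (hmin w hwJ)
  · rw [pathProd_consec huv, ih, h u v huv]
    split_ifs with he
    · rw [mul_one, he]
    · rw [pathProd_consec (huv.image hq he)]

/-- The product up to `v` only sees elements below `v`, so elements from `w ≥ v` on can be added.
Together with `pathProd_union_shift` this cuts the path of a concatenation at the common joint. -/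
lemma pathProd_congr_union {w : ℕ} (hw : ∀ j ∈ J', w ≤ j)
    (h : ∀ u v, Consec J u v → F u v = F' u v) :
    ∀ v ∈ J, v ≤ w → pathProd J F v = pathProd (J ∪ J') F' v := by
  refine consec_induction (fun v _ hmin hvw => ?_) fun u v huv ih hvw => ?_
  · rw [pathProd_of_forall_le hmin, pathProd_of_forall_le]
    intro y hy
    rcases Finset.mem_union.1 hy with hy | hy
    exacts [hmin y hy, hvw.trans (hw y hy)]
  · rw [pathProd_consec huv, ih (huv.lt.le.trans hvw), h u v huv]
    refine (pathProd_consec ⟨Finset.mem_union_left _ huv.left, Finset.mem_union_left _ huv.right,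
      huv.lt, fun y hy hyv => ?_⟩).symm
    rcases Finset.mem_union.1 hy with hy | hy
    · exact huv.le y hy hyv
    · exact absurd (hw y hy) (by omega)

lemma pathProd_union_shift {n : ℕ} (hJ : ∀ j ∈ J, j ≤ n) (h0 : 0 ∈ J')
    (h : ∀ u v, Consec J' u v → F u v = F' (n + u) (n + v)) :
    ∀ v ∈ J', pathProd (J ∪ J'.image (n + ·)) F' (n + v) =
      pathProd (J ∪ J'.image (n + ·)) F' n * pathProd J' F v := by
  refine consec_induction (fun v _ hmin => ?_) fun u v huv ih => ?_
  · obtain rfl : v = 0 := Nat.le_zero.1 (hmin 0 h0)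
    rw [pathProd_of_forall_le hmin, mul_one, Nat.add_zero]
  · rw [pathProd_consec huv, h u v huv, ← mul_assoc, ← ih]
    refine pathProd_consec ⟨Finset.mem_union_right _ (Finset.mem_image_of_mem _ huv.left),
      Finset.mem_union_right _ (Finset.mem_image_of_mem _ huv.right),
      Nat.add_lt_add_left huv.lt _, fun y hy hyv => ?_⟩
    rcases Finset.mem_union.1 hy with hy | hy
    · exact (hJ y hy).trans (Nat.le_add_right _ _)
    · obtain ⟨y, hyJ, rfl⟩ := Finset.mem_image.1 hy
      exact Nat.add_le_add_left (huv.le y hyJ (by simpa using hyv)) _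

end PathProd

lemma pathProd_eq_zero {A : Type*} [MonoidWithZero A] {J : Finset ℕ} {F : ℕ → ℕ → A} {u v : ℕ}
    (huv : Consec J u v) (h : F u v = 0) : ∀ w ∈ J, v ≤ w → pathProd J F w = 0 := by
  refine consec_induction (fun w _ hmin hvw => ?_) fun x y hxy ih hvy => ?_
  · have := hmin u huv.left
    have := huv.lt
    omega
  · rcases hvy.eq_or_lt with rfl | hlt
    · rw [pathProd_consec huv, h, mul_zero]
    · rw [pathProd_consec hxy, ih (hxy.le v huv.right hlt), zero_mul]

/-! ### The simplices of a necklace -/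

open Necklace

variable {k : Type v} [CommRing k] {X : ReducedSSet.{u}}

/-- If the vertices `i` and `j` of `s` agree, so do all in between. Sending the whole interval to
`i` is then an operator that fixes `s` and is not injective. -/
lemma napp_degenerate {T : Necklace} (σ : T.toSSet ⟶ X.obj) {n : ℕ} (s : T.Simplex n)
    {i j : Fin (n + 1)} (hij : i < j) (h : s.1 i = s.1 j) :
    Simplices.IsDegenerate (X := X.obj) ⟨n, napp (n := SimplexCategory.mk n) σ s⟩ := by
  let φ : SimplexCategory.mk n ⟶ SimplexCategory.mk n :=
    SimplexCategory.mkHom ⟨fun l => if i ≤ l ∧ l ≤ j then i else l, by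
      intro a b hab
      dsimp only
      split_ifs <;> grind⟩
  have hφ (l) : φ.toOrderHom l = if i ≤ l ∧ l ≤ j then i else l := rfl
  have hs : s = s.comp φ.toOrderHom := Simplex.ext fun l => by
    change s.1 l = s.1 (φ.toOrderHom l)
    rw [hφ]
    split_ifs with hl
    · exact le_antisymm ((s.1.monotone hl.2).trans_eq h.symm) (s.1.monotone hl.1)
    · rfl
  have := napp_comp (n := SimplexCategory.mk n) σ s φ
  rw [← hs] at this
  rw [this]
  refine Simplices.isDegenerate_of_not_injective φ _ hij.ne ?_
  rw [hφ, hφ, if_pos ⟨le_rfl, hij.le⟩, if_pos ⟨hij.le, le_rfl⟩]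

/-- `c` is the image of the nondegenerate simplex of the necklace with vertex set `B`. -/
def IsFace {T : Necklace} (σ : T.toSSet ⟶ X.obj) (B : Finset ℕ) (c : Simplices X.obj) : Prop :=
  ∃ (n : ℕ) (s : T.Simplex n), StrictMono s.1 ∧ Finset.univ.image s.1 = B ∧
    c = ⟨n, napp (n := SimplexCategory.mk n) σ s⟩

/-- A strictly increasing sequence is determined by its set of values. -/
lemma IsFace.unique {T : Necklace} {σ : T.toSSet ⟶ X.obj} {B : Finset ℕ} {c c' : Simplices X.obj}
    (h : IsFace σ B c) (h' : IsFace σ B c') : c = c' := by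
  obtain ⟨n, s, hs, hB, rfl⟩ := h
  obtain ⟨n', s', hs', hB', rfl⟩ := h'
  have hc : B.card = n + 1 := by
    rw [← hB, Finset.card_image_of_injective _ hs.injective, Finset.card_fin]
  have hc' : B.card = n' + 1 := by
    rw [← hB', Finset.card_image_of_injective _ hs'.injective, Finset.card_fin]
  obtain rfl : n = n' := by omega
  have : (s.1 : Fin (n + 1) → ℕ) = s'.1 := by
    refine (StrictMono.range_inj hs hs').1 ?_
    have h1 := congrArg (fun B : Finset ℕ => (B : Set ℕ)) (hB.trans hB'.symm)
    simpa using h1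
  rw [Simplex.ext (congrFun this)]

/-- The hypothesis on joints says that `B` lies in one bead, so its increasing enumeration is a
simplex of the necklace. -/
lemma exists_isFace {T : Necklace} (σ : T.toSSet ⟶ X.obj) {B : Finset ℕ} (hne : B.Nonempty)
    (hB : ∀ v ∈ B, v ≤ T.len) (hj : ∀ j ∈ T.joints, (∀ v ∈ B, v ≤ j) ∨ ∀ v ∈ B, j ≤ v) :
    ∃ c, IsFace σ B c ∧ c.1 + 1 = B.card := by
  obtain ⟨n, hn⟩ : ∃ n, B.card = n + 1 := ⟨B.card - 1, by
    have := Finset.card_pos.2 hne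
    omega⟩
  have he (a) : B.orderEmbOfFin hn a ∈ B := Finset.orderEmbOfFin_mem _ _ _
  refine ⟨_, ⟨n, ⟨⟨B.orderEmbOfFin hn, (B.orderEmbOfFin hn).monotone⟩, fun i => hB _ (he i),
    fun j h => (hj j h).imp (fun h i => h _ (he i)) fun h i => h _ (he i)⟩,
    (B.orderEmbOfFin hn).strictMono, ?_, rfl⟩, hn.symm⟩
  exact Finset.image_orderEmbOfFin_univ B hn

end

section

/-! ### Evaluation of cells in the cobar construction -/

open Necklace CoaugDGCoalg

variable {k : Type v} [CommRing k] {X : ReducedSSet.{u}}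

variable (k) in
/-- The element of the cobar construction that corresponds to the cell `bcell c`. -/
def weight (c : Simplices X.obj) : TensorAlgebra k (X.awObj k).Bar :=
  (X.awObj k).desusp (scell k c) + if c.1 ≤ 1 then 1 else 0

/-- The dichotomy behind the left inverse: degenerate edges have weight `1` and can be dropped from
a product, while degenerate simplices of dimension at least `2` have weight `0` and kill it. -/
lemma weight_of_isDegenerate {c : Simplices X.obj} (h : c.IsDegenerate) :
    weight k c = if c.1 ≤ 1 then 1 else 0 := by
  have : (X.awObj k).desusp (scell k c) = 0 :=
    (congrArg (X.awObj k).desusp (scell_degenerate h)).trans (map_zero _)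
  rw [weight, this, zero_add]

/-- The point spans the image of the coaugmentation, so only the unit is left. -/
lemma weight_pt : weight k X.pt = 1 := by
  have : (X.awObj k).desusp (scell k X.pt) = 0 := by
    have h : scell k X.pt = (X.awObj k).coaug 1 := (one_smul k _).symm
    refine (congrArg (X.awObj k).desusp h).trans ?_
    exact (congrArg (TensorAlgebra.ι k) ((X.awObj k).toBar_coaug 1)).trans (map_zero _)
  rw [weight, this, zero_add]
  exact if_pos (Nat.zero_le 1)

variable (k) in
open Classical in
/-- The weight of the simplex with a given vertex set. -/
def faceWeight {T : Necklace} (σ : T.toSSet ⟶ X.obj) (B : Finset ℕ) :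
    TensorAlgebra k (X.awObj k).Bar :=
  -- The default `0` plays no role for the sets cut out by consecutive elements of a span, since
  -- `IsSpan.exists_isFace` provides a face for each of them.
  if h : ∃ c, IsFace σ B c then weight k h.choose else 0

lemma IsFace.faceWeight_eq {T : Necklace} {σ : T.toSSet ⟶ X.obj} {B : Finset ℕ}
    {c : Simplices X.obj} (h : IsFace σ B c) : faceWeight k σ B = weight k c := by
  have h' : ∃ c, IsFace σ B c := ⟨c, h⟩
  rw [faceWeight, dif_pos h', h'.choose_spec.unique h]

/-- Along a map of necklaces a face either keeps its vertices apart, and is then the same simplex of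
`X` seen in the target, or it becomes degenerate; the second alternative is `IsFace.isDegenerate`.
-/
lemma IsFace.image {S T : Necklace} {g : S ⟶ T} {τ : T.toSSet ⟶ X.obj} {B : Finset ℕ}
    {c : Simplices X.obj} (h : IsFace (toSSetMap g ≫ τ) B c) (hg : Set.InjOn g.toFun B) :
    IsFace τ (B.image g.toFun) c := by
  obtain ⟨n, s, hs, rfl, rfl⟩ := h
  refine ⟨n, s.map g, fun i j hij => ?_, ?_, rfl⟩
  · refine lt_of_le_of_ne ((s.map g).1.monotone hij.le) fun he => (hs hij).ne ?_
    exact hg (by simp) (by simp) he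
  · rw [Finset.image_image]
    rfl

lemma IsFace.isDegenerate {S T : Necklace} {g : S ⟶ T} {τ : T.toSSet ⟶ X.obj} {B : Finset ℕ}
    {c : Simplices X.obj} (h : IsFace (toSSetMap g ≫ τ) B c) {x y : ℕ} (hx : x ∈ B) (hy : y ∈ B)
    (hxy : x ≠ y) (he : g.toFun x = g.toFun y) : c.IsDegenerate := by
  obtain ⟨n, s, hs, rfl, rfl⟩ := h
  simp only [Finset.mem_image, Finset.mem_univ, true_and] at hx hy
  obtain ⟨i, rfl⟩ := hx
  obtain ⟨j, rfl⟩ := hy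
  have hij : i ≠ j := fun h => hxy (by rw [h])
  rcases lt_or_gt_of_ne hij with h | h
  · exact napp_degenerate τ (s.map g) h he
  · exact napp_degenerate τ (s.map g) h he.symm

lemma IsFace.glue_left {S T : Necklace} {σ : S.toSSet ⟶ X.obj} (τ : T.toSSet ⟶ X.obj)
    {B : Finset ℕ} {c : Simplices X.obj} (h : IsFace σ B c) : IsFace (glue σ τ) B c := by
  obtain ⟨n, s, hs, rfl, rfl⟩ := h
  refine ⟨n, s.inl, hs, rfl, congrArg (Sigma.mk n) ?_⟩
  refine .trans ?_ (CubicalCobar.glue_left (n := SimplexCategory.mk n) σ τ s.inl s.2.1).symm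
  exact congrArg (napp (n := SimplexCategory.mk n) σ) (Simplex.ext fun i => (min_eq_left (s.2.1 i)).symm)

lemma IsFace.glue_right {S T : Necklace} (σ : S.toSSet ⟶ X.obj) {τ : T.toSSet ⟶ X.obj}
    {B : Finset ℕ} {c : Simplices X.obj} (h : IsFace τ B c) :
    IsFace (glue σ τ) (B.image (S.len + ·)) c := by
  obtain ⟨n, s, hs, rfl, rfl⟩ := h
  refine ⟨n, s.inr, fun i j hij => Nat.add_lt_add_left (hs hij) _, ?_, congrArg (Sigma.mk n) ?_⟩
  · rw [Finset.image_image]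
    rfl
  · refine .trans ?_ (CubicalCobar.glue_right (n := SimplexCategory.mk n) σ τ s.inr
      fun i => Nat.le_add_right _ _).symm
    exact congrArg (napp (n := SimplexCategory.mk n) τ)
      (Simplex.ext fun i => (Nat.add_sub_cancel_left S.len (s.1 i)).symm)

/-! ### Spans, their weights and maps of necklaces -/

/-- The pairs of vertex sets that span faces of the cube of a necklace. -/
structure IsSpan (T : Necklace) (V W : Finset ℕ) : Prop where
  joints : T.joints ⊆ V
  sub : V ⊆ W
  le : ∀ v ∈ W, v ≤ T.len

/-- The elements of a finite set that lie between two numbers. -/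
def between (W : Finset ℕ) (u v : ℕ) : Finset ℕ := W.filter fun w => u ≤ w ∧ w ≤ v

lemma mem_between {W : Finset ℕ} {u v w : ℕ} : w ∈ between W u v ↔ w ∈ W ∧ u ≤ w ∧ w ≤ v :=
  Finset.mem_filter

/-- As `V` contains all joints, none lies strictly between consecutive elements of `V`, so the piece
of `W` between them stays in one bead. -/
lemma IsSpan.exists_isFace {T : Necklace} {V W : Finset ℕ} (h : IsSpan T V W)
    (σ : T.toSSet ⟶ X.obj) {u v : ℕ} (huv : Consec V u v) :
    ∃ c, IsFace σ (between W u v) c ∧ c.1 + 1 = (between W u v).card := by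
  refine CubicalCobar.exists_isFace σ ⟨u, mem_between.2 ⟨h.sub huv.left, le_rfl, huv.lt.le⟩⟩
    (fun w hw => h.le w (mem_between.1 hw).1) fun j hj => ?_
  rcases lt_or_ge j v with hlt | hle
  · exact Or.inr fun w hw => (huv.le j (h.joints hj) hlt).trans (mem_between.1 hw).2.1
  · exact Or.inl fun w hw => (mem_between.1 hw).2.2.trans hle

lemma isSpan {A : Cube} {T : Necklace} (f : A ⟶ necklaceCube.obj T) :
    IsSpan T (loSet f) (hiSet f) :=
  ⟨joints_subset_loSet f, loSet_subset_hiSet f, fun _ => le_len_of_mem_hiSet f⟩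

variable (k) in
/-- The product of the weights of the simplices into which `V` divides `W`. -/
def spanWeight {T : Necklace} (σ : T.toSSet ⟶ X.obj) (V W : Finset ℕ) :
    TensorAlgebra k (X.awObj k).Bar :=
  pathProd V (fun u v => faceWeight k σ (between W u v)) T.len

/-- A vertex outside `[u, v]` may also land between `g u` and `g v`, but by monotonicity it then
lands on one of these two. -/
lemma between_image {S T : Necklace} (g : S ⟶ T) {V W : Finset ℕ} (hVW : V ⊆ W) {u v : ℕ}
    (huv : Consec V u v) :
    (between W u v).image g.toFun = between (W.image g.toFun) (g.toFun u) (g.toFun v) := by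
  ext w
  simp only [Finset.mem_image, mem_between]
  constructor
  · rintro ⟨w, ⟨hw, h1, h2⟩, rfl⟩
    exact ⟨⟨w, hw, rfl⟩, g.mono h1, g.mono h2⟩
  · rintro ⟨⟨w, hw, rfl⟩, h1, h2⟩
    by_cases hu : w < u
    · exact ⟨u, ⟨hVW huv.left, le_rfl, huv.lt.le⟩, le_antisymm h1 (g.mono hu.le)⟩
    by_cases hv : v < w
    · exact ⟨v, ⟨hVW huv.right, huv.lt.le, le_rfl⟩, le_antisymm (g.mono hv.le) h2⟩
    · exact ⟨w, ⟨hw, not_lt.1 hu, not_lt.1 hv⟩, rfl⟩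

/-- The hypotheses say that `g` identifies no element of `W \ V` with another such element or with
an element of `V`, i.e. that the rank is kept. So each piece is either a collapsed edge, of weight
`1`, or embedded by `g`. -/
lemma spanWeight_map {S T : Necklace} (g : S ⟶ T) (τ : T.toSSet ⟶ X.obj) {V W : Finset ℕ}
    (h : IsSpan S V W) (hinj : Set.InjOn g.toFun (W \ V : Finset ℕ))
    (hdisj : ∀ x ∈ W \ V, g.toFun x ∉ V.image g.toFun) :
    spanWeight k (toSSetMap g ≫ τ) V W = spanWeight k τ (V.image g.toFun) (W.image g.toFun) := by
  have hl : g.toFun S.len = T.len := g.map_len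
  rw [spanWeight, spanWeight, ← hl]
  refine pathProd_image g.mono (fun u v huv => ?_) _ (h.joints S.len_mem)
  obtain ⟨c, hc, hcard⟩ := h.exists_isFace (toSSetMap g ≫ τ) huv
  have hends {x : ℕ} (hx : x ∈ between W u v) (hxV : x ∈ V) : x = u ∨ x = v := by
    obtain ⟨-, h1, h2⟩ := mem_between.1 hx
    rcases h2.lt_or_eq with h2 | h2
    · exact Or.inl (le_antisymm (huv.le x hxV h2) h1)
    · exact Or.inr h2
  have hu : u ∈ between W u v := mem_between.2 ⟨h.sub huv.left, le_rfl, huv.lt.le⟩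
  have hv : v ∈ between W u v := mem_between.2 ⟨h.sub huv.right, huv.lt.le, le_rfl⟩
  rw [hc.faceWeight_eq]
  split_ifs with he
  -- If `u` and `v` are identified, anything between them would be identified with `u`, which
  -- `hdisj` forbids. So the piece is an edge.
  · have hB : between W u v ⊆ {u, v} := by
      intro x hx
      rw [Finset.mem_insert, Finset.mem_singleton]
      by_contra hne
      have hxV : x ∉ V := fun hxV => hne (hends hx hxV)
      obtain ⟨hxW, h1, h2⟩ := mem_between.1 hx
      refine hdisj x (Finset.mem_sdiff.2 ⟨hxW, hxV⟩) (Finset.mem_image.2 ⟨u, huv.left, ?_⟩)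
      exact le_antisymm (g.mono h1) ((g.mono h2).trans_eq he.symm)
    have := (Finset.card_le_card hB).trans Finset.card_le_two
    rw [weight_of_isDegenerate (hc.isDegenerate hu hv huv.lt.ne he), if_pos (by omega)]
  · rw [← between_image g h.sub huv]
    -- If they are not identified, `g` is injective on the piece: its only elements in `V` are `u`
    -- and `v`, and the elements of `W \ V` are kept apart by hypothesis.
    refine (hc.image fun x hx y hy hxy => ?_).faceWeight_eq.symm
    have hxW := (mem_between.1 hx).1
    have hyW := (mem_between.1 hy).1
    by_cases hxV : x ∈ V
    · by_cases hyV : y ∈ V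
      · rcases hends hx hxV with rfl | rfl <;> rcases hends hy hyV with rfl | rfl
        exacts [rfl, absurd hxy he, absurd hxy.symm he, rfl]
      · exact (hdisj y (Finset.mem_sdiff.2 ⟨hyW, hyV⟩) (hxy ▸ Finset.mem_image_of_mem _ hxV)).elim
    · by_cases hyV : y ∈ V
      · exact (hdisj x (Finset.mem_sdiff.2 ⟨hxW, hxV⟩) (hxy ▸ Finset.mem_image_of_mem _ hyV)).elim
      · exact hinj (Finset.mem_coe.2 (Finset.mem_sdiff.2 ⟨hxW, hxV⟩))
          (Finset.mem_coe.2 (Finset.mem_sdiff.2 ⟨hyW, hyV⟩)) hxy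

/-- The piece that contains `x` becomes degenerate. It has the three vertices `u < x < v`, so its
weight is `0` and not `1`. -/
lemma spanWeight_eq_zero {S T : Necklace} (g : S ⟶ T) (τ : T.toSSet ⟶ X.obj) {V W : Finset ℕ}
    (h : IsSpan S V W) {x y : ℕ} (hx : x ∈ W \ V) (hy : y ∈ W) (hne : x ≠ y)
    (he : g.toFun x = g.toFun y) : spanWeight k (toSSetMap g ≫ τ) V W = 0 := by
  obtain ⟨hxW, hxV⟩ := Finset.mem_sdiff.1 hx
  have hlen : S.len ∈ V := h.joints S.len_mem
  obtain ⟨u, v, huv, hux, hxv⟩ := exists_consec_between hxV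
    ⟨0, h.joints S.zero_mem, Nat.zero_le x⟩ ⟨_, hlen, h.le x hxW⟩
  refine pathProd_eq_zero huv ?_ _ hlen (h.le v (h.sub huv.right))
  obtain ⟨c, hc, hcard⟩ := h.exists_isFace (toSSetMap g ≫ τ) huv
  have hu : u ∈ between W u v := mem_between.2 ⟨h.sub huv.left, le_rfl, huv.lt.le⟩
  have hv : v ∈ between W u v := mem_between.2 ⟨h.sub huv.right, huv.lt.le, le_rfl⟩
  have hxB : x ∈ between W u v := mem_between.2 ⟨hxW, hux.le, hxv.le⟩
  have hdeg : c.IsDegenerate := by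
    -- If `y` lies outside the piece, monotonicity identifies `x` with the end of the piece on the
    -- side of `y`.
    by_cases h1 : y < u
    · exact hc.isDegenerate hxB hu hux.ne'
        (le_antisymm (he.trans_le (g.mono h1.le)) (g.mono hux.le))
    by_cases h2 : v < y
    · exact hc.isDegenerate hxB hv hxv.ne
        (le_antisymm (g.mono hxv.le) ((g.mono h2.le).trans_eq he.symm))
    · exact hc.isDegenerate hxB (mem_between.2 ⟨hy, not_lt.1 h1, not_lt.1 h2⟩) hne he
  have hcard3 : 3 ≤ (between W u v).card := by
    have h3 : ({u, x, v} : Finset ℕ) ⊆ between W u v := by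
      intro w hw
      simp only [Finset.mem_insert, Finset.mem_singleton] at hw
      rcases hw with rfl | rfl | rfl
      exacts [hu, hxB, hv]
    refine (Finset.card_le_card h3).trans' ?_
    rw [Finset.card_eq_three.2 ⟨u, x, v, hux.ne, (hux.trans hxv).ne, hxv.ne, rfl⟩]
  rw [hc.faceWeight_eq, weight_of_isDegenerate hdeg, if_neg (by omega)]

lemma image_sdiff_subset {V W : Finset ℕ} (q : ℕ → ℕ) :
    W.image q \ V.image q ⊆ (W \ V).image q := by
  intro w hw
  obtain ⟨h1, h2⟩ := Finset.mem_sdiff.1 hw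
  obtain ⟨x, hx, rfl⟩ := Finset.mem_image.1 h1
  exact Finset.mem_image_of_mem q (Finset.mem_sdiff.2 ⟨hx, fun h => h2 (Finset.mem_image_of_mem q h)⟩)

/-- Compatibility with the relation of the Kan extension, `m` being the dimension of the cell. The
rank cannot grow under `g`: if it stays equal to `m`, the weights agree by `spanWeight_map`; if it
drops below `m`, the weight before was already `0`. -/
lemma spanWeight_map_ite {S T : Necklace} (g : S ⟶ T) (τ : T.toSSet ⟶ X.obj) {V W : Finset ℕ}
    (h : IsSpan S V W) {m : ℕ} (hm : (W \ V).card ≤ m) :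
    (if (W \ V).card = m then spanWeight k (toSSetMap g ≫ τ) V W else 0) =
      if (W.image g.toFun \ V.image g.toFun).card = m then
        spanWeight k τ (V.image g.toFun) (W.image g.toFun) else 0 := by
  have hsub := image_sdiff_subset (V := V) (W := W) g.toFun
  have h1 := Finset.card_le_card hsub
  have h2 : ((W \ V).image g.toFun).card ≤ (W \ V).card := Finset.card_image_le
  by_cases hV : (W \ V).card = m
  · rw [if_pos hV]
    by_cases hc : (W.image g.toFun \ V.image g.toFun).card = m
    · rw [if_pos hc]
      have he := Finset.eq_of_subset_of_card_le hsub (by omega)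
      refine spanWeight_map g τ h (Finset.card_image_iff.1 (by omega)) fun x hx => ?_
      exact (Finset.mem_sdiff.1 (he ▸ Finset.mem_image_of_mem g.toFun hx)).2
    · rw [if_neg hc]
      -- If the weight did not vanish, then by `spanWeight_eq_zero` no element of `W \ V` would be
      -- identified with any other element of `W`, and the rank would be kept.
      by_contra hne
      have hsep {x y : ℕ} (hx : x ∈ W \ V) (hy : y ∈ W) (he : g.toFun x = g.toFun y) : x = y := by
        by_contra hxy
        exact hne (spanWeight_eq_zero g τ h hx hy hxy he)
      have hinj : Set.InjOn g.toFun (W \ V : Finset ℕ) := fun x hx y hy he =>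
        hsep hx (Finset.mem_sdiff.1 (Finset.mem_coe.1 hy)).1 he
      refine hc (le_antisymm (by omega) ?_)
      rw [← hV, ← Finset.card_image_iff.2 hinj]
      refine Finset.card_le_card fun w hw => ?_
      obtain ⟨x, hx, rfl⟩ := Finset.mem_image.1 hw
      obtain ⟨hxW, hxV⟩ := Finset.mem_sdiff.1 hx
      refine Finset.mem_sdiff.2 ⟨Finset.mem_image_of_mem _ hxW, fun hV => ?_⟩
      obtain ⟨y, hy, he⟩ := Finset.mem_image.1 hV
      exact hxV (hsep hx (h.sub hy) he.symm ▸ hy)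
  · rw [if_neg hV, if_neg (by omega)]

/-- The common vertex `S.len` is a joint, so the path of consecutive elements passes through it and
no simplex straddles the two parts. -/
lemma spanWeight_glue {S T : Necklace} (σ : S.toSSet ⟶ X.obj) (τ : T.toSSet ⟶ X.obj)
    {V W V' W' : Finset ℕ} (h : IsSpan S V W) (h' : IsSpan T V' W') :
    spanWeight k (glue σ τ) (V ∪ V'.image (S.len + ·)) (W ∪ W'.image (S.len + ·)) =
      spanWeight k σ V W * spanWeight k τ V' W' := by
  have hlen : (S ⊗ T).len = S.len + T.len := rfl
  have hle {v} (hv : v ∈ V) : v ≤ S.len := h.le v (h.sub hv)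
  rw [spanWeight, hlen, pathProd_union_shift (fun v => hle) (h'.joints T.zero_mem)
    (F := fun u v => faceWeight k τ (between W' u v)) ?_ _ (h'.joints T.len_mem)]
  · refine congrArg (· * _) ?_
    refine (pathProd_congr_union (fun j hj => ?_) (fun u v huv => ?_) _ (h.joints S.len_mem)
      le_rfl).symm
    · obtain ⟨i, -, rfl⟩ := Finset.mem_image.1 hj
      exact Nat.le_add_right _ _
    · obtain ⟨c, hc, -⟩ := h.exists_isFace σ huv
      rw [hc.faceWeight_eq]
      have hB : between (W ∪ W'.image (S.len + ·)) u v = between W u v := by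
        ext w
        simp only [mem_between, Finset.mem_union, Finset.mem_image]
        constructor
        · rintro ⟨hw | ⟨i, hi, rfl⟩, h1, h2⟩
          · exact ⟨hw, h1, h2⟩
          -- A shifted vertex that is at most `v ≤ S.len` must be the common joint, hence equal to
          -- `v`.
          · have := hle huv.right
            have hv : S.len + i = v := by omega
            exact ⟨hv ▸ h.sub huv.right, h1, h2⟩
        · rintro ⟨hw, h1, h2⟩
          exact ⟨Or.inl hw, h1, h2⟩
      rw [hB, (hc.glue_left τ).faceWeight_eq]
  · intro u v huv
    obtain ⟨c, hc, -⟩ := h'.exists_isFace τ huv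
    rw [hc.faceWeight_eq]
    have hB : between (W ∪ W'.image (S.len + ·)) (S.len + u) (S.len + v) =
        (between W' u v).image (S.len + ·) := by
      ext w
      simp only [mem_between, Finset.mem_union, Finset.mem_image]
      constructor
      · rintro ⟨hw | ⟨i, hi, rfl⟩, h1, h2⟩
        -- A vertex of the first part that is at least `S.len + u` must be the common joint, with `u
        -- = 0`.
        · have := h.le w hw
          exact ⟨u, ⟨h'.sub huv.left, le_rfl, huv.lt.le⟩, by omega⟩
        · exact ⟨i, ⟨hi, by omega, by omega⟩, rfl⟩
      · rintro ⟨i, ⟨hi, h1, h2⟩, rfl⟩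
        exact ⟨Or.inr ⟨i, hi, rfl⟩, by omega, by omega⟩
    rw [hB, (hc.glue_right σ).faceWeight_eq]

end

section

/-! ### Injectivity of the comparison map -/

open Necklace CoaugDGCoalg

variable {k : Type v} [CommRing k] {X : ReducedSSet.{u}}

lemma bit_const {n : ℕ} (b : Bool) {l : ℕ} (hl : l < n) : bit (fun _ : Fin n => b) l = b := by
  simp [bit, hl]

/-- Codegeneracies, and by the next lemma coconnections, preserve the extreme vertices. So
precomposing with them does not change the span of a map. -/
lemma Cube.degenN_const (A : Cube) {i : ℕ} (hi : i ≤ A.dim) (b : Bool) :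
    (degenN A i).1 (fun _ => b) = fun _ => b := bit_ext fun l hl => by
  rw [bit_degenN A hi, if_pos hl, bit_const _ hl]
  split_ifs <;> exact bit_const (n := A.dim + 1) _ (by omega)

lemma Cube.connN_const (A : Cube) {i : ℕ} (hi : i < A.dim) (b : Bool) :
    (connN A i).1 (fun _ => b) = fun _ => b := bit_ext fun l hl => by
  have h {l : ℕ} (hl : l < A.dim + 1) : bit (fun _ : Fin (Cube.mk (A.dim + 1)).dim => b) l = b :=
    bit_const (n := A.dim + 1) b hl
  rw [bit_connN A hi, bit_const _ hl, h (by omega), h (by omega), h (by split_ifs <;> omega),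
    if_pos hl, Bool.or_self, ite_self]

/-- A form of `exists_eq_pull_ncell` in which the cube is a free variable, so that `c` can be
eliminated by substitution. -/
lemma exists_pull_ncell (c : Cells (ccobar.obj X).toFunctor) :
    ∃ (A : Cube) (T : Necklace) (σ : T.toSSet ⟶ X.obj) (f : A ⟶ necklaceCube.obj T),
      c = (ncell σ).pull f :=
  ⟨c.cube, exists_eq_pull_ncell c⟩

variable (k) in
/-- The value on a cell of the inverse of the comparison map. -/
def cellWeight (c : Cells (ccobar.obj X).toFunctor) : TensorAlgebra k (X.awObj k).Bar :=
  LanObj.lift (F := necklaceCube) (K := ncobarFunctor X) (A := c.cube)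
    -- The condition says that `f` has full rank, so every other cell is sent to `0`.
    (fun _ σ f => if (hiSet f \ loSet f).card = c.cube.dim then
      spanWeight k σ (loSet f) (hiSet f) else 0)
    (fun g τ f => by
      have hle : (hiSet f \ loSet f).card ≤ c.cube.dim :=
        (card_moving_eq f).symm.trans_le f.2.card_moving_le
      rw [loSet_comp, hiSet_comp]
      exact spanWeight_map_ite g τ (isSpan f) hle) c.val

lemma cellWeight_pull {T : Necklace} (σ : T.toSSet ⟶ X.obj) {A : Cube}
    (f : A ⟶ necklaceCube.obj T) : cellWeight k ((ncell σ).pull f) =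
      if (hiSet f \ loSet f).card = A.dim then spanWeight k σ (loSet f) (hiSet f) else 0 := by
  rw [ncell_pull]
  rfl

/-- The cube grows but the span does not, so full rank is impossible. -/
lemma cellWeight_pull_of_lt {T : Necklace} (σ : T.toSSet ⟶ X.obj) {A B : Cube}
    (f : A ⟶ necklaceCube.obj T) (g : B ⟶ A) (h : A.dim < B.dim)
    (h0 : g.1 (fun _ => false) = fun _ => false) (h1 : g.1 (fun _ => true) = fun _ => true) :
    cellWeight k (((ncell σ).pull f).pull g) = 0 := by
  have hlo : loSet (g ≫ f) = loSet f := congrArg (fun x => T.vset (f.1 x)) h0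
  have hhi : hiSet (g ≫ f) = hiSet f := congrArg (fun x => T.vset (f.1 x)) h1
  refine (congrArg (cellWeight k) (Cells.pull_pull (ncell σ) f g)).trans
    ((cellWeight_pull σ (g ≫ f)).trans (if_neg ?_))
  have hle : (hiSet f \ loSet f).card ≤ A.dim :=
    (card_moving_eq f).symm.trans_le f.2.card_moving_le
  rw [hlo, hhi]
  omega

lemma cellWeight_degenerate (c : Cells (ccobar.obj X).toFunctor) (hc : c.IsDegenerate) :
    cellWeight k c = 0 := by
  obtain ⟨c', i, h⟩ := (Cells.isDegenerate_iff c).1 hc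
  obtain ⟨A, T, σ, f, rfl⟩ := exists_pull_ncell c'
  have key (g : Cube.mk (A.dim + 1) ⟶ A) (h0 : g.1 (fun _ => false) = fun _ => false)
      (h1 : g.1 (fun _ => true) = fun _ => true) (hcg : c = Cells.pull ((ncell σ).pull f) g) :
      cellWeight k c = 0 :=
    hcg ▸ cellWeight_pull_of_lt σ f g (Nat.lt_succ_self A.dim) h0 h1
  rcases h with ⟨hi, hcg⟩ | ⟨hi, hcg⟩
  · exact key (Cube.degenN A i) (Cube.degenN_const A hi _) (Cube.degenN_const A hi _) hcg
  · exact key (Cube.connN A i) (Cube.connN_const A hi _) (Cube.connN_const A hi _) hcg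

lemma vset_tens {S T : Necklace} {A B : Cube} (f : A ⟶ necklaceCube.obj S)
    (g : B ⟶ necklaceCube.obj T) (x : Fin A.dim → Bool) (y : Fin B.dim → Bool) :
    (S ⊗ T).vset (((f ⊗ₘ g) ≫ Functor.LaxMonoidal.μ necklaceCube S T).1 (Cube.tens x y)) =
      S.vset (f.1 x) ∪ (T.vset (g.1 y)).image (S.len + ·) := by
  apply Finset.coe_injective
  refine (coe_vset (S ⊗ T) _).trans ((congrArg (fun z => (S ⊗ T).verts
    ((Cube.castHom (necklaceCube_obj_tensor_dim S T)).1 z)) (Cube.tensorHom_tens f g x y)).trans ?_)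
  refine (verts_castHom S T _ _).trans ?_
  rw [Finset.coe_union, Finset.coe_image]
  exact (congrArg₂ (fun V W : Set ℕ => V ∪ (S.len + ·) '' W) (coe_vset S (f.1 x))
    (coe_vset T (g.1 y))).symm

/-- The two parts overlap only in the common joint, which lies in `V` and, as the vertex `0`, in
`V'`; so it is never counted. -/
lemma IsSpan.card_sdiff_wedge {S T : Necklace} {V W V' W' : Finset ℕ} (h : IsSpan S V W)
    (h' : IsSpan T V' W') :
    ((W ∪ W'.image (S.len + ·)) \ (V ∪ V'.image (S.len + ·))).card =
      (W \ V).card + (W' \ V').card := by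
  have e : (W ∪ W'.image (S.len + ·)) \ (V ∪ V'.image (S.len + ·)) =
      (W \ V) ∪ (W' \ V').image (S.len + ·) := by
    ext w
    simp only [Finset.mem_sdiff, Finset.mem_union, Finset.mem_image, not_or, not_exists, not_and]
    constructor
    · rintro ⟨hw | ⟨i, hi, rfl⟩, h1, h2⟩
      · exact Or.inl ⟨hw, h1⟩
      · exact Or.inr ⟨i, ⟨hi, fun hV => h2 i hV rfl⟩, rfl⟩
    · rintro (⟨hw, hV⟩ | ⟨i, ⟨hi, hV⟩, rfl⟩)
      · refine ⟨Or.inl hw, hV, fun i hi he => hV ?_⟩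
        have h1 := h.le w hw
        have h2 : w = S.len := by omega
        exact h2 ▸ h.joints S.len_mem
      · refine ⟨Or.inr ⟨i, hi, rfl⟩, fun hiV => hV ?_, fun j hj he => hV ?_⟩
        · have h1 := h.le _ (h.sub hiV)
          have h2 : i = 0 := by omega
          exact h2 ▸ h'.joints T.zero_mem
        · have h2 : j = i := by omega
          exact h2 ▸ hj
  rw [e, Finset.card_union_of_disjoint, Finset.card_image_of_injective _ (add_right_injective _)]
  rw [Finset.disjoint_left]
  intro w hw hw'
  obtain ⟨h1, h2⟩ := Finset.mem_sdiff.1 hw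
  obtain ⟨i, hi, rfl⟩ := Finset.mem_image.1 hw'
  have h3 := h.le _ h1
  have h4 : i = 0 := by omega
  exact (Finset.mem_sdiff.1 hi).2 (h4 ▸ h'.joints T.zero_mem)

/-- Ranks and dimensions are both additive, and a rank is at most the dimension. So a product has
full rank exactly when both factors have, and then `spanWeight_glue` applies. -/
lemma cellWeight_mul (c c' : Cells (ccobar.obj X).toFunctor) :
    cellWeight k (c * c') = cellWeight k c * cellWeight k c' := by
  obtain ⟨A, S, σ, f, rfl⟩ := exists_pull_ncell c
  obtain ⟨B, T, τ, g, rfl⟩ := exists_pull_ncell c'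
  -- Of the map of cubes representing the product only its extreme vertices are needed.
  obtain ⟨h, hlo, hhi, hmul⟩ : ∃ h : A ⊗ B ⟶ necklaceCube.obj (S ⊗ T),
      loSet h = loSet f ∪ (loSet g).image (S.len + ·) ∧
      hiSet h = hiSet f ∪ (hiSet g).image (S.len + ·) ∧
      (ncell σ).pull f * (ncell τ).pull g = (ncell (T := S ⊗ T) (glue σ τ)).pull h := by
    let h : A ⊗ B ⟶ necklaceCube.obj (S ⊗ T) :=
      (f ⊗ₘ g) ≫ Functor.LaxMonoidal.μ necklaceCube S T
    have hV (b : Bool) : (S ⊗ T).vset (h.1 fun _ => b) =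
        S.vset (f.1 fun _ => b) ∪ (T.vset (g.1 fun _ => b)).image (S.len + ·) :=
      (congrArg (fun z => (S ⊗ T).vset (h.1 z))
        (Cube.tens_pieces (A := A) (B := B) fun _ => b)).symm.trans (vset_tens f g _ _)
    refine ⟨h, hV false, hV true, ?_⟩
    refine (congrArg₂ (· * ·) (ncell_pull σ f) (ncell_pull τ g)).trans ?_
    exact .trans rfl (ncell_pull (glue σ τ) h).symm
  refine (congrArg (cellWeight k) hmul).trans ((cellWeight_pull _ h).trans ?_)
  rw [hlo, hhi]
  refine .trans ?_ (congrArg₂ (· * ·) (cellWeight_pull σ f) (cellWeight_pull τ g)).symm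
  have hle : (hiSet f \ loSet f).card ≤ A.dim :=
    (card_moving_eq f).symm.trans_le f.2.card_moving_le
  have hle' : (hiSet g \ loSet g).card ≤ B.dim :=
    (card_moving_eq g).symm.trans_le g.2.card_moving_le
  have hd : (A ⊗ B).dim = A.dim + B.dim := rfl
  rw [(isSpan f).card_sdiff_wedge (isSpan g), hd, spanWeight_glue σ τ (isSpan f) (isSpan g)]
  by_cases h1 : (hiSet f \ loSet f).card = A.dim
  · by_cases h2 : (hiSet g \ loSet g).card = B.dim
    · rw [if_pos h1, if_pos h2, if_pos (by rw [h1, h2])]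
    · rw [if_neg h2, mul_zero, if_neg (by omega)]
  · rw [if_neg h1, zero_mul, if_neg (by omega)]

lemma isFace_beadMap (c : Simplices X.obj) : IsFace (beadMap c) (Finset.range (c.1 + 1)) c := by
  let ι : (bead c.1).Simplex c.1 := ⟨⟨fun i => i, fun _ _ h => h⟩, fun i => i.is_le, fun j hj => by
    rcases mem_bead_joints.1 hj with rfl | rfl
    exacts [Or.inr fun i => Nat.zero_le _, Or.inl fun i => i.is_le]⟩
  refine ⟨c.1, ι, fun _ _ h => h, ?_, ?_⟩
  · ext v
    rw [Finset.mem_image, Finset.mem_range]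
    constructor
    · rintro ⟨i, -, rfl⟩
      exact i.2
    · intro hv
      exact ⟨⟨v, hv⟩, Finset.mem_univ _, rfl⟩
  · have h : (beadHom ι) = 𝟙 (SimplexCategory.mk c.1) := by
      refine Simplices.map_toOrderHom_ext fun i => rfl
    refine congrArg (Sigma.mk c.1) ?_
    refine .trans ?_ (napp_beadMap c (m := SimplexCategory.mk c.1) ι).symm
    rw [h, op_id, X.obj.map_id]
    rfl

/-- The whole cube of a bead has the span `{0, n} ⊆ {0, …, n}`: one step, whose face is `c` itself.
For `n = 0` the path is empty, and the value `1` is the weight of the point. -/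
lemma cellWeight_bcell (c : Simplices X.obj) : cellWeight k (bcell c) = weight k c := by
  have hlo : loSet (𝟙 (necklaceCube.obj (bead c.1))) = {0, c.1} := (bead c.1).vset_false
  have hhi : hiSet (𝟙 (necklaceCube.obj (bead c.1))) = Finset.range (c.1 + 1) := by
    ext v
    exact (mem_vset_true (T := bead c.1)).trans Finset.mem_range_succ_iff.symm
  have hcard : (hiSet (𝟙 (necklaceCube.obj (bead c.1))) \
      loSet (𝟙 (necklaceCube.obj (bead c.1)))).card = (necklaceCube.obj (bead c.1)).dim := by
    have : Finset.range (c.1 + 1) \ {0, c.1} = Finset.Ioo 0 c.1 := by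
      ext v
      simp
      omega
    rw [hlo, hhi, this, Nat.card_Ioo]
    exact (bead_dim c.1).symm
  have h := cellWeight_pull (k := k) (beadMap c) (𝟙 (necklaceCube.obj (bead c.1)))
  rw [if_pos hcard, hlo, hhi] at h
  refine (congrArg (cellWeight k) (Cells.pull_id (bcell c)).symm).trans (h.trans ?_)
  change pathProd _ _ c.1 = _
  by_cases h0 : c.1 = 0
  · rw [pathProd_of_forall_le (by simp [h0]), ReducedSSet.eq_pt c h0, weight_pt]
  · rw [pathProd_consec (u := 0) ⟨by simp, by simp, by omega, by simp⟩,
      pathProd_of_forall_le (by simp), one_mul]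
    have : between (Finset.range (c.1 + 1)) 0 c.1 = Finset.range (c.1 + 1) := by
      ext v
      simp only [mem_between, Finset.mem_range]
      omega
    rw [this, (isFace_beadMap c).faceWeight_eq]

variable (k X) in
/-- The inverse of the comparison map. -/
def chainWeight : CChains k (ccobar.obj X) →ₗ[k] TensorAlgebra k (X.awObj k).Bar :=
  cchainsLift (cellWeight k) cellWeight_degenerate

lemma chainWeight_ccell (c : Cells (ccobar.obj X).toFunctor) :
    chainWeight k X (ccell k c) = cellWeight k c :=
  cchainsLift_ccell _ _ _

lemma cellWeight_one : cellWeight k (1 : Cells (ccobar.obj X).toFunctor) = 1 := by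
  rw [← bcell_of_zero X.pt rfl, cellWeight_bcell, weight_pt]

lemma chainWeight_one : chainWeight k X 1 = 1 := by
  rw [← ccell_one, chainWeight_ccell, cellWeight_one]

lemma chainWeight_ccell_mul (c : Cells (ccobar.obj X).toFunctor) (y : CChains k (ccobar.obj X)) :
    chainWeight k X (ccell k c * y) = cellWeight k c * chainWeight k X y := by
  have : chainWeight k X ∘ₗ LinearMap.mulLeft k (ccell k c) =
      LinearMap.mulLeft k (cellWeight k c) ∘ₗ chainWeight k X := cchains_ext fun c' => by
    simp only [LinearMap.comp_apply, LinearMap.mulLeft_apply, chainWeight_ccell, ← ccell_mul,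
      cellWeight_mul]
  exact LinearMap.congr_fun this y

/-- The unit subtracted in `genImage` cancels the one added in `weight`. -/
lemma chainWeight_genImage_mul (c : Simplices X.obj) (y : CChains k (ccobar.obj X)) :
    chainWeight k X (genImage k c * y) =
      (X.awObj k).desusp (scell k c) * chainWeight k X y := by
  rw [genImage, sub_mul, map_sub, chainWeight_ccell_mul, cellWeight_bcell, weight, add_mul]
  split_ifs
  · rw [one_mul, one_mul]
    exact add_sub_cancel_right _ _
  · rw [zero_mul, zero_mul, map_zero, add_zero, sub_zero]

/-- `chainWeight` is only defined as a linear map. The right factor `y` lets the induction on `a` go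
through without first making it an algebra map; `y = 1` gives the left inverse. -/
lemma chainWeight_comparison_mul (a : TensorAlgebra k (X.awObj k).Bar)
    (y : CChains k (ccobar.obj X)) :
    chainWeight k X (comparison k X a * y) = a * chainWeight k X y := by
  induction a using TensorAlgebra.induction generalizing y with
  | algebraMap r =>
    rw [AlgHom.commutes, ← Algebra.smul_def, map_smul, ← Algebra.smul_def]
  | ι v =>
    obtain ⟨x, rfl⟩ := Submodule.Quotient.mk_surjective _ v
    have : chainWeight k X ∘ₗ LinearMap.mulRight k y ∘ₗ chainsImage k X =
        LinearMap.mulRight k (chainWeight k X y) ∘ₗ (X.awObj k).desusp :=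
      schains_ext fun c => by
        refine .trans ?_ (chainWeight_genImage_mul c y)
        exact congrArg (fun z => chainWeight k X (z * y)) (chainsImage_scell c)
    exact (congrArg (fun z => chainWeight k X (z * y)) (comparison_desusp x)).trans
      (LinearMap.congr_fun this x)
  | mul a b ha hb => rw [map_mul (comparison k X), mul_assoc, ha, hb, mul_assoc]
  | add a b ha hb => rw [map_add (comparison k X), add_mul, map_add, ha, hb, add_mul]

lemma comparison_injective : Function.Injective (comparison k X) := by
  refine Function.LeftInverse.injective (g := chainWeight k X) fun a => ?_
  have := chainWeight_comparison_mul a 1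
  rwa [mul_one, chainWeight_one, mul_one] at this

end

section

/-! ### The natural isomorphism -/

namespace DGAlg

variable {k : Type v} [CommRing k] {A B : DGAlg.{v, w} k}

open Classical in
/-- The projection of a graded algebra to a homogeneous component. -/
def proj (A : DGAlg.{v, w} k) (n : ℤ) : A.carrier →ₗ[k] A.carrier :=
  gradedLift A.isInternal fun m => if m = n then (A.grading m).subtype else 0

lemma proj_of_mem {m n : ℤ} {x : A.carrier} (hx : x ∈ A.grading m) :
    A.proj n x = if m = n then x else 0 := by
  rw [proj, gradedLift_of_mem A.isInternal _ hx]
  split_ifs <;> rfl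

lemma proj_mem (n : ℤ) (x : A.carrier) : A.proj n x ∈ A.grading n := by
  have : (⊤ : Submodule k A.carrier) ≤ (A.grading n).comap (A.proj n) := by
    rw [← A.isInternal.submodule_iSup_eq_top]
    refine iSup_le fun m y hy => ?_
    rw [Submodule.mem_comap, proj_of_mem hy]
    split_ifs with h
    exacts [h ▸ hy, zero_mem _]
  exact this (Submodule.mem_top (x := x))

lemma Hom.map_proj (f : Hom A B) (n : ℤ) (x : A.carrier) :
    f.toAlgHom (A.proj n x) = B.proj n (f.toAlgHom x) := by
  have : f.toAlgHom.toLinearMap ∘ₗ A.proj n = B.proj n ∘ₗ f.toAlgHom.toLinearMap := by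
    refine graded_ext A.isInternal fun m y hy => ?_
    simp only [LinearMap.comp_apply, AlgHom.toLinearMap_apply]
    rw [proj_of_mem hy, proj_of_mem (f.map_mem hy)]
    split_ifs
    exacts [rfl, map_zero _]
  exact LinearMap.congr_fun this x

/-- Morphisms commute with the homogeneous projections, so an injective one reflects degrees. This
makes the inverse of a bijective morphism preserve degrees. -/
lemma Hom.mem_of_map_mem (f : Hom A B) (hf : Function.Injective f.toAlgHom) {n : ℤ} {x : A.carrier}
    (hx : f.toAlgHom x ∈ B.grading n) : x ∈ A.grading n := by
  have : A.proj n x = x := hf (by rw [f.map_proj, proj_of_mem hx, if_pos rfl])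
  exact this ▸ proj_mem n x

/-- A bijective morphism of differential graded algebras is an isomorphism. -/
def isoOfBijective (f : A ⟶ B) (hf : Function.Bijective (Hom.toAlgHom f)) : A ≅ B :=
  let e := AlgEquiv.ofBijective (Hom.toAlgHom f) hf
  have he (x : B.carrier) : Hom.toAlgHom f (e.symm x) = x := e.apply_symm_apply x
  { hom := f
    inv := Hom.mk (A := B) (B := A) e.symm.toAlgHom
      (fun {_ x} hx => Hom.mem_of_map_mem f hf.1 (x := e.symm x) ((he x).symm ▸ hx))
      (fun x => hf.1 ((he (B.d x)).trans
        ((Hom.map_d f (e.symm x)).trans (congrArg B.d (he x))).symm))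
    hom_inv_id := Hom.ext (AlgHom.ext fun x => e.symm_apply_apply x)
    inv_hom_id := Hom.ext (AlgHom.ext he) }

end DGAlg

variable (k : Type v) [CommRing k]

/-- The comparison isomorphism. -/
def comparisonIso (X : ReducedSSet.{u}) :
    (X.awObj k).cobarObj ≅ (cubicalChains k).obj (ccobar.obj X) :=
  DGAlg.isoOfBijective (comparisonHom k X) ⟨comparison_injective, comparison_surjective⟩

/-- The chains of the cubical cobar construction are the cobar construction of the chains. -/
def cubicalCobarIso : ccobar.{u} ⋙ cubicalChains k ≅ awChains k ⋙ cobar k :=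
  -- The isomorphism is built out of the cobar construction, where maps are determined by
  -- generators, and then inverted.
  (NatIso.ofComponents (F := awChains k ⋙ cobar k) (G := ccobar.{u} ⋙ cubicalChains k)
    (fun X => comparisonIso k X) fun f =>
      DGAlg.Hom.ext (AlgHom.ext fun x => comparison_naturality f x)).symm

end

end CubicalCobar

end

theorem lemmal (k : Type v) [CommRing k] :
    Nonempty (CubicalCobar.ccobar.{u} ⋙ CubicalCobar.cubicalChains k ≅
      CubicalCobar.awChains k ⋙ CubicalCobar.cobar k) :=
  ⟨CubicalCobar.cubicalCobarIso k⟩
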